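/- **Setting.** Let $d\ge 2$ and write $x=(\tilde x,x_d)\in[0,1]^{d-1}\times[0,1]$. A classification problem is a probability measure $\mathbb P_X$ on $[0,1]^d$ together with a measurable regression function $\eta:[0,1]^d\to[0,1]$, $\eta(x)=\mathbb P(Y=1\mid X=x)$, $Y\in\{0,1\}$. For $f:[0,1]^d\to\{0,1\}$ let $R(f)=\mathbb P(Y\ne f(X))$, $f^*=\mathbf 1\{\eta\ge 1/2\}$ and $\mathcal E(f)=R(f)-R(f^*)$. A learner may request labels at points $x$ of its choice; each request at $x$ is answered by a fresh independent label of law $\mathrm{Bernoulli}(\eta(x))$. For $a>0$ let $\lfloor a\rfloor_-$ be the largest integer strictly smaller than $a$. The class $\Sigma(\lambda,\alpha)$ consists of the functions $g:[0,1]^{d-1}\to[0,1]$ that are $\lfloor\alpha\rfloor_-$ times continuously differentiable and satisfy $|g(x)-\mathrm{TP}_{y,\lfloor\beta\rfloor_-}(x)|\le\lambda\|x-y\|_\infty^\beta$ for all $x,y\in[0,1]^{d-1}$ and $0<\beta\le\alpha$, where $\mathrm{TP}_{y,k}$ is the Taylor polynomial of $g$ of degree $k$ at $y$. **Assumptions.**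 For some $g^*\in\Sigma(\lambda,\alpha)$ with $\lambda\ge1$, $\alpha>0$, and constants $c>0$, $\kappa>1$, $\kappa'>0$, $C_M>0$, $\Delta_0>0$: 1. $\{x:\eta(x)\ge1/2\}=\{x\in[0,1]^d:x_d\ge g^*(\tilde x)\}$; 2. $|\eta(x)-\tfrac12|\ge c\,|x_d-g^*(\tilde x)|^{\kappa-1}$ for all $x\in[0,1]^d$; 3. $\int_{\{x:|x_d-g^*(\tilde x)|\le\Delta\}}|1-2\eta|\,d\mathbb P_X\le C_M\Delta^{\kappa'}$ for all $\Delta\in[0,\Delta_0]$. **Line search** with parameters $(\varepsilon,\delta)$ on the line above $\tilde x$. Let $K=\lceil\log_2\frac1{2\varepsilon}\rceil$ and $[L_1,R_1]=[0,1]$. For $k=1,\dots,K-1$ put $\delta_k=\delta/(K2^k)$ and let $U<M<V$ be the points that divide $[L_k,R_k]$ into four equal parts. In rounds $t=1,2,\dots$ request one fresh label at each of $(\tilde x,U),(\tilde x,M),(\tilde x,V)$; let $\hat\eta_t(\cdot)$ be the mean of the $t$ labels received at a point in this epoch and $r_t=2\sqrt{\log(t/\delta_k)/(2t)}$. The epoch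 ends at the first $t$ with $|\hat\eta_t(M)-\frac12|\ge r_t$, or with both $\hat\eta_t(V)-\frac12\ge r_t$ and $\frac12-\hat\eta_t(U)\ge r_t$. In the first case $[L_{k+1},R_{k+1}]=[L_k,M]$ if $\hat\eta_t(M)>\frac12$ and $[M,R_k]$ otherwise; if only the second condition holds, $[L_{k+1},R_{k+1}]=[U,V]$. The threshold estimate is the midpoint of the last interval ($\frac12$ if there is no epoch). **Subroutine** with parameters $(n,\delta,\alpha,\lambda)$. Put $m=\lfloor\alpha\rfloor_-$. At depth $l=1,2,\dots$ let $M_l=\max(1,m)2^l$, $\varepsilon_l=\lambda2^{-l\alpha}$, $\delta_l=\delta/(\max(1,m)2^{l(d+1)})$, and run the line search with parameters $(\varepsilon_l,\delta_l)$ above each grid point $\tilde a/M_l$, $\tilde a\in\{0,\dots,M_l\}^{d-1}$, giving threshold estimates $T_{l,\tilde a}$. Stop when the budget of $n$ labels is spent, and let $l^*$ be the last depth all of whose line searches were completed. If $l^*=0$, output $S^0=S^1=\emptyset$. Otherwise let $\hat P$ be the following function: on each of the cells of side $2^{-l^*}$ that tile $[0,1]^{d-1}$, it is the tensor-product Lagrange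 interpolation, of degree $m$ in each variable, of the values $T_{l^*,\tilde a}$ at the grid points $\tilde a/M_{l^*}$ of the cell (for $\alpha\le1$: the constant $T_{l^*,\tilde a}$ with $\tilde a/M_{l^*}$ the lower corner of the cell). With $b=\lambda\lceil\alpha\rceil^{d\lceil\alpha\rceil}M_{l^*}^{-\alpha}$, output $S^0=\{x\in[0,1]^d:x_d\le\hat P(\tilde x)-4b\}$ and $S^1=\{x\in[0,1]^d:x_d\ge\hat P(\tilde x)+4b\}$. **Adaptive procedure** with parameters $(n,\delta,\lambda)$. Let $s_0^0=s_0^1=\emptyset$. For $i=1,\dots,\lfloor\log n\rfloor^2$ run the subroutine with fresh labels and parameters $\big(n/\lfloor\log n\rfloor^2,\ \delta/\lfloor\log n\rfloor^2,\ i/\lfloor\log n\rfloor,\ \lambda\big)$ to get $S_i^0,S_i^1$, and set $s_i^y=s_{i-1}^y\cup(S_i^y\setminus s_{i-1}^{1-y})$ for $y\in\{0,1\}$. Let $S^1$ be the final set $s_i^1$, let $\hat g_n(\tilde x)=\inf\{x_d:(\tilde x,x_d)\in S^1\}$ (the infimum in $[0,1]$, so $\inf\emptyset=1$), and let $\hat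 f_n(x)=\mathbf 1\{x_d\ge\hat g_n(\tilde x)\}$. **Claim.** Fix $d,c,\alpha,\kappa,\Delta_0$. There is a function $N=N(\lambda,\delta)$ such that for all $\kappa',C_M>0$ there is a constant $C>0$ for which the following holds for all $\lambda\ge1$, $\delta>0$ and $n\ge N(\lambda,\delta)$ with $\alpha\in[\lfloor\log n\rfloor^{-1},\lfloor\log n\rfloor]$, and all problems satisfying assumptions 1–3 with these constants. With probability at least $1-2\delta$, $$\mathcal E(\hat f_n)\le C\,\lambda^{\frac{\kappa'(d-1)}{2\alpha(\kappa-1)+d-1}}\Big(\frac{\log^3(n/\delta)}{n}\Big)^{\frac{\alpha\kappa'}{2\alpha(\kappa-1)+d-1}},$$ and, on the same event, the classifier $\mathbf 1\{x\in S^1\}$ (which can differ from $\hat f_n$ only where $x_d=\hat g_n(\tilde x)$) satisfies the same bound. In particular $C$ does not depend on $\lambda,n,\delta$. -/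

import Mathlib

open MeasureTheory ProbabilityTheory

noncomputable section

namespace ActiveBoundary

/-! ### Feature space and classification problems -/

/-- Points `x = (x̃, x_d)` of `ℝ^{d-1} × ℝ`; the first factor carries the sup norm. -/
abbrev Point (d : ℕ) : Type := (Fin (d - 1) → ℝ) × ℝ

/-- The cube `[0,1]^{d-1}`. -/
def baseCube (d : ℕ) : Set (Fin (d - 1) → ℝ) := Set.Icc 0 1

/-- The cube `[0,1]^d = [0,1]^{d-1} × [0,1]`. -/
def cube (d : ℕ) : Set (Point d) := baseCube d ×ˢ Set.Icc (0 : ℝ) 1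

/-- A binary classification problem on `[0,1]^d`, given by the marginal law `P_X` of the feature and
the regression function `η(x) = P(Y = 1 | X = x)`, which is specified at every point of the cube
(its values outside the cube play no role). -/
structure Problem (d : ℕ) where
  PX : Measure (Point d)
  isProb : IsProbabilityMeasure PX
  supported : PX (cube d)ᶜ = 0
  eta : Point d → ℝ
  eta_measurable : Measurable eta
  eta_mem : ∀ x ∈ cube d, eta x ∈ Set.Icc (0 : ℝ) 1

/-- The joint law of `(X, Y)`; the label `1` is `true`, the label `0` is `false`. -/
def Problem.joint {d : ℕ} (P : Problem d) : Measure (Point d × Bool) :=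
  (P.PX.withDensity fun x => ENNReal.ofReal (P.eta x)).map (fun x => (x, true)) +
    (P.PX.withDensity fun x => ENNReal.ofReal (1 - P.eta x)).map (fun x => (x, false))

/-- The `0`-`1` risk `R(f) = P(Y ≠ f(X))`. -/
def Problem.risk {d : ℕ} (P : Problem d) (f : Point d → Bool) : ℝ :=
  (P.joint {p | p.2 ≠ f p.1}).toReal

open Classical in
/-- The Bayes classifier `1{η(x) ≥ 1/2}`. -/
def Problem.bayes {d : ℕ} (P : Problem d) (x : Point d) : Bool := decide (1 / 2 ≤ P.eta x)

/-- The excess risk `R(f) - R(f*)`. -/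
def Problem.excessRisk {d : ℕ} (P : Problem d) (f : Point d → Bool) : ℝ :=
  P.risk f - P.risk P.bayes

/-! ### Assumptions on the problem -/

/-- The largest integer strictly smaller than `α` (for `α > 0`). -/
def strictFloor (α : ℝ) : ℕ := ⌈α⌉₊ - 1

/-- The Taylor polynomial of degree `k` of `g` at `y`, evaluated at `x`; derivatives are taken
within the cube. -/
def taylorPoly {d : ℕ} (g : (Fin (d - 1) → ℝ) → ℝ) (k : ℕ) (y x : Fin (d - 1) → ℝ) : ℝ :=
  ∑ j ∈ Finset.range (k + 1),
    ((j.factorial : ℝ))⁻¹ * iteratedFDerivWithin ℝ j g (baseCube d) y (fun _ => x - y)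

/-- The Hölder class `Σ(λ, α)` of functions `[0,1]^{d-1} → [0,1]`. -/
structure HolderClass {d : ℕ} (lam α : ℝ) (g : (Fin (d - 1) → ℝ) → ℝ) : Prop where
  mapsTo : Set.MapsTo g (baseCube d) (Set.Icc 0 1)
  contDiffOn : ContDiffOn ℝ (strictFloor α : ℕ) g (baseCube d)
  taylor_bound : ∀ β : ℝ, 0 < β → β ≤ α → ∀ x ∈ baseCube d, ∀ y ∈ baseCube d,
    |g x - taylorPoly g (strictFloor β) y x| ≤ lam * ‖x - y‖ ^ β

/-- The epigraph of `g` in the cube. -/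
def epi {d : ℕ} (g : (Fin (d - 1) → ℝ) → ℝ) : Set (Point d) := {x ∈ cube d | g x.1 ≤ x.2}

/-- Smoothness of the decision boundary: `{x : η(x) ≥ 1/2}` is the epigraph of a function `g` of
the class `Σ(λ, α)`. -/
def SmoothBoundary {d : ℕ} (P : Problem d) (lam α : ℝ) (g : (Fin (d - 1) → ℝ) → ℝ) : Prop :=
  HolderClass lam α g ∧ {x ∈ cube d | 1 / 2 ≤ P.eta x} = epi g

/-- The geometric noise condition, relative to the boundary function `g`. -/
def GeometricNoise {d : ℕ} (P : Problem d) (c κ : ℝ) (g : (Fin (d - 1) → ℝ) → ℝ) : Prop :=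
  ∀ x ∈ cube d, c * |x.2 - g x.1| ^ (κ - 1) ≤ |P.eta x - 1 / 2|

/-- The risk carried by the points within distance `Δ` of the boundary is at most `C Δ^{κ'}`, for
all `Δ ∈ [0, Δ₀]`. -/
def BoundaryMass {d : ℕ} (P : Problem d) (CM Δ₀ κ' : ℝ) (g : (Fin (d - 1) → ℝ) → ℝ) : Prop :=
  ∀ Δ ∈ Set.Icc (0 : ℝ) Δ₀,
    ∫ x in {x ∈ cube d | |x.2 - g x.1| ≤ Δ}, |1 - 2 * P.eta x| ∂P.PX ≤ CM * Δ ^ κ'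

/-! ### Label requests -/

/-- A label request. The algorithm never makes two requests with the same address: `run` is the
call of the subroutine, `depth` the depth of the grid, `epoch` the epoch of the line search that
makes the request, `pt` the point at which a label is requested, and `rep` counts the requests made
at this point in this epoch. -/
structure Request (d : ℕ) where
  run : ℕ
  depth : ℕ
  epoch : ℕ
  rep : ℕ
  pt : Point d

/-- `Y r` is the answer to the request `r`: the answers to distinct requests are independent, and
a request at the point `x` is answered by a label with law `P_{Y | X = x}`. -/
structure IsLabelOracle {d : ℕ} (P : Problem d) {Ω : Type*} [MeasurableSpace Ω] (μ : Measure Ω)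
    (Y : Request d → Ω → Bool) : Prop where
  measurable : ∀ r, Measurable (Y r)
  indep : iIndepFun Y μ
  law : ∀ r, r.pt ∈ cube d → μ {ω | Y r ω = true} = ENNReal.ofReal (P.eta r.pt)

/-! ### Line search

`lab k z s` is the answer to the `s`-th request (`s = 1, 2, …`) made in epoch `k` at height `z` on
the line that is being searched. -/

/-- The mean of the first `t` labels received at height `z` in epoch `k`. -/
def empMean (lab : ℕ → ℝ → ℕ → Bool) (k : ℕ) (z : ℝ) (t : ℕ) : ℝ :=
  (∑ s ∈ Finset.Icc 1 t, if lab k z s then (1 : ℝ) else 0) / t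

/-- The confidence term `2 √(log(t/δ) / (2t))`. -/
def confRadius (δ : ℝ) (t : ℕ) : ℝ := 2 * Real.sqrt (Real.log (t / δ) / (2 * t))

/-- After `t` rounds the label of the midpoint `M` of `[L, R]` is known with confidence. -/
def midDecided (lab : ℕ → ℝ → ℕ → Bool) (δk : ℝ) (k : ℕ) (L R : ℝ) (t : ℕ) : Prop :=
  confRadius δk t ≤ |empMean lab k ((L + R) / 2) t - 1 / 2|

/-- After `t` rounds the labels of the quartiles `U` and `V` of `[L, R]` are known with confidence
to be `0` and `1`. -/
def quartilesDecided (lab : ℕ → ℝ → ℕ → Bool) (δk : ℝ) (k : ℕ) (L R : ℝ) (t : ℕ) : Prop :=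
  confRadius δk t ≤ empMean lab k ((L + R) / 2 + (R - L) / 4) t - 1 / 2 ∧
    confRadius δk t ≤ 1 / 2 - empMean lab k (L + (R - L) / 4) t

/-- The rounds at which epoch `k` on `[L, R]` may end; it ends at the first of them. -/
def endRounds (lab : ℕ → ℝ → ℕ → Bool) (δk : ℝ) (k : ℕ) (L R : ℝ) : Set ℕ :=
  {t | 1 ≤ t ∧ (midDecided lab δk k L R t ∨ quartilesDecided lab δk k L R t)}

/-- The number of labels that epoch `k` requests (three per round; `⊤` if it never ends). -/
def epochCost (lab : ℕ → ℝ → ℕ → Bool) (δk : ℝ) (k : ℕ) (L R : ℝ) : ℕ∞ :=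
  3 * ⨅ t ∈ endRounds lab δk k L R, (t : ℕ∞)

open Classical in
/-- The interval that epoch `k`, started on `[L, R]`, hands over to the next epoch. -/
def epochNext (lab : ℕ → ℝ → ℕ → Bool) (δk : ℝ) (k : ℕ) (L R : ℝ) : ℝ × ℝ :=
  let t := sInf (endRounds lab δk k L R)
  if midDecided lab δk k L R t then
    if 1 / 2 < empMean lab k ((L + R) / 2) t then (L, (L + R) / 2) else ((L + R) / 2, R)
  else (L + (R - L) / 4, (L + R) / 2 + (R - L) / 4)

/-- `K = ⌈log₂(1/(2ε))⌉` (read as `0` when it is negative). -/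
def searchDepth (ε : ℝ) : ℕ := ⌈Real.logb 2 (1 / (2 * ε))⌉₊

/-- The interval `[L_{k+1}, R_{k+1}]` reached after the epochs `1, …, k`, and the number of labels
requested in them. -/
def searchState (lab : ℕ → ℝ → ℕ → Bool) (ε δ : ℝ) : ℕ → (ℝ × ℝ) × ℕ∞
  | 0 => ((0, 1), 0)
  | k + 1 =>
    let s := searchState lab ε δ k
    let δk := δ / (searchDepth ε * 2 ^ (k + 1))
    (epochNext lab δk (k + 1) s.1.1 s.1.2, s.2 + epochCost lab δk (k + 1) s.1.1 s.1.2)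

/-- The threshold estimate of the line search: the midpoint of the interval reached after the
epochs `1, …, K - 1`. -/
def searchThreshold (lab : ℕ → ℝ → ℕ → Bool) (ε δ : ℝ) : ℝ :=
  let s := searchState lab ε δ (searchDepth ε - 1)
  (s.1.1 + s.1.2) / 2

/-- The number of labels that the line search requests. -/
def searchCost (lab : ℕ → ℝ → ℕ → Bool) (ε δ : ℝ) : ℕ∞ :=
  (searchState lab ε δ (searchDepth ε - 1)).2

/-! ### The procedure in dimension `d` with known smoothness

`lab` answers the requests of one call, in the order depth, epoch, point, repetition. -/

/-- `max(1, ⌊α⌋)`. -/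
def cellDegree (α : ℝ) : ℕ := max 1 (strictFloor α)

/-- `M_l = max(1, ⌊α⌋) 2^l`. -/
def gridSize (α : ℝ) (l : ℕ) : ℕ := cellDegree α * 2 ^ l

/-- The precision `ε_l` of the line searches at depth `l`. -/
def depthPrec (lam α : ℝ) (l : ℕ) : ℝ := lam * (2 : ℝ) ^ (-((l : ℝ) * α))

/-- The confidence parameter `δ_l` of the line searches at depth `l`. -/
def depthConf (d : ℕ) (δ α : ℝ) (l : ℕ) : ℝ := δ / (cellDegree α * 2 ^ (l * (d + 1)))

/-- The labels received on the line above the grid point `M_l⁻¹ ã`. -/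
def lineLabels {d : ℕ} (lab : ℕ → ℕ → Point d → ℕ → Bool) (α : ℝ) (l : ℕ)
    (a : Fin (d - 1) → ℕ) : ℕ → ℝ → ℕ → Bool :=
  fun k z s => lab l k (fun i => (a i : ℝ) / gridSize α l, z) s

/-- The threshold estimate `T_{l, ã}`. -/
def threshold {d : ℕ} (lab : ℕ → ℕ → Point d → ℕ → Bool) (δ lam α : ℝ) (l : ℕ)
    (a : Fin (d - 1) → ℕ) : ℝ :=
  searchThreshold (lineLabels lab α l a) (depthPrec lam α l) (depthConf d δ α l)

/-- The number `N_l` of labels requested by the line searches above all the grid points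
`ã ∈ {0, …, M_l}^{d-1}`. -/
def depthCost {d : ℕ} (lab : ℕ → ℕ → Point d → ℕ → Bool) (δ lam α : ℝ) (l : ℕ) : ℕ∞ :=
  ∑ a ∈ Fintype.piFinset fun _ : Fin (d - 1) => Finset.range (gridSize α l + 1),
    searchCost (lineLabels lab α l a) (depthPrec lam α l) (depthConf d δ α l)

/-- The last depth `l*` all of whose line searches end within the budget of `n` labels. The labels
that are requested at depth `l* + 1` before the budget is spent are not used. -/
def lastDepth {d : ℕ} (lab : ℕ → ℕ → Point d → ℕ → Bool) (n : ℕ) (δ lam α : ℝ) : ℕ :=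
  sSup {l : ℕ | ∑ j ∈ Finset.Icc 1 l, depthCost lab δ lam α j ≤ (n : ℕ∞)}

/-- The index `q̃` of a cell of side `2^{-l}` that contains `x̃`. -/
def cellIndex {d : ℕ} (l : ℕ) (x : Fin (d - 1) → ℝ) (i : Fin (d - 1)) : ℕ :=
  min ⌊x i * 2 ^ l⌋₊ (2 ^ l - 1)

/-- The boundary estimate `P̂` at depth `l`: on each cell, the tensor-product Lagrange interpolation
of degree `⌊α⌋` of the threshold estimates. For `α ≤ 1` the degree is `0`, and `P̂` is on each cell
the threshold estimate at its lower corner. -/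
def interp {d : ℕ} (T : (Fin (d - 1) → ℕ) → ℝ) (α : ℝ) (l : ℕ) (x : Fin (d - 1) → ℝ) : ℝ :=
  let node : Fin (d - 1) → ℕ → ℕ := fun i j => cellDegree α * cellIndex l x i + j
  ∑ j ∈ Fintype.piFinset fun _ : Fin (d - 1) => Finset.range (strictFloor α + 1),
    T (fun i => node i (j i)) *
      ∏ i, ∏ j' ∈ (Finset.range (strictFloor α + 1)).erase (j i),
        (x i - (node i j' : ℝ) / gridSize α l) /
          ((node i (j i) : ℝ) / gridSize α l - (node i j' : ℝ) / gridSize α l)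

/-- The bias term `b_l = λ ⌈α⌉^{d⌈α⌉} M_l^{-α}`. -/
def biasTerm (d : ℕ) (lam α : ℝ) (l : ℕ) : ℝ :=
  lam * (⌈α⌉₊ : ℝ) ^ (d * ⌈α⌉₊) * (gridSize α l : ℝ) ^ (-α)

/-- The sets `(S⁰, S¹)` that the procedure labels `0` and `1`. If not even the first depth could be
completed, then no point is labeled. -/
def subroutine {d : ℕ} (lab : ℕ → ℕ → Point d → ℕ → Bool) (n : ℕ) (δ lam α : ℝ) :
    Set (Point d) × Set (Point d) :=
  let l := lastDepth lab n δ lam α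
  let Phat := interp (threshold lab δ lam α l) α l
  ({x ∈ cube d | 1 ≤ l ∧ x.2 ≤ Phat x.1 - 4 * biasTerm d lam α l},
    {x ∈ cube d | 1 ≤ l ∧ Phat x.1 + 4 * biasTerm d lam α l ≤ x.2})

/-! ### The adaptive procedure -/

/-- `⌊log n⌋`. -/
def logFloor (n : ℕ) : ℕ := ⌊Real.log n⌋₊

/-- The pair `(S⁰_i, S¹_i)` returned by the `i`-th call of the subroutine, with smoothness
`i / ⌊log n⌋`, confidence `δ / ⌊log n⌋²` and budget `n / ⌊log n⌋²` (rounded down, as a number of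
labels is an integer). -/
def call {d : ℕ} (lab : Request d → Bool) (n : ℕ) (δ lam : ℝ) (i : ℕ) :
    Set (Point d) × Set (Point d) :=
  subroutine (fun l k x s => lab ⟨i, l, k, s, x⟩) (n / logFloor n ^ 2) (δ / (logFloor n : ℝ) ^ 2)
    lam ((i : ℝ) / logFloor n)

/-- The pair `(s⁰_i, s¹_i)` of sets labeled after the first `i` calls. -/
def aggregate {d : ℕ} (lab : Request d → Bool) (n : ℕ) (δ lam : ℝ) :
    ℕ → Set (Point d) × Set (Point d)
  | 0 => (∅, ∅)
  | i + 1 =>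
    let s := aggregate lab n δ lam i
    let S := call lab n δ lam (i + 1)
    (s.1 ∪ (S.1 \ s.2), s.2 ∪ (S.2 \ s.1))

/-- The set `S¹` finally labeled `1`. -/
def labeledOne {d : ℕ} (lab : Request d → Bool) (n : ℕ) (δ lam : ℝ) : Set (Point d) :=
  (aggregate lab n δ lam (logFloor n ^ 2)).2

/-- The estimated boundary `ĝ_n(x̃) = inf {x_d : (x̃, x_d) ∈ S¹}`, the infimum being taken in
`[0,1]` (so it is `1` if no point above `x̃` is in `S¹`). -/
def boundaryEstimate {d : ℕ} (lab : Request d → Bool) (n : ℕ) (δ lam : ℝ)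
    (x : Fin (d - 1) → ℝ) : ℝ :=
  sInf (insert 1 {z : ℝ | (x, z) ∈ labeledOne lab n δ lam})

open Classical in
/-- The plug-in classifier `1{x_d ≥ ĝ_n(x̃)}`. -/
def classifier {d : ℕ} (lab : Request d → Bool) (n : ℕ) (δ lam : ℝ) (x : Point d) : Bool :=
  decide (boundaryEstimate lab n δ lam x.1 ≤ x.2)

open Classical in
/-- The classifier `1{x ∈ S¹}`. It can differ from `1{x_d ≥ ĝ_n(x̃)}` only where `x_d = ĝ_n(x̃)`,
namely where the infimum that defines `ĝ_n` is not attained. -/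
def setClassifier {d : ℕ} (lab : Request d → Bool) (n : ℕ) (δ lam : ℝ) (x : Point d) : Bool :=
  decide (x ∈ labeledOne lab n δ lam)

end ActiveBoundary

end

noncomputable section

namespace ActiveBoundary

/-!
With high probability every line search is accurate: its empirical means stay within the confidence
radii, so it locates the boundary up to twice its precision `ε`, at the cost of about
`ε^{-2(κ-1)} log(1/δ)` labels. Tensor-product Lagrange interpolation reproduces Taylor polynomials,
so a call of the subroutine whose smoothness `α'` is at most `α` satisfies `|P̂ - g| ≤ 3b`: it never
mislabels a point, and it labels every point at distance at least `7b` from the boundary.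

The adaptive procedure runs the calls in order of increasing smoothness. Those with `α' ≤ α` are
correct, and the last of them labels every point outside a band around the boundary. Labels are
never revised, so the possibly wrong later calls do no harm outside this band. Replacing `α` by the
smoothness `α'` of that call, which is within `1/⌊log n⌋` of `α`, costs a constant factor only,
since `λ` and `n/log³(n/δ)` are at most `e^{O(log n)}`. The excess risk is at most the mass that
assumption 3 gives to the band.
-/

/-! ### Tensor-product Lagrange interpolation -/

section TensorLagrange

variable {F ι κ : Type*} [Field F] [DecidableEq κ] {s : Finset κ}

theorem eval_lagrangeBasis (v : κ → F) (x : F) (j : κ) :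
    (Lagrange.basis s v j).eval x = ∏ j' ∈ s.erase j, (x - v j') / (v j - v j') := by
  simp only [Lagrange.basis, Lagrange.basisDivisor, Polynomial.eval_prod, Polynomial.eval_mul,
    Polynomial.eval_C, Polynomial.eval_sub, Polynomial.eval_X, div_eq_inv_mul]

theorem sum_pow_sub_mul_eval_lagrangeBasis {v : κ → F} (hv : Set.InjOn v s) (x : F) {k : ℕ}
    (hk : k < s.card) :
    ∑ j ∈ s, (v j - x) ^ k * (Lagrange.basis s v j).eval x = 0 ^ k := by
  have interpolate_eq := Lagrange.eq_interpolate_of_eval_eq (r := fun j => (v j - x) ^ k)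
    (f := (Polynomial.X - Polynomial.C x) ^ k) hv (by simpa using hk) (by simp)
  have eval_eq := congrArg (Polynomial.eval x) interpolate_eq
  simp only [Polynomial.eval_pow, Polynomial.eval_sub, Polynomial.eval_X, Polynomial.eval_C,
    sub_self, Lagrange.interpolate_apply, Polynomial.eval_finsetSum, Polynomial.eval_mul] at eval_eq
  exact eval_eq.symm

variable [Fintype ι]

/-- The weight of the node with index `j` in tensor-product Lagrange interpolation at `x`, the nodes
in direction `i` being `v i k` for `k ∈ s`. -/
def tensorWeight (s : Finset κ) (v : ι → κ → F) (x : ι → F) (j : ι → κ) : F :=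
  ∏ i, (Lagrange.basis s (v i) (j i)).eval (x i)

variable [DecidableEq ι]

theorem sum_tensorWeight_prod_pow {v : ι → κ → F} (hv : ∀ i, Set.InjOn (v i) s) (x : ι → F)
    {k : ι → ℕ} (hk : ∀ i, k i < s.card) :
    ∑ j ∈ Fintype.piFinset fun _ => s, (∏ i, (v i (j i) - x i) ^ k i) * tensorWeight s v x j =
      ∏ i, (0 : F) ^ k i := by
  simp_rw [tensorWeight, ← Finset.prod_mul_distrib]
  rw [← Finset.prod_univ_sum (fun _ => s) fun i n =>
    (v i n - x i) ^ k i * (Lagrange.basis s (v i) n).eval (x i)]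
  exact Finset.prod_congr rfl fun i _ => sum_pow_sub_mul_eval_lagrangeBasis (hv i) (x i) (hk i)

variable {R E M τ : Type*} [CommSemiring R] [AddCommMonoid E] [Module R E] [CommMonoid M]
  [Fintype τ]

theorem prod_comp_eq_prod_pow_card (u : ι → M) (r : τ → ι) :
    ∏ i, u (r i) = ∏ c, u c ^ (Finset.univ.filter (r · = c)).card := by
  rw [← Finset.prod_fiberwise' Finset.univ r u]
  simp only [Finset.prod_const]

theorem multilinearMap_diag_eq_sum [DecidableEq τ] (A : MultilinearMap R (fun _ : τ => ι → R) E)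
    (u : ι → R) :
    A (fun _ => u) = ∑ r : τ → ι, (∏ i, u (r i)) • A fun i => Pi.single (r i) 1 := by
  have expand : u = ∑ c, u c • (Pi.single c 1 : ι → R) := by
    ext c
    simp [Finset.sum_apply, Pi.single_apply]
  conv_lhs => rw [expand, A.map_sum]
  exact Finset.sum_congr rfl fun r _ => A.map_smul_univ _ _

theorem sum_tensorWeight_multilinearMap (hs : Fintype.card τ < s.card) {v : ι → κ → F}
    (hv : ∀ i, Set.InjOn (v i) s) (x : ι → F) (A : MultilinearMap F (fun _ : τ => ι → F) F) :
    ∑ j ∈ Fintype.piFinset fun _ => s,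
      A (fun _ => (fun i => v i (j i)) - x) * tensorWeight s v x j = A 0 := by
  classical
  have expand_zero := multilinearMap_diag_eq_sum A 0
  rw [show (A fun _ => 0) = A 0 from rfl] at expand_zero
  rw [expand_zero]
  simp_rw [fun u : ι → F => multilinearMap_diag_eq_sum A u, Finset.sum_mul]
  rw [Finset.sum_comm]
  refine Finset.sum_congr rfl fun r _ => ?_
  simp_rw [prod_comp_eq_prod_pow_card, Pi.zero_apply, smul_eq_mul]
  rw [← sum_tensorWeight_prod_pow hv x fun c => (Finset.card_le_univ _).trans_lt hs,
    Finset.sum_mul]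
  refine Finset.sum_congr rfl fun j _ => ?_
  simp only [Pi.sub_apply]
  ring

end TensorLagrange

theorem sum_taylorPoly_mul_tensorWeight {κ : Type*} [DecidableEq κ] {s : Finset κ} {d m : ℕ}
    (hm : m < s.card) {v : Fin (d - 1) → κ → ℝ} (hv : ∀ i, Set.InjOn (v i) s)
    (g : (Fin (d - 1) → ℝ) → ℝ) (x : Fin (d - 1) → ℝ) :
    ∑ j ∈ Fintype.piFinset fun _ => s,
      taylorPoly g m x (fun i => v i (j i)) * tensorWeight s v x j = g x := by
  set D := fun k => iteratedFDerivWithin ℝ k g (baseCube d) x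
  have sum_degree : ∀ k ∈ Finset.range (m + 1), ∑ j ∈ Fintype.piFinset fun _ => s,
      (k.factorial : ℝ)⁻¹ * D k (fun _ => (fun i => v i (j i)) - x) * tensorWeight s v x j =
        (k.factorial : ℝ)⁻¹ * D k 0 := by
    intro k hk
    have hk : Fintype.card (Fin k) < s.card := by
      rw [Fintype.card_fin]
      exact (Nat.lt_succ_iff.mp (Finset.mem_range.mp hk)).trans_lt hm
    simp_rw [mul_assoc, ← Finset.mul_sum]
    exact congrArg _ (sum_tensorWeight_multilinearMap hk hv x (D k).toMultilinearMap)
  simp_rw [taylorPoly, Finset.sum_mul]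
  rw [Finset.sum_comm, Finset.sum_congr rfl sum_degree, Finset.sum_range_succ',
    Finset.sum_eq_zero fun k _ => by rw [(D (k + 1)).map_coord_zero 0 rfl, mul_zero]]
  simp [D]

/-! ### Interpolation on the grid -/

section Grid

variable {d : ℕ} {α lam : ℝ} {l : ℕ} {x : Fin (d - 1) → ℝ}

theorem cellDegree_pos (α : ℝ) : 0 < cellDegree α := lt_of_lt_of_le one_pos (le_max_left _ _)

theorem strictFloor_le_cellDegree (α : ℝ) : strictFloor α ≤ cellDegree α := le_max_right _ _

theorem strictFloor_add_one (hα : 0 < α) : strictFloor α + 1 = ⌈α⌉₊ := by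
  have := Nat.ceil_pos.mpr hα
  simp only [strictFloor]
  omega

theorem cellDegree_le_ceil (hα : 0 < α) : cellDegree α ≤ ⌈α⌉₊ := by
  have := strictFloor_add_one hα
  simp only [cellDegree]
  omega

theorem one_le_ceil_cast (hα : 0 < α) : (1 : ℝ) ≤ ⌈α⌉₊ := by
  exact_mod_cast Nat.ceil_pos.mpr hα

theorem gridSize_pos (α : ℝ) (l : ℕ) : 0 < gridSize α l :=
  Nat.mul_pos (cellDegree_pos α) (by positivity)

theorem gridSize_cast_pos (α : ℝ) (l : ℕ) : (0 : ℝ) < gridSize α l := by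
  exact_mod_cast gridSize_pos α l

/-- The `j`-th grid coordinate in the cell whose index in the coordinate direction is `q`. -/
def gridNode (α : ℝ) (l q j : ℕ) : ℝ := ((cellDegree α * q + j : ℕ) : ℝ) / gridSize α l

theorem gridNode_eq_add (α : ℝ) (l q j : ℕ) :
    gridNode α l q j = (q : ℝ) / 2 ^ l + (j : ℝ) / gridSize α l := by
  have : (cellDegree α : ℝ) ≠ 0 := by exact_mod_cast (cellDegree_pos α).ne'
  simp only [gridNode, gridSize]
  push_cast
  field_simp

theorem gridNode_injective (α : ℝ) (l q : ℕ) : Function.Injective (gridNode α l q) := by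
  intro a b h
  have := Nat.cast_injective ((div_left_inj' (gridSize_cast_pos α l).ne').mp h)
  omega

theorem inv_gridSize_le_abs_gridNode_sub (α : ℝ) (l q : ℕ) {j j' : ℕ} (hne : j ≠ j') :
    (gridSize α l : ℝ)⁻¹ ≤ |gridNode α l q j - gridNode α l q j'| := by
  have one_le : (1 : ℝ) ≤ |(j : ℝ) - j'| := by
    have : (1 : ℤ) ≤ |(j : ℤ) - j'| := Int.one_le_abs (by omega)
    exact_mod_cast this
  rw [gridNode_eq_add, gridNode_eq_add, add_sub_add_left_eq_sub, ← sub_div, abs_div, Nat.abs_cast,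
    div_eq_mul_inv]
  exact le_mul_of_one_le_left (by positivity) one_le

theorem cellIndex_add_one_le (l : ℕ) (x : Fin (d - 1) → ℝ) (i : Fin (d - 1)) :
    cellIndex l x i + 1 ≤ 2 ^ l := by
  have := Nat.one_le_two_pow (n := l)
  simp only [cellIndex]
  omega

theorem cellIndex_div_le (hx : x ∈ baseCube d) (i : Fin (d - 1)) :
    (cellIndex l x i : ℝ) / 2 ^ l ≤ x i := by
  have : 0 ≤ x i := hx.1 i
  rw [div_le_iff₀ (by positivity)]
  exact (Nat.cast_le.mpr (min_le_left _ _)).trans (Nat.floor_le (by positivity))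

theorem le_cellIndex_add_one_div (hx : x ∈ baseCube d) (i : Fin (d - 1)) :
    x i ≤ ((cellIndex l x i : ℝ) + 1) / 2 ^ l := by
  rw [le_div_iff₀ (by positivity)]
  rcases min_choice ⌊x i * 2 ^ l⌋₊ (2 ^ l - 1) with h | h <;> rw [cellIndex, h]
  · exact (Nat.lt_floor_add_one _).le
  · rw [Nat.cast_sub Nat.one_le_two_pow]
    push_cast
    have le_one : x i ≤ 1 := hx.2 i
    have pow_pos : (0 : ℝ) < 2 ^ l := by positivity
    nlinarith

theorem abs_sub_gridNode_le (hx : x ∈ baseCube d) (i : Fin (d - 1)) {j : ℕ}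
    (hj : j ≤ cellDegree α) : |x i - gridNode α l (cellIndex l x i) j| ≤ ((2 : ℝ) ^ l)⁻¹ := by
  have lower := cellIndex_div_le (l := l) hx i
  have upper := le_cellIndex_add_one_div (l := l) hx i
  have offset_nonneg : 0 ≤ (j : ℝ) / gridSize α l := by positivity
  have offset_le : (j : ℝ) / gridSize α l ≤ ((2 : ℝ) ^ l)⁻¹ := by
    rw [div_le_iff₀ (gridSize_cast_pos α l), gridSize]
    push_cast
    field_simp
    exact_mod_cast hj
  rw [add_div, one_div] at upper
  rw [gridNode_eq_add, abs_le]
  constructor <;> linarith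

theorem abs_sub_gridNode_div_le (hx : x ∈ baseCube d) (i : Fin (d - 1)) {j j' : ℕ} (hne : j ≠ j')
    (hj' : j' ≤ cellDegree α) :
    |(x i - gridNode α l (cellIndex l x i) j') /
      (gridNode α l (cellIndex l x i) j - gridNode α l (cellIndex l x i) j')| ≤ cellDegree α := by
  have node_gap := inv_gridSize_le_abs_gridNode_sub α l (cellIndex l x i) hne
  have gap_pos := (inv_pos.mpr (gridSize_cast_pos α l)).trans_le node_gap
  have cell_width : ((2 : ℝ) ^ l)⁻¹ = cellDegree α * (gridSize α l : ℝ)⁻¹ := by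
    have : (cellDegree α : ℝ) ≠ 0 := by exact_mod_cast (cellDegree_pos α).ne'
    rw [gridSize]
    push_cast
    field_simp
  rw [abs_div, div_le_iff₀ gap_pos]
  calc _ ≤ ((2 : ℝ) ^ l)⁻¹ := abs_sub_gridNode_le hx i hj'
    _ = cellDegree α * (gridSize α l : ℝ)⁻¹ := cell_width
    _ ≤ _ := by gcongr

/-- The point of the cube with grid coordinates `a`. -/
def gridPoint (α : ℝ) (l : ℕ) (a : Fin (d - 1) → ℕ) : Fin (d - 1) → ℝ :=
  fun i => (a i : ℝ) / gridSize α l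

theorem gridPoint_mem {a : Fin (d - 1) → ℕ} (ha : ∀ i, a i ≤ gridSize α l) :
    gridPoint α l a ∈ baseCube d :=
  ⟨fun i => div_nonneg (Nat.cast_nonneg _) (Nat.cast_nonneg _), fun i =>
    (div_le_one (gridSize_cast_pos α l)).mpr (by exact_mod_cast ha i)⟩

/-- The indices, relative to its cell, of the grid points between which `interp` interpolates. -/
def localNodes (d : ℕ) (α : ℝ) : Finset (Fin (d - 1) → ℕ) :=
  Fintype.piFinset fun _ => Finset.range (strictFloor α + 1)

/-- The grid coordinates of the node with relative index `j` in the cell of `x`. -/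
def cellNode (α : ℝ) (l : ℕ) (x : Fin (d - 1) → ℝ) (j : Fin (d - 1) → ℕ) : Fin (d - 1) → ℕ :=
  fun i => cellDegree α * cellIndex l x i + j i

/-- The weight with which the value at the node `j` of the cell of `x` enters `interp` at `x`. -/
def nodeWeight (α : ℝ) (l : ℕ) (x : Fin (d - 1) → ℝ) (j : Fin (d - 1) → ℕ) : ℝ :=
  tensorWeight (Finset.range (strictFloor α + 1)) (fun i => gridNode α l (cellIndex l x i)) x j

theorem interp_eq_sum_nodeWeight (T : (Fin (d - 1) → ℕ) → ℝ) (α : ℝ) (l : ℕ)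
    (x : Fin (d - 1) → ℝ) :
    interp T α l x = ∑ j ∈ localNodes d α, T (cellNode α l x j) * nodeWeight α l x j := by
  simp only [nodeWeight, tensorWeight, eval_lagrangeBasis]
  rfl

theorem sum_taylorPoly_mul_nodeWeight (g : (Fin (d - 1) → ℝ) → ℝ) (α : ℝ) (l : ℕ)
    (x : Fin (d - 1) → ℝ) :
    ∑ j ∈ localNodes d α,
      taylorPoly g (strictFloor α) x (gridPoint α l (cellNode α l x j)) * nodeWeight α l x j =
        g x :=
  sum_taylorPoly_mul_tensorWeight (by simp) (fun _ => (gridNode_injective α l _).injOn) g x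

theorem le_cellDegree_of_mem_localNodes {j : Fin (d - 1) → ℕ} (hj : j ∈ localNodes d α)
    (i : Fin (d - 1)) : j i ≤ cellDegree α :=
  (Nat.lt_succ_iff.mp (Finset.mem_range.mp (Fintype.mem_piFinset.mp hj i))).trans
    (strictFloor_le_cellDegree α)

theorem cellNode_le_gridSize {j : Fin (d - 1) → ℕ} (hj : j ∈ localNodes d α) (i : Fin (d - 1)) :
    cellNode α l x j i ≤ gridSize α l :=
  calc cellDegree α * cellIndex l x i + j i
      ≤ cellDegree α * cellIndex l x i + cellDegree α := by
        gcongr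
        exact le_cellDegree_of_mem_localNodes hj i
    _ = cellDegree α * (cellIndex l x i + 1) := by ring
    _ ≤ _ := Nat.mul_le_mul_left _ (cellIndex_add_one_le l x i)

theorem norm_gridPoint_cellNode_sub_le (hx : x ∈ baseCube d) {j : Fin (d - 1) → ℕ}
    (hj : j ∈ localNodes d α) : ‖gridPoint α l (cellNode α l x j) - x‖ ≤ ((2 : ℝ) ^ l)⁻¹ := by
  refine (pi_norm_le_iff_of_nonneg (by positivity)).mpr fun i => ?_
  rw [Real.norm_eq_abs, Pi.sub_apply, abs_sub_comm]
  exact abs_sub_gridNode_le hx i (le_cellDegree_of_mem_localNodes hj i)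

theorem abs_nodeWeight_le (hx : x ∈ baseCube d) {j : Fin (d - 1) → ℕ} (hj : j ∈ localNodes d α) :
    |nodeWeight α l x j| ≤ ((cellDegree α : ℝ) ^ strictFloor α) ^ (d - 1) := by
  simp only [nodeWeight, tensorWeight, eval_lagrangeBasis, Finset.abs_prod]
  have factor_le : ∀ i, ∏ j' ∈ (Finset.range (strictFloor α + 1)).erase (j i),
      |(x i - gridNode α l (cellIndex l x i) j') /
        (gridNode α l (cellIndex l x i) (j i) - gridNode α l (cellIndex l x i) j')| ≤
      (cellDegree α : ℝ) ^ strictFloor α := by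
    intro i
    refine (Finset.prod_le_prod (g := fun _ => (cellDegree α : ℝ)) (fun _ _ => abs_nonneg _)
      fun j' hj' => ?_).trans_eq ?_
    · obtain ⟨hne, hr⟩ := Finset.mem_erase.mp hj'
      exact abs_sub_gridNode_div_le hx i hne.symm
        ((Nat.lt_succ_iff.mp (Finset.mem_range.mp hr)).trans (strictFloor_le_cellDegree α))
    · rw [Finset.prod_const, Finset.card_erase_of_mem (Fintype.mem_piFinset.mp hj i),
        Finset.card_range, Nat.add_sub_cancel]
  refine (Finset.prod_le_prod (fun i _ => Finset.prod_nonneg fun _ _ => abs_nonneg _)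
    fun i _ => factor_le i).trans_eq ?_
  simp

/-- A bound for the sum of the absolute values of the weights of tensor-product interpolation on a
cell. -/
def lebesgueBound (d : ℕ) (α : ℝ) : ℝ := ((⌈α⌉₊ : ℝ) ^ ⌈α⌉₊) ^ (d - 1)

theorem sum_abs_nodeWeight_le (hα : 0 < α) (hx : x ∈ baseCube d) :
    ∑ j ∈ localNodes d α, |nodeWeight α l x j| ≤ lebesgueBound d α := by
  have pow_le : (⌈α⌉₊ : ℝ) * (cellDegree α : ℝ) ^ strictFloor α ≤ (⌈α⌉₊ : ℝ) ^ ⌈α⌉₊ := by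
    conv_rhs => rw [← strictFloor_add_one hα, pow_succ', strictFloor_add_one hα]
    gcongr
    exact cellDegree_le_ceil hα
  calc _ ≤ (localNodes d α).card • ((cellDegree α : ℝ) ^ strictFloor α) ^ (d - 1) :=
        Finset.sum_le_card_nsmul _ _ _ fun j hj => abs_nodeWeight_le hx hj
    _ = ((⌈α⌉₊ : ℝ) * (cellDegree α : ℝ) ^ strictFloor α) ^ (d - 1) := by
        simp [localNodes, Fintype.card_piFinset, strictFloor_add_one hα, mul_pow]
    _ ≤ lebesgueBound d α := by
        rw [lebesgueBound]
        gcongr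

theorem depthPrec_nonneg (hlam : 0 ≤ lam) : 0 ≤ depthPrec lam α l := by
  rw [depthPrec]
  positivity

theorem inv_two_pow_rpow (l : ℕ) (α : ℝ) : (((2 : ℝ) ^ l)⁻¹) ^ α = (2 : ℝ) ^ (-((l : ℝ) * α)) := by
  rw [← Real.rpow_natCast, ← Real.rpow_neg (by norm_num), ← Real.rpow_mul (by norm_num), neg_mul]

theorem abs_sub_taylorPoly_le_depthPrec (hα : 0 < α) (hlam : 0 ≤ lam)
    {g : (Fin (d - 1) → ℝ) → ℝ} (hg : HolderClass lam α g) {y : Fin (d - 1) → ℝ}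
    (hy : y ∈ baseCube d) (hx : x ∈ baseCube d) (hyx : ‖y - x‖ ≤ ((2 : ℝ) ^ l)⁻¹) :
    |g y - taylorPoly g (strictFloor α) x y| ≤ depthPrec lam α l := by
  refine (hg.taylor_bound α hα le_rfl y hy x hx).trans (mul_le_mul_of_nonneg_left ?_ hlam)
  rw [← inv_two_pow_rpow]
  exact Real.rpow_le_rpow (norm_nonneg _) hyx hα.le

/-- Interpolation reproduces the Taylor polynomial of `g` at `x`, whose value at `x` is `g x`; hence
only the remainder at the nodes and the error of the node values contribute. -/
theorem abs_interp_sub_le {e : ℝ} (hα : 0 < α) (hlam : 0 ≤ lam) {g : (Fin (d - 1) → ℝ) → ℝ}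
    (hg : HolderClass lam α g) {T : (Fin (d - 1) → ℕ) → ℝ}
    (hT : ∀ a : Fin (d - 1) → ℕ, (∀ i, a i ≤ gridSize α l) → |T a - g (gridPoint α l a)| ≤ e)
    (hx : x ∈ baseCube d) :
    |interp T α l x - g x| ≤ (e + depthPrec lam α l) * lebesgueBound d α := by
  have node_error : ∀ j ∈ localNodes d α,
      |T (cellNode α l x j) - taylorPoly g (strictFloor α) x (gridPoint α l (cellNode α l x j))| ≤
        e + depthPrec lam α l := fun j hj =>
    have hnode := cellNode_le_gridSize hj
    (abs_sub_le _ (g (gridPoint α l (cellNode α l x j))) _).trans <|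
      add_le_add (hT _ hnode) <| abs_sub_taylorPoly_le_depthPrec hα hlam hg (gridPoint_mem hnode) hx
        (norm_gridPoint_cellNode_sub_le hx hj)
  have e_nonneg : 0 ≤ e := (abs_nonneg _).trans (hT (fun _ => 0) fun _ => Nat.zero_le _)
  conv_lhs => rw [interp_eq_sum_nodeWeight, ← sum_taylorPoly_mul_nodeWeight g α l x,
    ← Finset.sum_sub_distrib]
  calc _ ≤ ∑ j ∈ localNodes d α, (e + depthPrec lam α l) * |nodeWeight α l x j| := by
        refine (Finset.abs_sum_le_sum_abs _ _).trans (Finset.sum_le_sum fun j hj => ?_)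
        rw [← sub_mul, abs_mul]
        exact mul_le_mul_of_nonneg_right (node_error j hj) (abs_nonneg _)
    _ ≤ _ := by
        rw [← Finset.mul_sum]
        exact mul_le_mul_of_nonneg_left (sum_abs_nodeWeight_le hα hx)
          (add_nonneg e_nonneg (depthPrec_nonneg hlam))

theorem biasTerm_eq (d : ℕ) (lam α : ℝ) (l : ℕ) :
    biasTerm d lam α l =
      (⌈α⌉₊ : ℝ) ^ (d * ⌈α⌉₊) * (cellDegree α : ℝ) ^ (-α) * depthPrec lam α l := by
  rw [biasTerm, gridSize, depthPrec, ← inv_two_pow_rpow]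
  push_cast
  rw [Real.mul_rpow (by positivity) (by positivity), Real.inv_rpow (by positivity),
    Real.rpow_neg (x := (2 : ℝ) ^ l) (by positivity)]
  ring

theorem lebesgueBound_le (hd : 1 ≤ d) (hα : 0 < α) :
    lebesgueBound d α ≤ (⌈α⌉₊ : ℝ) ^ (d * ⌈α⌉₊) * (cellDegree α : ℝ) ^ (-α) := by
  have degree_pos : (0 : ℝ) < cellDegree α := by exact_mod_cast cellDegree_pos α
  have one_le := one_le_ceil_cast hα
  have degree_rpow_le : (cellDegree α : ℝ) ^ α ≤ (⌈α⌉₊ : ℝ) ^ ⌈α⌉₊ :=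
    calc (cellDegree α : ℝ) ^ α ≤ (⌈α⌉₊ : ℝ) ^ α := by
          gcongr
          exact cellDegree_le_ceil hα
      _ ≤ (⌈α⌉₊ : ℝ) ^ (⌈α⌉₊ : ℝ) := Real.rpow_le_rpow_of_exponent_le one_le (Nat.le_ceil α)
      _ = _ := Real.rpow_natCast _ _
  have pow_split : (⌈α⌉₊ : ℝ) ^ (d * ⌈α⌉₊) = lebesgueBound d α * (⌈α⌉₊ : ℝ) ^ ⌈α⌉₊ := by
    rw [lebesgueBound, ← pow_succ, ← pow_mul, mul_comm d, Nat.sub_add_cancel hd]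
  have lebesgue_nonneg : 0 ≤ lebesgueBound d α := by
    rw [lebesgueBound]
    positivity
  rw [pow_split, Real.rpow_neg degree_pos.le, mul_assoc, ← div_eq_mul_inv]
  exact le_mul_of_one_le_right lebesgue_nonneg ((one_le_div (by positivity)).mpr degree_rpow_le)

theorem depthPrec_mul_lebesgueBound_le_biasTerm (hd : 1 ≤ d) (hα : 0 < α) (hlam : 0 ≤ lam) :
    depthPrec lam α l * lebesgueBound d α ≤ biasTerm d lam α l := by
  rw [biasTerm_eq, mul_comm]
  exact mul_le_mul_of_nonneg_right (lebesgueBound_le hd hα) (depthPrec_nonneg hlam)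

theorem biasTerm_le (hα : 0 < α) (hlam : 0 ≤ lam) :
    biasTerm d lam α l ≤ (⌈α⌉₊ : ℝ) ^ (d * ⌈α⌉₊) * depthPrec lam α l := by
  have one_le_degree : (1 : ℝ) ≤ cellDegree α := by exact_mod_cast cellDegree_pos α
  rw [biasTerm_eq]
  refine mul_le_mul_of_nonneg_right ?_ (depthPrec_nonneg hlam)
  exact mul_le_of_le_one_right (by positivity)
    (Real.rpow_le_one_of_one_le_of_nonpos one_le_degree (neg_nonpos.mpr hα.le))

theorem biasTerm_pos (hα : 0 < α) (hlam : 0 < lam) : 0 < biasTerm d lam α l := by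
  have := one_le_ceil_cast hα
  have := gridSize_cast_pos α l
  rw [biasTerm]
  positivity

end Grid

/-! ### Line search -/

section LineSearch

variable {lab : ℕ → ℝ → ℕ → Bool} {h : ℝ → ℝ} {ε δ δk γ c κ L R : ℝ} {k : ℕ}

/-- `γ` is the point of `[0,1]` at which the regression function `h` on a line passes `1/2`. -/
structure IsThreshold (h : ℝ → ℝ) (γ : ℝ) : Prop where
  mem : γ ∈ Set.Icc (0 : ℝ) 1
  half_le_iff : ∀ z ∈ Set.Icc (0 : ℝ) 1, 1 / 2 ≤ h z ↔ γ ≤ z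

/-- The geometric noise condition for the regression function `h` on a line. -/
def HasMargin (c κ : ℝ) (h : ℝ → ℝ) (γ : ℝ) : Prop :=
  ∀ z ∈ Set.Icc (0 : ℝ) 1, c * |z - γ| ^ (κ - 1) ≤ |h z - 1 / 2|

/-- All the empirical means at the height `z` in epoch `k` are within the confidence radius of
`h z`. -/
def Accurate (lab : ℕ → ℝ → ℕ → Bool) (h : ℝ → ℝ) (δk : ℝ) (k : ℕ) (z : ℝ) : Prop :=
  ∀ t : ℕ, 1 ≤ t → |empMean lab k z t - h z| < confRadius δk t

/-- The labels are accurate at the three points that epoch `k`, run on `[L, R] ⊆ [0, 1]`, looks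
at. -/
structure EpochGood (lab : ℕ → ℝ → ℕ → Bool) (h : ℝ → ℝ) (δk : ℝ) (k : ℕ) (L R : ℝ) : Prop where
  nonneg : 0 ≤ L
  lt : L < R
  le_one : R ≤ 1
  lower : Accurate lab h δk k (L + (R - L) / 4)
  mid : Accurate lab h δk k ((L + R) / 2)
  upper : Accurate lab h δk k ((L + R) / 2 + (R - L) / 4)

theorem EpochGood.lower_mem (H : EpochGood lab h δk k L R) :
    L + (R - L) / 4 ∈ Set.Icc (0 : ℝ) 1 := by
  constructor <;> linarith [H.nonneg, H.lt, H.le_one]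

theorem EpochGood.mid_mem (H : EpochGood lab h δk k L R) : (L + R) / 2 ∈ Set.Icc (0 : ℝ) 1 := by
  constructor <;> linarith [H.nonneg, H.lt, H.le_one]

theorem EpochGood.upper_mem (H : EpochGood lab h δk k L R) :
    (L + R) / 2 + (R - L) / 4 ∈ Set.Icc (0 : ℝ) 1 := by
  constructor <;> linarith [H.nonneg, H.lt, H.le_one]

theorem IsThreshold.lt_half (hγ : IsThreshold h γ) {z : ℝ} (hz : z ∈ Set.Icc (0 : ℝ) 1)
    (hlt : z < γ) : h z < 1 / 2 :=
  lt_of_not_ge fun hle => hlt.not_ge ((hγ.half_le_iff z hz).mp hle)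

theorem mem_epochNext (hgood : EpochGood lab h δk k L R) (hγ : IsThreshold h γ)
    (hmem : γ ∈ Set.Icc L R) (hne : (endRounds lab δk k L R).Nonempty) :
    γ ∈ Set.Icc (epochNext lab δk k L R).1 (epochNext lab δk k L R).2 := by
  obtain ⟨ht, decided⟩ := Nat.sInf_mem hne
  simp only [epochNext]
  set t := sInf (endRounds lab δk k L R)
  have accM := abs_lt.mp (hgood.mid t ht)
  have accU := abs_lt.mp (hgood.lower t ht)
  have accV := abs_lt.mp (hgood.upper t ht)
  split_ifs with hmid hsign
  · rw [midDecided, abs_of_pos (sub_pos.mpr hsign)] at hmid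
    exact ⟨hmem.1, (hγ.half_le_iff _ hgood.mid_mem).mp (by linarith)⟩
  · rw [midDecided, abs_of_nonpos (sub_nonpos.mpr (not_lt.mp hsign))] at hmid
    refine ⟨?_, hmem.2⟩
    by_contra! hlt
    linarith [(hγ.half_le_iff _ hgood.mid_mem).mpr hlt.le]
  · obtain ⟨decV, decU⟩ := decided.resolve_left hmid
    refine ⟨?_, (hγ.half_le_iff _ hgood.upper_mem).mp (by linarith)⟩
    by_contra! hlt
    linarith [(hγ.half_le_iff _ hgood.lower_mem).mpr hlt.le]

/-- The dichotomy behind the stopping rule: either the midpoint is at distance at least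
`(R - L) / 8` from the threshold, and then it is decided, or both quartiles are, on the two sides
of it. -/
theorem mem_endRounds (hκ : 1 ≤ κ) (hc : 0 ≤ c) (hgood : EpochGood lab h δk k L R)
    (hγ : IsThreshold h γ) (hnoise : HasMargin c κ h γ) {t : ℕ} (ht : 1 ≤ t)
    (hr : 2 * confRadius δk t ≤ c * ((R - L) / 8) ^ (κ - 1)) :
    t ∈ endRounds lab δk k L R := by
  have hw : 0 < R - L := sub_pos.mpr hgood.lt
  have margin : ∀ z ∈ Set.Icc (0 : ℝ) 1, (R - L) / 8 ≤ |z - γ| →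
      2 * confRadius δk t ≤ |h z - 1 / 2| := by
    intro z hz hfar
    refine hr.trans (le_trans ?_ (hnoise z hz))
    gcongr
  refine ⟨ht, (le_or_gt ((R - L) / 8) |(L + R) / 2 - γ|).imp (fun hfar => ?_) fun hnear => ?_⟩
  · have := margin _ hgood.mid_mem hfar
    have acc := hgood.mid t ht
    have triangle := abs_sub_le (h ((L + R) / 2)) (empMean lab k ((L + R) / 2) t) (1 / 2)
    rw [abs_sub_comm (h _) (empMean _ _ _ _)] at triangle
    rw [midDecided]
    linarith
  · rw [abs_lt] at hnear
    have marginV := margin _ hgood.upper_mem (by rw [abs_of_pos] <;> linarith)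
    have marginU := margin _ hgood.lower_mem (by rw [abs_of_neg] <;> linarith)
    have signV := (hγ.half_le_iff _ hgood.upper_mem).mpr (by linarith)
    have signU := hγ.lt_half hgood.lower_mem (by linarith)
    rw [abs_of_nonneg (by linarith)] at marginV
    rw [abs_of_neg (by linarith)] at marginU
    have accU := abs_lt.mp (hgood.lower t ht)
    have accV := abs_lt.mp (hgood.upper t ht)
    constructor <;> linarith

theorem endRounds_nonempty_of_epochCost_ne_top (hcost : epochCost lab δk k L R ≠ ⊤) :
    (endRounds lab δk k L R).Nonempty := by
  by_contra hne
  rw [Set.not_nonempty_iff_eq_empty] at hne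
  exact hcost (by simp [epochCost, hne])

theorem epochCost_le {t : ℕ} (ht : t ∈ endRounds lab δk k L R) :
    epochCost lab δk k L R ≤ 3 * (t : ℕ∞) :=
  mul_le_mul_right (iInf₂_le t ht) 3

theorem one_le_epochCost : 1 ≤ epochCost lab δk k L R := by
  have : (1 : ℕ∞) ≤ ⨅ t ∈ endRounds lab δk k L R, (t : ℕ∞) :=
    le_iInf₂ fun t ht => by exact_mod_cast ht.1
  calc (1 : ℕ∞) ≤ 3 * 1 := by norm_num
    _ ≤ _ := mul_le_mul_right this 3

theorem epochNext_cases (lab : ℕ → ℝ → ℕ → Bool) (δk : ℝ) (k : ℕ) (L R : ℝ) :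
    epochNext lab δk k L R = (L, (L + R) / 2) ∨ epochNext lab δk k L R = ((L + R) / 2, R) ∨
      epochNext lab δk k L R = (L + (R - L) / 4, (L + R) / 2 + (R - L) / 4) := by
  simp only [epochNext]
  split_ifs <;> simp

theorem searchState_eq_dyadic (lab : ℕ → ℝ → ℕ → Bool) (ε δ : ℝ) (k : ℕ) :
    ∃ j : ℕ, (searchState lab ε δ k).1 = ((j : ℝ) / 2 ^ (k + 1), ((j : ℝ) + 2) / 2 ^ (k + 1)) ∧
      j + 2 ≤ 2 ^ (k + 1) := by
  induction k with
  | zero => exact ⟨0, by simp [searchState], by norm_num⟩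
  | succ k ih =>
    obtain ⟨j, hj, hle⟩ := ih
    simp only [searchState, hj]
    have := pow_succ' 2 (k + 1)
    rcases epochNext_cases lab (δ / (searchDepth ε * 2 ^ (k + 1))) (k + 1)
      ((j : ℝ) / 2 ^ (k + 1)) (((j : ℝ) + 2) / 2 ^ (k + 1)) with h | h | h
    · refine ⟨2 * j, ?_, by omega⟩
      rw [h]; push_cast; ext <;> (simp only []; field_simp; ring)
    · refine ⟨2 * j + 2, ?_, by omega⟩
      rw [h]; push_cast; ext <;> (simp only []; field_simp; ring)
    · refine ⟨2 * j + 1, ?_, by omega⟩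
      rw [h]; push_cast; ext <;> (simp only []; field_simp; ring)

theorem searchState_width (lab : ℕ → ℝ → ℕ → Bool) (ε δ : ℝ) (k : ℕ) :
    (searchState lab ε δ k).1.2 - (searchState lab ε δ k).1.1 = ((2 : ℝ) ^ k)⁻¹ := by
  obtain ⟨j, hj, -⟩ := searchState_eq_dyadic lab ε δ k
  rw [hj]
  field_simp
  ring

/-- The confidence parameter `δ_k` of epoch `k`. -/
def epochConf (ε δ : ℝ) (k : ℕ) : ℝ := δ / (searchDepth ε * 2 ^ k)

/-- The labels are accurate at all the dyadic points that the line search may visit. -/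
def LineGood (lab : ℕ → ℝ → ℕ → Bool) (h : ℝ → ℝ) (ε δ : ℝ) : Prop :=
  ∀ k : ℕ, 1 ≤ k → k < searchDepth ε → ∀ j : ℕ, j ≤ 2 ^ (k + 1) →
    Accurate lab h (epochConf ε δ k) k ((j : ℝ) / 2 ^ (k + 1))

theorem LineGood.epochGood (hgood : LineGood lab h ε δ) (hk : k + 1 < searchDepth ε) :
    EpochGood lab h (epochConf ε δ (k + 1)) (k + 1) (searchState lab ε δ k).1.1
      (searchState lab ε δ k).1.2 := by
  obtain ⟨j, hj, hle⟩ := searchState_eq_dyadic lab ε δ k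
  have := pow_succ' 2 (k + 1)
  have accurate_of_eq : ∀ i ≤ 3, ∀ z : ℝ, z = ((2 * j + i : ℕ) : ℝ) / 2 ^ (k + 1 + 1) →
      Accurate lab h (epochConf ε δ (k + 1)) (k + 1) z := by
    rintro i hi _ rfl
    exact hgood (k + 1) (by omega) hk (2 * j + i) (by omega)
  rw [hj]
  refine ⟨by positivity, div_lt_div_of_pos_right (lt_add_of_pos_right _ two_pos) (by positivity),
    ?_, accurate_of_eq 1 (by norm_num) _ ?_,
    accurate_of_eq 2 (by norm_num) _ ?_, accurate_of_eq 3 le_rfl _ ?_⟩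
  · rw [div_le_one (by positivity)]
    exact_mod_cast hle
  all_goals push_cast; field_simp; ring

theorem mem_searchState (hgood : LineGood lab h ε δ) (hγ : IsThreshold h γ)
    (hk : k ≤ searchDepth ε - 1) (hfin : (searchState lab ε δ k).2 ≠ ⊤) :
    γ ∈ Set.Icc (searchState lab ε δ k).1.1 (searchState lab ε δ k).1.2 := by
  induction k with
  | zero => simpa [searchState] using hγ.mem
  | succ k ih =>
    simp only [searchState, ne_eq, ENat.add_eq_top, not_or] at hfin
    exact mem_epochNext (hgood.epochGood (by omega)) hγ (ih (by omega) hfin.1)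
      (endRounds_nonempty_of_epochCost_ne_top hfin.2)

theorem inv_two_pow_searchDepth_le (hε : 0 < ε) : ((2 : ℝ) ^ searchDepth ε)⁻¹ ≤ 2 * ε := by
  have le_depth : Real.logb 2 (1 / (2 * ε)) ≤ searchDepth ε := Nat.le_ceil _
  rw [Real.logb_le_iff_le_rpow (by norm_num) (by positivity), Real.rpow_natCast,
    div_le_iff₀ (by positivity)] at le_depth
  rw [inv_le_iff_one_le_mul₀ (by positivity)]
  linarith

theorem abs_searchThreshold_sub_le (hε : 0 < ε) (hgood : LineGood lab h ε δ)
    (hγ : IsThreshold h γ) (hfin : searchCost lab ε δ ≠ ⊤) :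
    |searchThreshold lab ε δ - γ| ≤ 2 * ε := by
  have hmem := mem_searchState hgood hγ le_rfl hfin
  have width := searchState_width lab ε δ (searchDepth ε - 1)
  have width_le : ((2 : ℝ) ^ (searchDepth ε - 1))⁻¹ ≤ 4 * ε := by
    have := inv_two_pow_searchDepth_le hε
    rcases Nat.eq_zero_or_pos (searchDepth ε) with h0 | hpos
    · rw [h0] at this ⊢
      norm_num at this ⊢
      linarith
    · rw [← Nat.sub_add_cancel hpos, pow_succ, mul_inv] at this
      linarith
  simp only [searchThreshold]
  rw [abs_le]
  constructor <;> linarith [hmem.1, hmem.2]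

theorem searchState_cost_le (hκ : 1 ≤ κ) (hc : 0 ≤ c) (hgood : LineGood lab h ε δ)
    (hγ : IsThreshold h γ) (hnoise : HasMargin c κ h γ) {τ : ℕ → ℕ}
    (hτ : ∀ k, k + 1 < searchDepth ε → 1 ≤ τ k ∧
      2 * confRadius (epochConf ε δ (k + 1)) (τ k) ≤ c * (((2 : ℝ) ^ k)⁻¹ / 8) ^ (κ - 1))
    (hk : k ≤ searchDepth ε - 1) :
    (searchState lab ε δ k).2 ≤ ((∑ i ∈ Finset.range k, 3 * τ i : ℕ) : ℕ∞) := by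
  induction k with
  | zero => simp [searchState]
  | succ k ih =>
    obtain ⟨one_le, radius_le⟩ := hτ k (by omega)
    have hend := mem_endRounds hκ hc (hgood.epochGood (k := k) (by omega)) hγ hnoise one_le
      (by rwa [searchState_width])
    rw [Finset.sum_range_succ, Nat.cast_add, Nat.cast_mul]
    exact add_le_add (ih (by omega)) (epochCost_le hend)

theorem searchCost_le (hκ : 1 ≤ κ) (hc : 0 ≤ c) (hgood : LineGood lab h ε δ)
    (hγ : IsThreshold h γ) (hnoise : HasMargin c κ h γ) {τ : ℕ → ℕ}
    (hτ : ∀ k, k + 1 < searchDepth ε → 1 ≤ τ k ∧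
      2 * confRadius (epochConf ε δ (k + 1)) (τ k) ≤ c * (((2 : ℝ) ^ k)⁻¹ / 8) ^ (κ - 1)) :
    searchCost lab ε δ ≤ ((∑ i ∈ Finset.range (searchDepth ε - 1), 3 * τ i : ℕ) : ℕ∞) :=
  searchState_cost_le hκ hc hgood hγ hnoise hτ le_rfl

theorem one_le_searchCost (hK : 2 ≤ searchDepth ε) : 1 ≤ searchCost lab ε δ := by
  obtain ⟨k, hk⟩ : ∃ k, searchDepth ε - 1 = k + 1 := ⟨searchDepth ε - 2, by omega⟩
  rw [searchCost, hk]
  exact le_add_left one_le_epochCost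

end LineSearch

/-! ### Concentration of the labels -/

section Concentration

variable {Ω : Type*} [MeasurableSpace Ω] {μ : Measure Ω}

theorem measure_iUnion_le_ofReal {s : ℕ → Set Ω} {b : ℕ → ℝ} {B : ℝ} (hb : ∀ n, 0 ≤ b n)
    (hB : HasSum b B) (h : ∀ n, μ (s n) ≤ ENNReal.ofReal (b n)) :
    μ (⋃ n, s n) ≤ ENNReal.ofReal B := by
  refine (measure_iUnion_le s).trans ((ENNReal.tsum_le_tsum h).trans ?_)
  rw [← ENNReal.ofReal_tsum_of_nonneg hb hB.summable, hB.tsum_eq]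

theorem measure_biUnion_finset_le_ofReal {ι : Type*} {I : Finset ι} {s : ι → Set Ω} {b : ℝ}
    (h : ∀ i ∈ I, μ (s i) ≤ ENNReal.ofReal b) :
    μ (⋃ i ∈ I, s i) ≤ ENNReal.ofReal (I.card * b) := by
  refine (measure_biUnion_finset_le I s).trans ((Finset.sum_le_card_nsmul I _ _ h).trans ?_)
  rw [ENNReal.ofReal_mul (by positivity), ENNReal.ofReal_natCast, nsmul_eq_mul]

theorem ofReal_one_sub_le_of_measure_compl_le [IsProbabilityMeasure μ] {s : Set Ω} {δ : ℝ}
    (hδ : 0 ≤ δ) (h : μ sᶜ ≤ ENNReal.ofReal δ) : ENNReal.ofReal (1 - δ) ≤ μ s := by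
  rw [ENNReal.ofReal_sub _ hδ, ENNReal.ofReal_one, tsub_le_iff_right]
  calc 1 = μ (s ∪ sᶜ) := by rw [Set.union_compl_self, measure_univ]
    _ ≤ μ s + μ sᶜ := measure_union_le _ _
    _ ≤ μ s + ENNReal.ofReal δ := by gcongr

theorem measure_le_abs_sum_le_of_iIndepFun {ι : Type*} {X : ι → Ω → ℝ} (hind : iIndepFun X μ)
    {v : NNReal} {s : Finset ι} (hX : ∀ i ∈ s, HasSubgaussianMGF (X i) v μ) {r : ℝ}
    (hr : 0 ≤ r) :
    μ {ω | r ≤ |∑ i ∈ s, X i ω|} ≤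
      ENNReal.ofReal (2 * Real.exp (-r ^ 2 / (2 * (s.card * v)))) := by
  have : IsProbabilityMeasure μ := hind.isProbabilityMeasure
  have hind_neg : iIndepFun (fun i => -X i) μ := hind.comp (fun _ y => -y) fun _ => measurable_neg
  have upper := HasSubgaussianMGF.measure_sum_ge_le_of_iIndepFun hind hX hr
  have lower := HasSubgaussianMGF.measure_sum_ge_le_of_iIndepFun hind_neg
    (fun i hi => (hX i hi).neg) hr
  have card_sum : ((∑ _i ∈ s, v : NNReal) : ℝ) = s.card * v := by simp
  rw [card_sum] at upper lower
  have cover : {ω | r ≤ |∑ i ∈ s, X i ω|} ⊆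
      {ω | r ≤ ∑ i ∈ s, X i ω} ∪ {ω | r ≤ ∑ i ∈ s, (-X i) ω} := by
    intro ω hω
    simpa only [Set.mem_union, Set.mem_ofPred_eq, Pi.neg_apply, Finset.sum_neg_distrib] using
      le_abs.mp hω
  refine (measure_mono cover).trans ((measure_union_le _ _).trans ?_)
  rw [← ofReal_measureReal, ← ofReal_measureReal,
    ← ENNReal.ofReal_add measureReal_nonneg measureReal_nonneg]
  exact ENNReal.ofReal_le_ofReal (by linarith)

theorem confRadius_nonneg (δ : ℝ) (t : ℕ) : 0 ≤ confRadius δ t := by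
  rw [confRadius]
  positivity

theorem exp_neg_mul_confRadius_sq {δ : ℝ} (hδ : 0 < δ) (hδ1 : δ ≤ 1) {t : ℕ} (ht : 1 ≤ t) :
    Real.exp (-(t * confRadius δ t) ^ 2 / (2 * (t * (1 / 4)))) = (δ / t) ^ 4 := by
  have ht1 : (1 : ℝ) ≤ t := by exact_mod_cast ht
  have ht0 : (0 : ℝ) < t := by linarith
  have log_nonneg : 0 ≤ Real.log (t / δ) := Real.log_nonneg ((one_le_div hδ).mpr (by linarith))
  have radius_sq : confRadius δ t ^ 2 = 4 * (Real.log (t / δ) / (2 * t)) := by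
    rw [confRadius, mul_pow, Real.sq_sqrt (by positivity)]
    norm_num
  have exponent : -(t * confRadius δ t) ^ 2 / (2 * (t * (1 / 4))) =
      ((4 : ℕ) : ℝ) * Real.log (δ / t) := by
    rw [mul_pow, radius_sq, Real.log_div hδ.ne' ht0.ne', Real.log_div ht0.ne' hδ.ne']
    push_cast
    field_simp
    ring
  rw [exponent, Real.exp_nat_mul, Real.exp_log (by positivity)]

theorem hasSubgaussianMGF_bernoulli [IsProbabilityMeasure μ] {Z : Ω → Bool} (hZ : Measurable Z)
    {p : ℝ} (hp : 0 ≤ p) (hlaw : μ {ω | Z ω = true} = ENNReal.ofReal p) :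
    HasSubgaussianMGF (fun ω => (if Z ω then (1 : ℝ) else 0) - p) (1 / 4) μ := by
  have meas : Measurable fun ω => if Z ω then (1 : ℝ) else 0 :=
    (measurable_from_top (f := fun b : Bool => if b then (1 : ℝ) else 0)).comp hZ
  have mean : ∫ ω, (if Z ω then (1 : ℝ) else 0) ∂μ = p := by
    have : (fun ω => if Z ω then (1 : ℝ) else 0) =
        Set.indicator {ω | Z ω = true} fun _ => (1 : ℝ) := by
      ext ω
      simp [Set.indicator_apply]
    have meas_true : MeasurableSet {ω | Z ω = true} := hZ (measurableSet_singleton true)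
    rw [this, integral_indicator_const _ meas_true, measureReal_def, hlaw,
      ENNReal.toReal_ofReal hp, smul_eq_mul, mul_one]
  have mem_Icc : ∀ᵐ ω ∂μ, (if Z ω then (1 : ℝ) else 0) ∈ Set.Icc (0 : ℝ) 1 :=
    Filter.Eventually.of_forall fun ω => by cases Z ω <;> simp
  have hoeffding := hasSubgaussianMGF_of_mem_Icc meas.aemeasurable mem_Icc
  rw [mean] at hoeffding
  convert hoeffding using 1
  rw [sub_zero, nnnorm_one, div_pow]
  norm_num

section Labels

variable {lab : Ω → ℕ → ℝ → ℕ → Bool} {h : ℝ → ℝ} {δ : ℝ}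

theorem measure_confRadius_le_abs_empMean_sub_le {k : ℕ} {z : ℝ}
    (hm : ∀ s, Measurable fun ω => lab ω k z s) (hind : iIndepFun (fun s ω => lab ω k z s) μ)
    (hz : 0 ≤ h z) (hlaw : ∀ s, μ {ω | lab ω k z s = true} = ENNReal.ofReal (h z))
    (hδ : 0 < δ) (hδ1 : δ ≤ 1) {t : ℕ} (ht : 1 ≤ t) :
    μ {ω | confRadius δ t ≤ |empMean (lab ω) k z t - h z|} ≤
      ENNReal.ofReal (2 * (δ / t) ^ 4) := by
  have : IsProbabilityMeasure μ := hind.isProbabilityMeasure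
  have ht0 : (0 : ℝ) < t := by exact_mod_cast ht
  have hind' : iIndepFun (fun s ω => (if lab ω k z s then (1 : ℝ) else 0) - h z) μ :=
    hind.comp (fun _ b => (if b then (1 : ℝ) else 0) - h z) fun _ => measurable_from_top
  have tail := measure_le_abs_sum_le_of_iIndepFun hind' (s := Finset.Icc 1 t)
    (fun s _ => hasSubgaussianMGF_bernoulli (hm s) hz (hlaw s))
    (mul_nonneg ht0.le (confRadius_nonneg δ t))
  have sum_eq : ∀ ω, ∑ s ∈ Finset.Icc 1 t, ((if lab ω k z s then (1 : ℝ) else 0) - h z) =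
      t * (empMean (lab ω) k z t - h z) := by
    intro ω
    rw [Finset.sum_sub_distrib, mul_sub, empMean, mul_div_cancel₀ _ ht0.ne']
    simp
  simp only [sum_eq, abs_mul, abs_of_pos ht0, mul_le_mul_iff_right₀ ht0] at tail
  simpa [← exp_neg_mul_confRadius_sq hδ hδ1 ht] using tail

theorem measure_not_accurate_le {k : ℕ} {z : ℝ}
    (hm : ∀ s, Measurable fun ω => lab ω k z s) (hind : iIndepFun (fun s ω => lab ω k z s) μ)
    (hz : 0 ≤ h z) (hlaw : ∀ s, μ {ω | lab ω k z s = true} = ENNReal.ofReal (h z))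
    (hδ : 0 < δ) (hδ1 : δ ≤ 1) :
    μ {ω | ¬ Accurate (lab ω) h δ k z} ≤ ENNReal.ofReal (4 * δ ^ 4) := by
  have cover : {ω | ¬ Accurate (lab ω) h δ k z} ⊆
      ⋃ t : ℕ, {ω | 1 ≤ t ∧ confRadius δ t ≤ |empMean (lab ω) k z t - h z|} := by
    intro ω hω
    simpa [Accurate] using hω
  refine (measure_mono cover).trans ((measure_iUnion_le_ofReal
    (b := fun t : ℕ => 2 * δ ^ 4 * (1 / (t : ℝ) ^ 4)) (fun t => by positivity)
    (hasSum_zeta_four.mul_left (2 * δ ^ 4)) fun t => ?_).trans (ENNReal.ofReal_le_ofReal ?_))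
  · by_cases ht : 1 ≤ t
    · simp only [ht, true_and]
      refine (measure_confRadius_le_abs_empMean_sub_le hm hind hz hlaw hδ hδ1 ht).trans_eq ?_
      rw [div_pow, mul_one_div, mul_div_assoc]
    · simp [ht]
  · have pi_pow_le : Real.pi ^ 4 ≤ 180 :=
      calc Real.pi ^ 4 ≤ 3.15 ^ 4 := by gcongr; exact Real.pi_lt_d2.le
        _ ≤ 180 := by norm_num
    nlinarith [pow_pos hδ 4]

theorem dyadic_mem {j n : ℕ} (hj : j ≤ 2 ^ n) : (j : ℝ) / 2 ^ n ∈ Set.Icc (0 : ℝ) 1 :=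
  ⟨by positivity, (div_le_one (by positivity)).mpr (by exact_mod_cast hj)⟩

theorem epochConf_pos {ε : ℝ} {k : ℕ} (hδ : 0 < δ) (hk : k < searchDepth ε) :
    0 < epochConf ε δ k := by
  have : (0 : ℝ) < searchDepth ε := by exact_mod_cast pos_of_gt hk
  rw [epochConf]
  positivity

theorem epochConf_le {ε : ℝ} {k : ℕ} (hδ : 0 ≤ δ) (hk : k < searchDepth ε) :
    epochConf ε δ k ≤ δ / 2 ^ k := by
  have : (1 : ℝ) ≤ searchDepth ε := by exact_mod_cast pos_of_gt hk
  rw [epochConf]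
  gcongr
  exact le_mul_of_one_le_left (by positivity) this

theorem two_pow_add_one_mul_div_pow_le (δ : ℝ) (k : ℕ) :
    ((2 : ℝ) ^ (k + 1) + 1) * (4 * (δ / 2 ^ k) ^ 4) ≤ 16 * δ ^ 4 * (1 / 2) ^ k := by
  have one_le : (1 : ℝ) ≤ 2 ^ k := one_le_pow₀ (by norm_num)
  calc ((2 : ℝ) ^ (k + 1) + 1) * (4 * (δ / 2 ^ k) ^ 4)
      ≤ (4 * 2 ^ k) * (4 * (δ / 2 ^ k) ^ 4) := by
        gcongr
        rw [pow_succ]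
        linarith
    _ = 16 * δ ^ 4 / (2 ^ k) ^ 3 := by field_simp; ring
    _ ≤ 16 * δ ^ 4 / 2 ^ k := by
        gcongr
        exact le_self_pow₀ one_le (by norm_num)
    _ = 16 * δ ^ 4 * (1 / 2) ^ k := by rw [one_div, inv_pow, div_eq_mul_inv]

theorem measure_not_lineGood_le (hm : ∀ k z s, Measurable fun ω => lab ω k z s)
    (hind : ∀ k z, iIndepFun (fun s ω => lab ω k z s) μ)
    (hh : ∀ z ∈ Set.Icc (0 : ℝ) 1, 0 ≤ h z)
    (hlaw : ∀ k, ∀ z ∈ Set.Icc (0 : ℝ) 1, ∀ s,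
      μ {ω | lab ω k z s = true} = ENNReal.ofReal (h z))
    {ε : ℝ} (hδ : 0 < δ) (hδ1 : δ ≤ 1) :
    μ {ω | ¬ LineGood (lab ω) h ε δ} ≤ ENNReal.ofReal (32 * δ ^ 4) := by
  have cover : {ω | ¬ LineGood (lab ω) h ε δ} ⊆
      ⋃ k : ℕ, ⋃ j ∈ Finset.range (2 ^ (k + 1) + 1), {ω | k < searchDepth ε ∧
        ¬ Accurate (lab ω) h (epochConf ε δ k) k ((j : ℝ) / 2 ^ (k + 1))} := by
    intro ω hω
    simp only [LineGood, Set.mem_ofPred_eq, not_forall] at hω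
    obtain ⟨k, -, hk, j, hj, hne⟩ := hω
    simp only [Set.mem_iUnion]
    exact ⟨k, j, Finset.mem_range.mpr (Nat.lt_succ_of_le hj), hk, hne⟩
  refine (measure_mono cover).trans ((measure_iUnion_le_ofReal
    (b := fun k : ℕ => 16 * δ ^ 4 * (1 / 2) ^ k) (fun k => by positivity)
    (hasSum_geometric_two.mul_left (16 * δ ^ 4)) fun k => ?_).trans
    (ENNReal.ofReal_le_ofReal (by linarith)))
  by_cases hk : k < searchDepth ε
  · simp only [hk, true_and]
    have conf_le := epochConf_le hδ.le hk
    have conf_pos := epochConf_pos hδ hk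
    have conf_le_one : epochConf ε δ k ≤ 1 :=
      conf_le.trans ((div_le_self hδ.le (one_le_pow₀ (by norm_num))).trans hδ1)
    refine (measure_biUnion_finset_le_ofReal (b := 4 * (δ / 2 ^ k) ^ 4) fun j hj => ?_).trans
      (ENNReal.ofReal_le_ofReal ?_)
    · have hz := dyadic_mem (Nat.lt_succ_iff.mp (Finset.mem_range.mp hj))
      refine (measure_not_accurate_le (hm k _) (hind k _) (hh _ hz) (hlaw k _ hz) conf_pos
        conf_le_one).trans (ENNReal.ofReal_le_ofReal ?_)
      gcongr
    · rw [Finset.card_range]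
      exact_mod_cast two_pow_add_one_mul_div_pow_le δ k
  · simp [hk]

end Labels

/-- All line searches of one call of the subroutine are run with accurate labels. -/
def CallGood {d : ℕ} (P : Problem d) (lab : ℕ → ℕ → Point d → ℕ → Bool) (δ lam α : ℝ) : Prop :=
  ∀ l : ℕ, ∀ a : Fin (d - 1) → ℕ, (∀ i, a i ≤ gridSize α l) →
    LineGood (lineLabels lab α l a) (fun z => P.eta (gridPoint α l a, z)) (depthPrec lam α l)
      (depthConf d δ α l)

section Calls

variable {d : ℕ} {P : Problem d} {Y : Request d → Ω → Bool} {δ lam α α' : ℝ}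

theorem gridPoint_prod_mem {l : ℕ} {a : Fin (d - 1) → ℕ} (ha : ∀ i, a i ≤ gridSize α l) {z : ℝ}
    (hz : z ∈ Set.Icc (0 : ℝ) 1) : (gridPoint α l a, z) ∈ cube d :=
  ⟨gridPoint_mem ha, hz⟩

theorem one_le_cellDegree_cast (α : ℝ) : (1 : ℝ) ≤ cellDegree α := by
  exact_mod_cast cellDegree_pos α

theorem depthConf_pos (hδ : 0 < δ) (α : ℝ) (l : ℕ) : 0 < depthConf d δ α l := by
  have := one_le_cellDegree_cast α
  rw [depthConf]
  positivity

theorem depthConf_le (hδ : 0 ≤ δ) (α : ℝ) (l : ℕ) :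
    depthConf d δ α l ≤ δ / 2 ^ (l * (d + 1)) := by
  rw [depthConf]
  gcongr
  exact le_mul_of_one_le_left (by positivity) (one_le_cellDegree_cast α)

theorem depthConf_le_self (hδ : 0 ≤ δ) (α : ℝ) (l : ℕ) : depthConf d δ α l ≤ δ :=
  (depthConf_le hδ α l).trans (div_le_self hδ (one_le_pow₀ (by norm_num)))

theorem gridSize_add_one_le (α : ℝ) (l : ℕ) :
    ((gridSize α l + 1 : ℕ) : ℝ) ≤ 2 * cellDegree α * 2 ^ l := by
  have h : gridSize α l + 1 ≤ 2 * gridSize α l := by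
    have := gridSize_pos α l
    omega
  calc ((gridSize α l + 1 : ℕ) : ℝ) ≤ ((2 * gridSize α l : ℕ) : ℝ) := by exact_mod_cast h
    _ = 2 * cellDegree α * 2 ^ l := by
      rw [gridSize]
      push_cast
      ring

theorem gridSize_add_one_pow_mul_depthConf_pow_le (hδ : 0 < δ) (α : ℝ) (l : ℕ) :
    ((gridSize α l + 1 : ℕ) : ℝ) ^ (d - 1) * (32 * depthConf d δ α l ^ 4) ≤
      32 * (2 * cellDegree α) ^ (d - 1) * δ ^ 4 * (1 / 2) ^ l := by
  have decay : ((2 : ℝ) ^ l) ^ (d - 1) * (δ / 2 ^ (l * (d + 1))) ^ 4 ≤ δ ^ 4 * (1 / 2) ^ l := by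
    rw [div_pow, one_div, inv_pow, ← pow_mul, ← pow_mul, mul_div_assoc', mul_comm _ (δ ^ 4),
      ← div_eq_mul_inv, div_le_div_iff₀ (by positivity) (by positivity), mul_assoc, ← pow_add]
    gcongr
    · norm_num
    · nlinarith [Nat.mul_le_mul_left l (Nat.sub_le d 1)]
  calc ((gridSize α l + 1 : ℕ) : ℝ) ^ (d - 1) * (32 * depthConf d δ α l ^ 4)
      ≤ (2 * cellDegree α * 2 ^ l) ^ (d - 1) * (32 * (δ / 2 ^ (l * (d + 1))) ^ 4) := by
        have := depthConf_pos (d := d) hδ α l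
        gcongr
        · exact gridSize_add_one_le α l
        · exact depthConf_le hδ.le α l
    _ = 32 * (2 * cellDegree α) ^ (d - 1) *
          (((2 : ℝ) ^ l) ^ (d - 1) * (δ / 2 ^ (l * (d + 1))) ^ 4) := by
        rw [mul_pow]
        ring
    _ ≤ 32 * (2 * cellDegree α) ^ (d - 1) * (δ ^ 4 * (1 / 2) ^ l) := by gcongr
    _ = _ := by ring

theorem measure_not_callGood_le (hY : IsLabelOracle P μ Y) (i : ℕ) (hδ : 0 < δ) (hδ1 : δ ≤ 1) :
    μ {ω | ¬ CallGood P (fun l k x s => Y ⟨i, l, k, s, x⟩ ω) δ lam α} ≤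
      ENNReal.ofReal (64 * (2 * cellDegree α : ℝ) ^ (d - 1) * δ ^ 4) := by
  have cover : {ω | ¬ CallGood P (fun l k x s => Y ⟨i, l, k, s, x⟩ ω) δ lam α} ⊆
      ⋃ l : ℕ, ⋃ a ∈ Fintype.piFinset fun _ : Fin (d - 1) => Finset.range (gridSize α l + 1),
        {ω | ¬ LineGood (fun k z s => Y ⟨i, l, k, s, (gridPoint α l a, z)⟩ ω)
          (fun z => P.eta (gridPoint α l a, z)) (depthPrec lam α l) (depthConf d δ α l)} := by
    intro ω hω
    simp only [CallGood, Set.mem_ofPred_eq, not_forall] at hω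
    obtain ⟨l, a, ha, hne⟩ := hω
    simp only [Set.mem_iUnion]
    exact ⟨l, a, Fintype.mem_piFinset.mpr fun i => Finset.mem_range.mpr (Nat.lt_succ_of_le (ha i)),
      hne⟩
  refine (measure_mono cover).trans ((measure_iUnion_le_ofReal
    (b := fun l : ℕ => 32 * (2 * cellDegree α : ℝ) ^ (d - 1) * δ ^ 4 * (1 / 2) ^ l)
    (fun l => by positivity) (hasSum_geometric_two.mul_left _) fun l => ?_).trans
    (ENNReal.ofReal_le_ofReal (by linarith)))
  refine (measure_biUnion_finset_le_ofReal (b := 32 * depthConf d δ α l ^ 4)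
    fun a ha => ?_).trans (ENNReal.ofReal_le_ofReal ?_)
  · have ha' : ∀ i, a i ≤ gridSize α l := fun i =>
      Nat.lt_succ_iff.mp (Finset.mem_range.mp (Fintype.mem_piFinset.mp ha i))
    refine measure_not_lineGood_le (fun k z s => hY.measurable _) (fun k z => ?_)
      (fun z hz => (P.eta_mem _ (gridPoint_prod_mem ha' hz)).1)
      (fun k z hz s => hY.law _ (gridPoint_prod_mem ha' hz)) (depthConf_pos hδ α l)
      ((depthConf_le_self hδ.le α l).trans hδ1)
    exact hY.indep.precomp (g := fun s : ℕ => (⟨i, l, k, s, (gridPoint α l a, z)⟩ : Request d))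
      fun s s' h => by simpa using h
  · rw [Fintype.card_piFinset]
    simp only [Finset.card_range, Finset.prod_const, Finset.card_univ, Fintype.card_fin,
      Nat.cast_pow]
    exact gridSize_add_one_pow_mul_depthConf_pow_le hδ α l

theorem cellDegree_mono (h : α' ≤ α) : cellDegree α' ≤ cellDegree α :=
  max_le_max le_rfl (Nat.sub_le_sub_right (Nat.ceil_mono h) 1)

/-- All calls of the subroutine whose smoothness parameter is at most `α` are run with accurate
labels. -/
def AllGood {d : ℕ} (P : Problem d) (lab : Request d → Bool) (n : ℕ) (δ lam α : ℝ) : Prop :=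
  ∀ i : ℕ, 1 ≤ i → i ≤ logFloor n ^ 2 → (i : ℝ) / logFloor n ≤ α →
    CallGood P (fun l k x s => lab ⟨i, l, k, s, x⟩) (δ / (logFloor n : ℝ) ^ 2) lam
      ((i : ℝ) / logFloor n)

theorem one_le_logFloor {n : ℕ}
    (h : 64 * (2 * cellDegree α : ℝ) ^ (d - 1) ≤ logFloor n) :
    1 ≤ logFloor n := by
  have one_le_pow : (1 : ℝ) ≤ (2 * cellDegree α : ℝ) ^ (d - 1) :=
    one_le_pow₀ (by linarith [one_le_cellDegree_cast α])
  exact_mod_cast (by linarith : (1 : ℝ) ≤ logFloor n)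

theorem measure_not_allGood_le (hY : IsLabelOracle P μ Y) {n : ℕ} (hδ : 0 < δ) (hδ1 : δ ≤ 1)
    (hn : 64 * (2 * cellDegree α : ℝ) ^ (d - 1) ≤ logFloor n) :
    μ {ω | ¬ AllGood P (fun r => Y r ω) n δ lam α} ≤ ENNReal.ofReal δ := by
  have one_le_cast : (1 : ℝ) ≤ logFloor n := by exact_mod_cast one_le_logFloor hn
  set conf := δ / (logFloor n : ℝ) ^ 2 with conf_eq
  have cover : {ω | ¬ AllGood P (fun r => Y r ω) n δ lam α} ⊆
      ⋃ i ∈ Finset.Icc 1 (logFloor n ^ 2), {ω | (i : ℝ) / logFloor n ≤ α ∧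
        ¬ CallGood P (fun l k x s => Y ⟨i, l, k, s, x⟩ ω) conf lam ((i : ℝ) / logFloor n)} := by
    intro ω hω
    simp only [AllGood, Set.mem_ofPred_eq, not_forall] at hω
    obtain ⟨i, one_le, le_sq, hα, hne⟩ := hω
    simp only [Set.mem_iUnion]
    exact ⟨i, Finset.mem_Icc.mpr ⟨one_le, le_sq⟩, hα, hne⟩
  refine (measure_mono cover).trans ((measure_biUnion_finset_le_ofReal
    (b := logFloor n * conf ^ 4) fun i _ => ?_).trans (ENNReal.ofReal_le_ofReal ?_))
  · by_cases hi : (i : ℝ) / logFloor n ≤ α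
    · simp only [hi, true_and]
      have conf_le_one : conf ≤ 1 := (div_le_self hδ.le (one_le_pow₀ one_le_cast)).trans hδ1
      refine (measure_not_callGood_le hY i (by positivity) conf_le_one).trans
        (ENNReal.ofReal_le_ofReal ?_)
      refine le_trans ?_ (mul_le_mul_of_nonneg_right hn (by positivity))
      gcongr
      exact cellDegree_mono hi
    · simp [hi]
  · rw [Nat.card_Icc, Nat.add_sub_cancel]
    calc ((logFloor n ^ 2 : ℕ) : ℝ) * (logFloor n * conf ^ 4)
        = δ ^ 4 / (logFloor n : ℝ) ^ 5 := by
          rw [conf_eq]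
          push_cast
          field_simp
      _ ≤ δ ^ 4 := div_le_self (by positivity) (one_le_pow₀ one_le_cast)
      _ ≤ δ := pow_le_of_le_one hδ.le hδ1 (by norm_num)

theorem ofReal_one_sub_le_measure_allGood (hY : IsLabelOracle P μ Y) {n : ℕ} (hδ : 0 < δ)
    (hδ1 : δ ≤ 1) (hn : 64 * (2 * cellDegree α : ℝ) ^ (d - 1) ≤ logFloor n) :
    ENNReal.ofReal (1 - δ) ≤ μ {ω | AllGood P (fun r => Y r ω) n δ lam α} :=
  have : IsProbabilityMeasure μ := hY.indep.isProbabilityMeasure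
  ofReal_one_sub_le_of_measure_compl_le hδ.le (measure_not_allGood_le hY hδ hδ1 hn)

end Calls

end Concentration

/-! ### Excess risk -/

section ExcessRisk

variable {d : ℕ} (P : Problem d) {f : Point d → Bool}

theorem Problem.ae_mem_cube : ∀ᵐ x ∂P.PX, x ∈ cube d :=
  ae_iff.mpr P.supported

/-- The conditional risk of the classifier `f`. -/
def Problem.loss (f : Point d → Bool) (x : Point d) : ℝ := if f x then 1 - P.eta x else P.eta x

theorem Problem.measurable_loss (hf : Measurable f) : Measurable (P.loss f) :=
  Measurable.ite (hf (measurableSet_singleton true)) (measurable_const.sub P.eta_measurable)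
    P.eta_measurable

theorem Problem.loss_mem {x : Point d} (hx : x ∈ cube d) : P.loss f x ∈ Set.Icc (0 : ℝ) 1 := by
  have := P.eta_mem x hx
  rw [Problem.loss]
  split_ifs <;> constructor <;> linarith [this.1, this.2]

theorem Problem.integrable_loss (hf : Measurable f) : Integrable (P.loss f) P.PX :=
  have := P.isProb
  Integrable.of_mem_Icc 0 1 (P.measurable_loss hf).aemeasurable
    (P.ae_mem_cube.mono fun _ hx => P.loss_mem hx)

theorem Problem.risk_eq (hf : Measurable f) : P.risk f = ∫ x, P.loss f x ∂P.PX := by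
  have meas_error : MeasurableSet {p : Point d × Bool | p.2 ≠ f p.1} :=
    (measurableSet_eq_fun measurable_snd (hf.comp measurable_fst)).compl
  have meas_one : MeasurableSet {x | f x = true} := hf (measurableSet_singleton true)
  have error_true : (fun x : Point d => (x, true)) ⁻¹' {p | p.2 ≠ f p.1} = {x | f x = true}ᶜ := by
    ext x
    cases h : f x <;> simp [h]
  have error_false : (fun x : Point d => (x, false)) ⁻¹' {p | p.2 ≠ f p.1} = {x | f x = true} := by
    ext x
    cases h : f x <;> simp [h]
  rw [integral_eq_lintegral_of_nonneg_ae (P.ae_mem_cube.mono fun x hx => (P.loss_mem hx).1)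
    (P.measurable_loss hf).aestronglyMeasurable, Problem.risk, Problem.joint]
  congr 1
  rw [Measure.add_apply, Measure.map_apply (by fun_prop) meas_error,
    Measure.map_apply (by fun_prop) meas_error, error_true, error_false,
    withDensity_apply _ meas_one.compl, withDensity_apply _ meas_one, add_comm,
    ← lintegral_add_compl (fun x => ENNReal.ofReal (P.loss f x)) meas_one]
  congr 1
  · refine setLIntegral_congr_fun meas_one fun x (hx : f x = true) => ?_
    simp [Problem.loss, hx]
  · refine setLIntegral_congr_fun meas_one.compl fun x (hx : ¬ f x = true) => ?_
    simp [Problem.loss, hx]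

theorem Problem.bayes_eq_true_iff (x : Point d) : P.bayes x = true ↔ 1 / 2 ≤ P.eta x :=
  decide_eq_true_iff

theorem Problem.measurable_bayes : Measurable P.bayes := by
  refine measurable_to_bool ?_
  have : P.bayes ⁻¹' {true} = {x | 1 / 2 ≤ P.eta x} := Set.ext P.bayes_eq_true_iff
  rw [this]
  exact measurableSet_le measurable_const P.eta_measurable

theorem Problem.integrable_margin : Integrable (fun x => |1 - 2 * P.eta x|) P.PX :=
  have := P.isProb
  ((integrable_const 1).sub ((Integrable.of_mem_Icc 0 1 P.eta_measurable.aemeasurable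
    (P.ae_mem_cube.mono P.eta_mem)).const_mul 2)).abs

theorem Problem.loss_sub_loss_bayes (f : Point d → Bool) (x : Point d) :
    P.loss f x - P.loss P.bayes x =
      Set.indicator {x | f x ≠ P.bayes x} (fun x => |1 - 2 * P.eta x|) x := by
  by_cases h : f x = P.bayes x
  · simp [Problem.loss, h]
  rw [Set.indicator_of_mem (by exact h)]
  cases hb : P.bayes x
  · have eta_lt : P.eta x < 1 / 2 :=
      lt_of_not_ge (mt (P.bayes_eq_true_iff x).mpr (by simp [hb]))
    rw [hb, Bool.not_eq_false] at h
    rw [abs_of_nonneg (by linarith)]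
    simp only [Problem.loss, h, hb, if_true, Bool.false_eq_true, if_false]
    ring
  · have le_eta := (P.bayes_eq_true_iff x).mp hb
    rw [hb, Bool.not_eq_true] at h
    rw [abs_of_nonpos (by linarith)]
    simp only [Problem.loss, h, hb, if_true, Bool.false_eq_true, if_false]
    ring

theorem Problem.excessRisk_eq (hf : Measurable f) :
    P.excessRisk f = ∫ x in {x | f x ≠ P.bayes x}, |1 - 2 * P.eta x| ∂P.PX := by
  have meas_ne : MeasurableSet {x | f x ≠ P.bayes x} :=
    (measurableSet_eq_fun hf P.measurable_bayes).compl
  rw [Problem.excessRisk, P.risk_eq hf, P.risk_eq P.measurable_bayes,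
    ← integral_sub (P.integrable_loss hf) (P.integrable_loss P.measurable_bayes),
    ← integral_indicator meas_ne]
  exact integral_congr_ae (Filter.Eventually.of_forall (P.loss_sub_loss_bayes f))

theorem BoundaryMass.excessRisk_le {P : Problem d} {CM Δ₀ κ' Δ : ℝ}
    {g : (Fin (d - 1) → ℝ) → ℝ} (hmass : BoundaryMass P CM Δ₀ κ' g) (hΔ : Δ ∈ Set.Icc 0 Δ₀)
    (hf : Measurable f) (heq : ∀ x ∈ cube d, Δ < |x.2 - g x.1| → f x = P.bayes x) :
    P.excessRisk f ≤ CM * Δ ^ κ' := by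
  rw [P.excessRisk_eq hf]
  refine le_trans (setIntegral_mono_set P.integrable_margin.integrableOn
    (Filter.Eventually.of_forall fun x => abs_nonneg _) ?_) (hmass Δ hΔ)
  filter_upwards [P.ae_mem_cube] with x hx hne
  exact ⟨hx, not_lt.mp fun hlt => hne (heq x hx hlt)⟩

end ExcessRisk

/-! ### Measurability of the classifiers -/

section RegularSlices

variable {X : Type*} [MeasurableSpace X] {A B : Set (X × ℝ)}

/-- A measurable set whose slices have their frontiers on the graphs of countably many measurable
functions. Unlike that of a general measurable set, the projection of such a set to `X` is
measurable, which makes infima over its slices measurable. -/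
def RegularSlices (A : Set (X × ℝ)) : Prop :=
  MeasurableSet A ∧ ∃ F : Set (X → ℝ), F.Countable ∧ (∀ τ ∈ F, Measurable τ) ∧
    ∀ x, ∀ z ∈ frontier {z | (x, z) ∈ A}, ∃ τ ∈ F, τ x = z

namespace RegularSlices

theorem compl (hA : RegularSlices A) : RegularSlices Aᶜ := by
  obtain ⟨meas, F, countable, measF, onGraph⟩ := hA
  refine ⟨meas.compl, F, countable, measF, fun x z hz => onGraph x z ?_⟩
  rw [← frontier_compl]
  exact hz

theorem inter (hA : RegularSlices A) (hB : RegularSlices B) : RegularSlices (A ∩ B) := by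
  obtain ⟨measA, F, hF, measF, onF⟩ := hA
  obtain ⟨measB, G, hG, measG, onG⟩ := hB
  refine ⟨measA.inter measB, F ∪ G, hF.union hG, fun τ hτ => hτ.elim (measF τ) (measG τ),
    fun x z hz => ?_⟩
  rcases frontier_inter_subset {z | (x, z) ∈ A} {z | (x, z) ∈ B} hz with frA | frB
  · obtain ⟨τ, hτ, hτz⟩ := onF x z frA.1
    exact ⟨τ, Or.inl hτ, hτz⟩
  · obtain ⟨τ, hτ, hτz⟩ := onG x z frB.2
    exact ⟨τ, Or.inr hτ, hτz⟩

theorem union (hA : RegularSlices A) (hB : RegularSlices B) : RegularSlices (A ∪ B) := by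
  simpa only [Set.compl_inter, compl_compl] using (hA.compl.inter hB.compl).compl

theorem diff (hA : RegularSlices A) (hB : RegularSlices B) : RegularSlices (A \ B) :=
  hA.inter hB.compl

theorem of_fst {S : Set X} (hS : MeasurableSet S) : RegularSlices {p : X × ℝ | p.1 ∈ S} := by
  refine ⟨measurable_fst hS, ∅, Set.countable_empty, by simp, fun x z hz => ?_⟩
  by_cases h : x ∈ S <;> simp [h] at hz

theorem empty : RegularSlices (∅ : Set (X × ℝ)) := of_fst MeasurableSet.empty

theorem le_snd {a : X → ℝ} (ha : Measurable a) : RegularSlices {p : X × ℝ | a p.1 ≤ p.2} := by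
  refine ⟨measurableSet_le (ha.comp measurable_fst) measurable_snd, {a}, Set.countable_singleton a,
    by simpa using ha, fun x z (hz : z ∈ frontier (Set.Ici (a x))) => ⟨a, rfl, ?_⟩⟩
  rw [frontier_Ici] at hz
  exact hz.symm

theorem snd_le {a : X → ℝ} (ha : Measurable a) : RegularSlices {p : X × ℝ | p.2 ≤ a p.1} := by
  refine ⟨measurableSet_le measurable_snd (ha.comp measurable_fst), {a}, Set.countable_singleton a,
    by simpa using ha, fun x z (hz : z ∈ frontier (Set.Iic (a x))) => ⟨a, rfl, ?_⟩⟩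
  rw [frontier_Iic] at hz
  exact hz.symm

theorem exists_rat_of_notMem_frontier {S : Set ℝ} {z q : ℝ} (hz : z ∈ S) (hfr : z ∉ frontier S)
    (hzq : z < q) : ∃ r : ℚ, (r : ℝ) ∈ S ∧ (r : ℝ) < q := by
  have hint : z ∈ interior S := by
    by_contra hcon
    exact hfr ⟨subset_closure hz, hcon⟩
  obtain ⟨-, ⟨mem, lt⟩, r, rfl⟩ := Rat.denseRange_cast.inter_open_nonempty _
    (isOpen_interior.inter isOpen_Iio) ⟨z, hint, hzq⟩
  exact ⟨r, interior_subset mem, lt⟩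

theorem measurableSet_exists_lt (hA : RegularSlices A) (q : ℝ) :
    MeasurableSet {x | ∃ z, (x, z) ∈ A ∧ z < q} := by
  obtain ⟨meas, F, countable, measF, onGraph⟩ := hA
  have cover : {x | ∃ z, (x, z) ∈ A ∧ z < q} =
      (⋃ r : ℚ, {x | (x, (r : ℝ)) ∈ A ∧ (r : ℝ) < q}) ∪ ⋃ τ ∈ F, {x | (x, τ x) ∈ A ∧ τ x < q} := by
    ext x
    simp only [Set.mem_ofPred_eq, Set.mem_union, Set.mem_iUnion]
    constructor
    · rintro ⟨z, hz, hzq⟩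
      by_cases hfr : z ∈ frontier {z | (x, z) ∈ A}
      · obtain ⟨τ, hτ, rfl⟩ := onGraph x z hfr
        exact Or.inr ⟨τ, hτ, hz, hzq⟩
      · exact Or.inl (exists_rat_of_notMem_frontier (S := {z | (x, z) ∈ A}) hz hfr hzq)
    · rintro (⟨r, mem, lt⟩ | ⟨τ, -, mem, lt⟩)
      · exact ⟨r, mem, lt⟩
      · exact ⟨τ x, mem, lt⟩
  rw [cover]
  refine (MeasurableSet.iUnion fun r => ?_).union (MeasurableSet.biUnion countable fun τ hτ => ?_)
  · exact ((measurable_id.prodMk measurable_const) meas).inter (MeasurableSet.const _)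
  · exact ((measurable_id.prodMk (measF τ hτ)) meas).inter
      (measurableSet_lt (measF τ hτ) measurable_const)

theorem measurable_sInf_insert (hA : RegularSlices A) {b : ℝ} (hb : ∀ x z, (x, z) ∈ A → b ≤ z)
    (c : ℝ) : Measurable fun x => sInf (insert c {z : ℝ | (x, z) ∈ A}) := by
  refine measurable_of_Iio fun q => ?_
  have preimage_eq : (fun x => sInf (insert c {z : ℝ | (x, z) ∈ A})) ⁻¹' Set.Iio q =
      {_x | c < q} ∪ {x | ∃ z, (x, z) ∈ A ∧ z < q} := by
    ext x
    have bdd : BddBelow {z : ℝ | (x, z) ∈ A} := ⟨b, fun z hz => hb x z hz⟩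
    simp only [Set.mem_preimage, Set.mem_Iio, Set.mem_union, Set.mem_ofPred_eq,
      csInf_lt_iff (bdd.insert c) (Set.insert_nonempty _ _), Set.exists_mem_insert]
  rw [preimage_eq]
  exact (MeasurableSet.const _).union (hA.measurableSet_exists_lt q)

end RegularSlices

end RegularSlices

section Classifiers

variable {d : ℕ}

theorem regularSlices_cube : RegularSlices (cube d) := by
  have hbase : MeasurableSet (baseCube d) := measurableSet_Icc
  convert ((RegularSlices.of_fst hbase).inter
    (RegularSlices.le_snd (measurable_const (a := (0 : ℝ))))).inter
    (RegularSlices.snd_le (measurable_const (a := (1 : ℝ)))) using 1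
  ext x
  simp only [cube, Set.mem_prod, Set.mem_Icc, Set.mem_inter_iff, Set.mem_ofPred_eq, and_assoc]

theorem measurable_interp (T : (Fin (d - 1) → ℕ) → ℝ) (α : ℝ) (l : ℕ) :
    Measurable (interp T α l) := by
  have cell : ∀ i : Fin (d - 1), Measurable fun x : Fin (d - 1) → ℝ => cellIndex l x i := fun i =>
    (Nat.measurable_floor.comp ((measurable_pi_apply i).mul_const _)).min measurable_const
  have node : ∀ (i : Fin (d - 1)) (j : ℕ), Measurable fun x : Fin (d - 1) → ℝ =>
      cellDegree α * cellIndex l x i + j := fun i j => ((cell i).const_mul _).add_const _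
  have coord : ∀ (i : Fin (d - 1)) (j : ℕ), Measurable fun x : Fin (d - 1) → ℝ =>
      ((cellDegree α * cellIndex l x i + j : ℕ) : ℝ) / gridSize α l := fun i j =>
    (measurable_from_top.comp (node i j)).div_const _
  unfold interp
  refine Finset.measurable_sum _ fun j _ => Measurable.mul ?_ ?_
  · exact (Measurable.of_discrete (f := T)).comp (measurable_pi_lambda _ fun i => node i (j i))
  · refine Finset.measurable_prod _ fun i _ => Finset.measurable_prod _ fun j' _ => ?_
    exact ((measurable_pi_apply i).sub (coord i j')).div ((coord i (j i)).sub (coord i j'))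

theorem regularSlices_subroutine (lab : ℕ → ℕ → Point d → ℕ → Bool) (n : ℕ) (δ lam α : ℝ) :
    RegularSlices (subroutine lab n δ lam α).1 ∧ RegularSlices (subroutine lab n δ lam α).2 := by
  have meas := measurable_interp (threshold lab δ lam α (lastDepth lab n δ lam α)) α
    (lastDepth lab n δ lam α)
  simp only [subroutine]
  by_cases hl : 1 ≤ lastDepth lab n δ lam α
  · simp only [hl, true_and]
    exact ⟨regularSlices_cube.inter (RegularSlices.snd_le (meas.sub_const _)),
      regularSlices_cube.inter (RegularSlices.le_snd (meas.add_const _))⟩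
  · simp only [hl, false_and, and_false, Set.ofPred_false]
    exact ⟨RegularSlices.empty, RegularSlices.empty⟩

variable (lab : Request d → Bool) (n : ℕ) (δ lam : ℝ)

theorem regularSlices_aggregate (i : ℕ) :
    RegularSlices (aggregate lab n δ lam i).1 ∧ RegularSlices (aggregate lab n δ lam i).2 := by
  induction i with
  | zero => exact ⟨RegularSlices.empty, RegularSlices.empty⟩
  | succ i ih =>
    have hcall : RegularSlices (call lab n δ lam (i + 1)).1 ∧
      RegularSlices (call lab n δ lam (i + 1)).2 := regularSlices_subroutine _ _ _ _ _
    exact ⟨ih.1.union (hcall.1.diff ih.2), ih.2.union (hcall.2.diff ih.1)⟩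

theorem aggregate_snd_subset_cube (i : ℕ) : (aggregate lab n δ lam i).2 ⊆ cube d := by
  induction i with
  | zero => exact Set.empty_subset _
  | succ i ih => exact Set.union_subset ih (Set.sdiff_subset.trans fun _ hx => hx.1)

theorem labeledOne_subset_cube : labeledOne lab n δ lam ⊆ cube d :=
  aggregate_snd_subset_cube _ _ _ _ _

theorem classifier_eq_true_iff (x : Point d) :
    classifier lab n δ lam x = true ↔ boundaryEstimate lab n δ lam x.1 ≤ x.2 :=
  decide_eq_true_iff

theorem setClassifier_eq_true_iff (x : Point d) :
    setClassifier lab n δ lam x = true ↔ x ∈ labeledOne lab n δ lam := by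
  simp [setClassifier]

theorem measurable_classifier : Measurable (classifier lab n δ lam) := by
  refine measurable_to_bool ?_
  have meas : Measurable (boundaryEstimate lab n δ lam) :=
    (regularSlices_aggregate lab n δ lam _).2.measurable_sInf_insert
      (fun x z h => (labeledOne_subset_cube lab n δ lam h).2.1) 1
  have preimage_eq : classifier lab n δ lam ⁻¹' {true} =
      {x | boundaryEstimate lab n δ lam x.1 ≤ x.2} :=
    Set.ext (classifier_eq_true_iff lab n δ lam)
  rw [preimage_eq]
  exact measurableSet_le (meas.comp measurable_fst) measurable_snd

theorem measurable_setClassifier : Measurable (setClassifier lab n δ lam) := by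
  refine measurable_to_bool ?_
  have preimage_eq : setClassifier lab n δ lam ⁻¹' {true} = labeledOne lab n δ lam :=
    Set.ext (setClassifier_eq_true_iff lab n δ lam)
  rw [preimage_eq]
  exact (regularSlices_aggregate lab n δ lam _).2.1

end Classifiers

/-! ### Aggregation of the calls -/

section Aggregation

variable {d : ℕ} {g : (Fin (d - 1) → ℝ) → ℝ} {B : ℝ} {S s : Set (Point d) × Set (Point d)}

/-- Both labels assigned by a call are correct, relative to the boundary `g`. -/
structure CorrectLabels (g : (Fin (d - 1) → ℝ) → ℝ) (S : Set (Point d) × Set (Point d)) :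
    Prop where
  lt_of_mem_fst : ∀ x ∈ S.1, x.2 < g x.1
  le_of_mem_snd : ∀ x ∈ S.2, g x.1 ≤ x.2

/-- Every point of the cube at vertical distance at least `B` from the boundary `g` gets the correct
label. -/
structure CoversBeyond (g : (Fin (d - 1) → ℝ) → ℝ) (B : ℝ)
    (S : Set (Point d) × Set (Point d)) : Prop where
  mem_fst : ∀ x ∈ cube d, x.2 ≤ g x.1 - B → x ∈ S.1
  mem_snd : ∀ x ∈ cube d, g x.1 + B ≤ x.2 → x ∈ S.2

/-- Every point of the cube at vertical distance at least `B` from the boundary `g` gets the correct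
label, and only this label. -/
structure SettledBeyond (g : (Fin (d - 1) → ℝ) → ℝ) (B : ℝ)
    (s : Set (Point d) × Set (Point d)) : Prop where
  below : ∀ x ∈ cube d, x.2 ≤ g x.1 - B → x ∈ s.1 ∧ x ∉ s.2
  above : ∀ x ∈ cube d, g x.1 + B ≤ x.2 → x ∈ s.2 ∧ x ∉ s.1

theorem CorrectLabels.update (hs : CorrectLabels g s) (hS : CorrectLabels g S) :
    CorrectLabels g (s.1 ∪ (S.1 \ s.2), s.2 ∪ (S.2 \ s.1)) where
  lt_of_mem_fst x hx := hx.elim (hs.lt_of_mem_fst x) fun hx => hS.lt_of_mem_fst x hx.1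
  le_of_mem_snd x hx := hx.elim (hs.le_of_mem_snd x) fun hx => hS.le_of_mem_snd x hx.1

theorem CoversBeyond.update (hB : 0 < B) (hs : CorrectLabels g s) (hS : CorrectLabels g S)
    (hcov : CoversBeyond g B S) :
    SettledBeyond g B (s.1 ∪ (S.1 \ s.2), s.2 ∪ (S.2 \ s.1)) where
  below x hx hlow := by
    have not_mem : x ∉ s.2 := fun h => by linarith [hs.le_of_mem_snd x h]
    exact ⟨Or.inr ⟨hcov.mem_fst x hx hlow, not_mem⟩,
      fun h => by linarith [(hs.update hS).le_of_mem_snd x h]⟩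
  above x hx hhigh := by
    have not_mem : x ∉ s.1 := fun h => by linarith [hs.lt_of_mem_fst x h]
    exact ⟨Or.inr ⟨hcov.mem_snd x hx hhigh, not_mem⟩,
      fun h => by linarith [(hs.update hS).lt_of_mem_fst x h]⟩

theorem SettledBeyond.update (hs : SettledBeyond g B s) (S : Set (Point d) × Set (Point d)) :
    SettledBeyond g B (s.1 ∪ (S.1 \ s.2), s.2 ∪ (S.2 \ s.1)) where
  below x hx hlow :=
    have ⟨mem, not_mem⟩ := hs.below x hx hlow
    ⟨Or.inl mem, fun h => h.elim not_mem fun h => h.2 mem⟩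
  above x hx hhigh :=
    have ⟨mem, not_mem⟩ := hs.above x hx hhigh
    ⟨Or.inl mem, fun h => h.elim not_mem fun h => h.2 mem⟩

variable {lab : Request d → Bool} {n i₀ : ℕ} {δ lam : ℝ}

theorem correctLabels_aggregate (h : ∀ i, 1 ≤ i → i ≤ i₀ → CorrectLabels g (call lab n δ lam i))
    (i : ℕ) (hi : i ≤ i₀) : CorrectLabels g (aggregate lab n δ lam i) := by
  induction i with
  | zero => exact ⟨fun x hx => hx.elim, fun x hx => hx.elim⟩
  | succ i ih => exact (ih (by omega)).update (h (i + 1) (by omega) hi)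

theorem settledBeyond_aggregate (hB : 0 < B) (hi₀ : 1 ≤ i₀)
    (h : ∀ i, 1 ≤ i → i ≤ i₀ → CorrectLabels g (call lab n δ lam i))
    (hcov : CoversBeyond g B (call lab n δ lam i₀)) (i : ℕ) (hi : i₀ ≤ i) :
    SettledBeyond g B (aggregate lab n δ lam i) := by
  induction i, hi using Nat.le_induction with
  | base =>
    obtain ⟨j, rfl⟩ : ∃ j, i₀ = j + 1 := ⟨i₀ - 1, by omega⟩
    exact hcov.update hB (correctLabels_aggregate h j (by omega)) (h _ hi₀ le_rfl)
  | succ i _ ih => exact ih.update _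

theorem one_half_le_eta_iff {P : Problem d} (hη : {x ∈ cube d | 1 / 2 ≤ P.eta x} = epi g)
    {x : Point d} (hx : x ∈ cube d) : 1 / 2 ≤ P.eta x ↔ g x.1 ≤ x.2 := by
  simpa [epi, hx] using Set.ext_iff.mp hη x

theorem boundaryEstimate_le {x : Point d} (hx : x ∈ labeledOne lab n δ lam) :
    boundaryEstimate lab n δ lam x.1 ≤ x.2 :=
  csInf_le (BddBelow.insert 1 ⟨0, fun _ hz => (labeledOne_subset_cube lab n δ lam hz).2.1⟩)
    (Or.inr hx)

theorem SettledBeyond.sub_le_boundaryEstimate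
    (hs : SettledBeyond g B (aggregate lab n δ lam (logFloor n ^ 2)))
    (hB : 0 ≤ B) {x : Fin (d - 1) → ℝ} (hx : g x ≤ 1) :
    g x - B ≤ boundaryEstimate lab n δ lam x := by
  refine le_csInf (Set.insert_nonempty _ _) fun z hz => ?_
  rcases hz with rfl | hz
  · linarith
  · by_contra! hlt
    exact (hs.below (x, z) (labeledOne_subset_cube lab n δ lam hz) hlt.le).2 hz

theorem SettledBeyond.classifier_eq_bayes
    (hs : SettledBeyond g B (aggregate lab n δ lam (logFloor n ^ 2))) (hB : 0 ≤ B)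
    {P : Problem d} (hg : Set.MapsTo g (baseCube d) (Set.Icc 0 1))
    (hη : {x ∈ cube d | 1 / 2 ≤ P.eta x} = epi g) {x : Point d} (hx : x ∈ cube d)
    (hfar : B < |x.2 - g x.1|) :
    classifier lab n δ lam x = P.bayes x ∧ setClassifier lab n δ lam x = P.bayes x := by
  suffices (boundaryEstimate lab n δ lam x.1 ≤ x.2 ↔ g x.1 ≤ x.2) ∧
      (x ∈ labeledOne lab n δ lam ↔ g x.1 ≤ x.2) by
    simpa only [← classifier_eq_true_iff, ← setClassifier_eq_true_iff, ← one_half_le_eta_iff hη hx,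
      ← P.bayes_eq_true_iff, ← Bool.eq_iff_iff] using this
  rcases lt_abs.mp hfar with above | below
  · have mem := (hs.above x hx (by linarith)).1
    have le_snd : g x.1 ≤ x.2 := by linarith
    exact ⟨iff_of_true (boundaryEstimate_le mem) le_snd, iff_of_true mem le_snd⟩
  · have not_mem := (hs.below x hx (by linarith)).2
    have estimate_gt : x.2 < boundaryEstimate lab n δ lam x.1 := by
      linarith [hs.sub_le_boundaryEstimate hB (hg hx.1).2]
    have snd_lt : ¬ g x.1 ≤ x.2 := by linarith
    exact ⟨iff_of_false estimate_gt.not_ge snd_lt, iff_of_false not_mem snd_lt⟩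

end Aggregation

/-! ### Correctness of the subroutine -/

section Subroutine

variable {d : ℕ} {P : Problem d} {g : (Fin (d - 1) → ℝ) → ℝ}
  {lab : ℕ → ℕ → Point d → ℕ → Bool} {n l : ℕ} {δ lam α α' c κ : ℝ}

theorem HolderClass.mono (hg : HolderClass lam α g) (h : α' ≤ α) : HolderClass lam α' g where
  mapsTo := hg.mapsTo
  contDiffOn := hg.contDiffOn.of_le (by
    have : strictFloor α' ≤ strictFloor α := Nat.sub_le_sub_right (Nat.ceil_mono h) 1
    exact_mod_cast this)
  taylor_bound β pos le := hg.taylor_bound β pos (le.trans h)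

theorem SmoothBoundary.mono (hP : SmoothBoundary P lam α g) (h : α' ≤ α) :
    SmoothBoundary P lam α' g :=
  ⟨hP.1.mono h, hP.2⟩

theorem SmoothBoundary.isThreshold (hP : SmoothBoundary P lam α g) {x : Fin (d - 1) → ℝ}
    (hx : x ∈ baseCube d) : IsThreshold (fun z => P.eta (x, z)) (g x) where
  mem := hP.1.mapsTo hx
  half_le_iff _ hz := one_half_le_eta_iff hP.2 ⟨hx, hz⟩

theorem GeometricNoise.hasMargin (hP : GeometricNoise P c κ g) {x : Fin (d - 1) → ℝ}
    (hx : x ∈ baseCube d) : HasMargin c κ (fun z => P.eta (x, z)) (g x) :=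
  fun z hz => hP (x, z) ⟨hx, hz⟩

theorem depthPrec_pos (hlam : 0 < lam) (α : ℝ) (l : ℕ) : 0 < depthPrec lam α l := by
  rw [depthPrec]
  positivity

theorem two_le_searchDepth {ε : ℝ} (hε : 0 < ε) (hε' : ε < 1 / 4) : 2 ≤ searchDepth ε := by
  rw [searchDepth]
  refine Nat.succ_le_of_lt (Nat.lt_ceil.mpr ?_)
  rw [Real.lt_logb_iff_rpow_lt (by norm_num) (by positivity), lt_div_iff₀ (by positivity)]
  norm_num
  linarith

theorem exists_two_le_searchDepth_depthPrec (hlam : 0 < lam) (hα : 0 < α) :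
    ∃ l₀ : ℕ, ∀ l, l₀ ≤ l → 2 ≤ searchDepth (depthPrec lam α l) := by
  have ratio_lt_one : (2 : ℝ) ^ (-α) < 1 :=
    Real.rpow_lt_one_of_one_lt_of_neg one_lt_two (neg_lt_zero.mpr hα)
  obtain ⟨l₀, hl₀⟩ := exists_pow_lt_of_lt_one (show 0 < 1 / 4 / lam by positivity) ratio_lt_one
  refine ⟨l₀, fun l hl => two_le_searchDepth (depthPrec_pos hlam α l) ?_⟩
  have ratio_pow_lt : ((2 : ℝ) ^ (-α)) ^ l < 1 / 4 / lam :=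
    (pow_le_pow_of_le_one (by positivity) ratio_lt_one.le hl).trans_lt hl₀
  calc depthPrec lam α l = ((2 : ℝ) ^ (-α)) ^ l * lam := by
        rw [depthPrec, ← Real.rpow_mul_natCast zero_le_two, mul_comm lam, neg_mul, mul_comm α]
    _ < 1 / 4 := (lt_div_iff₀ hlam).mp ratio_pow_lt

theorem searchCost_le_depthCost {a : Fin (d - 1) → ℕ} (ha : ∀ i, a i ≤ gridSize α l) :
    searchCost (lineLabels lab α l a) (depthPrec lam α l) (depthConf d δ α l) ≤
      depthCost lab δ lam α l :=
  Finset.single_le_sum (f := fun a => searchCost (lineLabels lab α l a) (depthPrec lam α l)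
    (depthConf d δ α l)) (fun _ _ => zero_le)
    (Fintype.mem_piFinset.mpr fun i => Finset.mem_range_succ_iff.mpr (ha i))

theorem one_le_depthCost (hl : 2 ≤ searchDepth (depthPrec lam α l)) :
    1 ≤ depthCost lab δ lam α l :=
  (one_le_searchCost hl).trans (searchCost_le_depthCost (a := fun _ => 0) fun _ => Nat.zero_le _)

/-- The depths all of whose line searches, and those of the smaller depths, end within the
budget. -/
def completedDepths (lab : ℕ → ℕ → Point d → ℕ → Bool) (n : ℕ) (δ lam α : ℝ) : Set ℕ :=
  {l | ∑ j ∈ Finset.Icc 1 l, depthCost lab δ lam α j ≤ (n : ℕ∞)}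

theorem bddAbove_completedDepths (hlam : 0 < lam) (hα : 0 < α) :
    BddAbove (completedDepths lab n δ lam α) := by
  obtain ⟨l₀, hl₀⟩ := exists_two_le_searchDepth_depthPrec hlam hα
  refine ⟨l₀ + n, fun l (hl : ∑ j ∈ Finset.Icc 1 l, depthCost lab δ lam α j ≤ (n : ℕ∞)) => ?_⟩
  have count_le : ((l + 1 - (l₀ + 1) : ℕ) : ℕ∞) ≤ n :=
    calc ((l + 1 - (l₀ + 1) : ℕ) : ℕ∞) = ∑ _j ∈ Finset.Icc (l₀ + 1) l, (1 : ℕ∞) := by simp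
      _ ≤ ∑ j ∈ Finset.Icc (l₀ + 1) l, depthCost lab δ lam α j :=
          Finset.sum_le_sum fun j hj => one_le_depthCost (hl₀ j (by grind))
      _ ≤ ∑ j ∈ Finset.Icc 1 l, depthCost lab δ lam α j :=
          Finset.sum_le_sum_of_subset (Finset.Icc_subset_Icc_left (by omega))
      _ ≤ n := hl
  have : l + 1 - (l₀ + 1) ≤ n := by exact_mod_cast count_le
  omega

theorem lastDepth_mem_completedDepths (hlam : 0 < lam) (hα : 0 < α) :
    lastDepth lab n δ lam α ∈ completedDepths lab n δ lam α :=
  Nat.sSup_mem ⟨0, by simp [completedDepths]⟩ (bddAbove_completedDepths hlam hα)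

theorem le_lastDepth (hlam : 0 < lam) (hα : 0 < α) (hl : l ∈ completedDepths lab n δ lam α) :
    l ≤ lastDepth lab n δ lam α :=
  le_csSup (bddAbove_completedDepths hlam hα) hl

theorem depthCost_ne_top (hl : 1 ≤ l) (hcompleted : l ∈ completedDepths lab n δ lam α) :
    depthCost lab δ lam α l ≠ ⊤ :=
  ne_top_of_le_ne_top (ENat.natCast_ne_top n) <|
    (Finset.single_le_sum (f := fun j => depthCost lab δ lam α j) (fun _ _ => zero_le)
      (Finset.mem_Icc.mpr ⟨hl, le_rfl⟩)).trans hcompleted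

theorem abs_threshold_sub_le (hlam : 0 < lam) (hP : SmoothBoundary P lam α g)
    (hgood : CallGood P lab δ lam α) (hfin : depthCost lab δ lam α l ≠ ⊤)
    {a : Fin (d - 1) → ℕ} (ha : ∀ i, a i ≤ gridSize α l) :
    |threshold lab δ lam α l a - g (gridPoint α l a)| ≤ 2 * depthPrec lam α l :=
  abs_searchThreshold_sub_le (depthPrec_pos hlam α l) (hgood l a ha)
    (hP.isThreshold (gridPoint_mem ha)) (ne_top_of_le_ne_top hfin (searchCost_le_depthCost ha))

theorem abs_interp_threshold_sub_le (hd : 1 ≤ d) (hlam : 0 < lam) (hα : 0 < α)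
    (hP : SmoothBoundary P lam α g) (hgood : CallGood P lab δ lam α)
    (hfin : depthCost lab δ lam α l ≠ ⊤) {x : Fin (d - 1) → ℝ} (hx : x ∈ baseCube d) :
    |interp (threshold lab δ lam α l) α l x - g x| ≤ 3 * biasTerm d lam α l :=
  calc |interp (threshold lab δ lam α l) α l x - g x|
      ≤ (2 * depthPrec lam α l + depthPrec lam α l) * lebesgueBound d α :=
        abs_interp_sub_le hα hlam.le hP.1
          (fun _ ha => abs_threshold_sub_le hlam hP hgood hfin ha) hx
    _ = 3 * (depthPrec lam α l * lebesgueBound d α) := by ring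
    _ ≤ 3 * biasTerm d lam α l := by
        gcongr
        exact depthPrec_mul_lebesgueBound_le_biasTerm hd hα hlam.le

theorem correctLabels_subroutine (hd : 1 ≤ d) (hlam : 0 < lam) (hα : 0 < α)
    (hP : SmoothBoundary P lam α g) (hgood : CallGood P lab δ lam α) :
    CorrectLabels g (subroutine lab n δ lam α) := by
  have bias_pos := biasTerm_pos (d := d) (l := lastDepth lab n δ lam α) hα hlam
  have error_le {x : Point d} (hx : x ∈ cube d) (hl : 1 ≤ lastDepth lab n δ lam α) :=
    abs_le.mp <| abs_interp_threshold_sub_le hd hlam hα hP hgood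
      (depthCost_ne_top hl (lastDepth_mem_completedDepths hlam hα)) hx.1
  refine ⟨fun x ⟨hx, hl, below⟩ => ?_, fun x ⟨hx, hl, above⟩ => ?_⟩
  · linarith [(error_le hx hl).2]
  · linarith [(error_le hx hl).1]

theorem coversBeyond_subroutine (hd : 1 ≤ d) (hlam : 0 < lam) (hα : 0 < α)
    (hP : SmoothBoundary P lam α g) (hgood : CallGood P lab δ lam α)
    (hl : 1 ≤ lastDepth lab n δ lam α) {B : ℝ}
    (hB : 7 * biasTerm d lam α (lastDepth lab n δ lam α) ≤ B) :
    CoversBeyond g B (subroutine lab n δ lam α) := by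
  have error_le {x : Point d} (hx : x ∈ cube d) :=
    abs_le.mp <| abs_interp_threshold_sub_le hd hlam hα hP hgood
      (depthCost_ne_top hl (lastDepth_mem_completedDepths hlam hα)) hx.1
  refine ⟨fun x hx low => ⟨hx, hl, ?_⟩, fun x hx high => ⟨hx, hl, ?_⟩⟩
  · linarith [(error_le hx).1]
  · linarith [(error_le hx).2]

end Subroutine

/-! ### Number of label requests -/

/-- The number of rounds of an epoch that halves an interval of length `ℓ` is at most this constant
times `ℓ^{-2(κ-1)}` times a logarithm. -/
def roundConst (c κ : ℝ) : ℝ := 8 * (c ^ 2)⁻¹ * 8 ^ (2 * (κ - 1)) + 1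

/-- The number of labels of a line search with precision `ε` is at most this constant times
`ε^{-2(κ-1)}` times a logarithm. -/
def searchConst (c κ : ℝ) : ℝ := 3 * roundConst c κ / ((2 : ℝ) ^ (2 * (κ - 1)) - 1)

/-- The number of rounds that suffice in the epoch `k + 1`, whose interval has length `2⁻ᵏ`, if `Λ`
bounds the logarithm in its confidence radius. -/
def roundBound (c κ Λ : ℝ) (k : ℕ) : ℕ := ⌈8 * Λ / (c * (((2 : ℝ) ^ k)⁻¹ / 8) ^ (κ - 1)) ^ 2⌉₊

section SearchCost

variable {c κ Λ ε δ : ℝ} {k : ℕ}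

theorem one_le_roundConst (c κ : ℝ) : 1 ≤ roundConst c κ := by
  rw [roundConst]
  exact le_add_of_nonneg_left (by positivity)

theorem one_lt_two_rpow (hκ : 1 < κ) : 1 < (2 : ℝ) ^ (2 * (κ - 1)) :=
  Real.one_lt_rpow one_lt_two (by linarith)

theorem searchConst_pos (hκ : 1 < κ) : 0 < searchConst c κ :=
  div_pos (by linarith [one_le_roundConst c κ]) (by linarith [one_lt_two_rpow hκ])

theorem two_mul_confRadius_le {A : ℝ} {t : ℕ} (hA : 0 < A) (ht : 1 ≤ t)
    (hlog : Real.log (t / δ) ≤ Λ) (hΛ : 8 * Λ / A ^ 2 ≤ t) : 2 * confRadius δ t ≤ A := by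
  have t_pos : (0 : ℝ) < t := by exact_mod_cast ht
  have sqrt_le : Real.sqrt (Real.log (t / δ) / (2 * t)) ≤ A / 4 := by
    rw [Real.sqrt_le_left (by positivity), div_le_iff₀ (by positivity)]
    rw [div_le_iff₀ (by positivity)] at hΛ
    linarith
  rw [confRadius]
  linarith

theorem inv_two_pow_div_eight_rpow_sq (κ : ℝ) (k : ℕ) :
    ((((2 : ℝ) ^ k)⁻¹ / 8) ^ (κ - 1)) ^ 2 =
      (8 ^ (2 * (κ - 1)) * ((2 : ℝ) ^ (2 * (κ - 1))) ^ k)⁻¹ := by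
  rw [div_eq_mul_inv, ← mul_inv, ← Real.rpow_mul_natCast (by positivity),
    Real.inv_rpow (by positivity), Real.mul_rpow (by positivity) (by norm_num),
    ← Real.rpow_pow_comm (by norm_num), Nat.cast_ofNat, mul_comm (κ - 1), mul_comm (_ ^ k)]

theorem roundBound_le (hc : 0 < c) (hκ : 1 < κ) (hΛ : 1 ≤ Λ) (k : ℕ) :
    (roundBound c κ Λ k : ℝ) ≤ Λ * roundConst c κ * ((2 : ℝ) ^ (2 * (κ - 1))) ^ k := by
  have one_le_pow : 1 ≤ ((2 : ℝ) ^ (2 * (κ - 1))) ^ k := one_le_pow₀ (one_lt_two_rpow hκ).le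
  calc (roundBound c κ Λ k : ℝ)
      ≤ 8 * Λ / (c * (((2 : ℝ) ^ k)⁻¹ / 8) ^ (κ - 1)) ^ 2 + 1 :=
        (Nat.ceil_lt_add_one (by positivity)).le
    _ = Λ * (8 * (c ^ 2)⁻¹ * 8 ^ (2 * (κ - 1))) * ((2 : ℝ) ^ (2 * (κ - 1))) ^ k + 1 := by
        rw [mul_pow, inv_two_pow_div_eight_rpow_sq]
        field_simp
    _ ≤ Λ * (8 * (c ^ 2)⁻¹ * 8 ^ (2 * (κ - 1))) * ((2 : ℝ) ^ (2 * (κ - 1))) ^ k +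
          Λ * ((2 : ℝ) ^ (2 * (κ - 1))) ^ k := by
        gcongr
        exact one_le_mul_of_one_le_of_one_le hΛ one_le_pow
    _ = Λ * roundConst c κ * ((2 : ℝ) ^ (2 * (κ - 1))) ^ k := by
        rw [roundConst]
        ring

theorem two_pow_searchDepth_le (hε : 0 < ε) (hK : 2 ≤ searchDepth ε) :
    (2 : ℝ) ^ searchDepth ε ≤ ε⁻¹ := by
  have lt_logb : ((searchDepth ε - 1 : ℕ) : ℝ) < Real.logb 2 (1 / (2 * ε)) :=
    Nat.lt_ceil.mp (Nat.sub_one_lt_of_lt hK)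
  rw [Real.lt_logb_iff_rpow_lt one_lt_two (by positivity), Real.rpow_natCast] at lt_logb
  calc (2 : ℝ) ^ searchDepth ε = 2 ^ (searchDepth ε - 1) * 2 :=
        (pow_sub_one_mul (by omega) 2).symm
    _ ≤ 1 / (2 * ε) * 2 := by gcongr
    _ = ε⁻¹ := by field_simp

theorem two_rpow_pow_le (hκ : 1 ≤ κ) (hε : 0 < ε) (hk : k ≤ searchDepth ε)
    (hK : 2 ≤ searchDepth ε) : ((2 : ℝ) ^ (2 * (κ - 1))) ^ k ≤ ε⁻¹ ^ (2 * (κ - 1)) := by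
  rw [Real.rpow_pow_comm zero_le_two]
  exact Real.rpow_le_rpow (by positivity)
    ((pow_le_pow_right₀ one_le_two hk).trans (two_pow_searchDepth_le hε hK)) (by linarith)

theorem searchDepth_mul_two_pow_le (hε : 0 < ε) (hk : k ≤ searchDepth ε)
    (hK : 2 ≤ searchDepth ε) : (searchDepth ε : ℝ) * 2 ^ k ≤ ε⁻¹ ^ (2 : ℝ) :=
  have depth_le : (searchDepth ε : ℝ) ≤ 2 ^ searchDepth ε := by
    exact_mod_cast Nat.lt_two_pow_self.le
  calc (searchDepth ε : ℝ) * 2 ^ k ≤ 2 ^ searchDepth ε * 2 ^ searchDepth ε := by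
        gcongr
        exact one_le_two
    _ ≤ ε⁻¹ * ε⁻¹ := by gcongr <;> exact two_pow_searchDepth_le hε hK
    _ = ε⁻¹ ^ (2 : ℝ) := by rw [Real.rpow_two, sq]

theorem roundBound_div_epochConf_le (hκ : 1 < κ) (hc : 0 < c) (hε : 0 < ε) (hδ : 0 < δ)
    (hΛ : 1 ≤ Λ) (hk : k + 1 < searchDepth ε) :
    roundBound c κ Λ k / epochConf ε δ (k + 1) ≤ Λ * roundConst c κ * ε⁻¹ ^ (2 * κ) / δ := by
  have := one_le_roundConst c κ
  rw [epochConf, div_div_eq_mul_div]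
  refine div_le_div_of_nonneg_right ?_ hδ.le
  calc (roundBound c κ Λ k : ℝ) * (searchDepth ε * 2 ^ (k + 1))
      ≤ Λ * roundConst c κ * ε⁻¹ ^ (2 * (κ - 1)) * ε⁻¹ ^ (2 : ℝ) := by
        gcongr
        · refine (roundBound_le hc hκ hΛ k).trans ?_
          gcongr
          exact two_rpow_pow_le hκ.le hε (by omega) (by omega)
        · exact searchDepth_mul_two_pow_le hε hk.le (by omega)
    _ = Λ * roundConst c κ * ε⁻¹ ^ (2 * κ) := by
        rw [mul_assoc, ← Real.rpow_add (by positivity)]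
        ring_nf

theorem sum_three_mul_roundBound_le (hκ : 1 < κ) (hc : 0 < c) (hε : 0 < ε) (hΛ : 1 ≤ Λ) :
    ∑ i ∈ Finset.range (searchDepth ε - 1), 3 * (roundBound c κ Λ i : ℝ) ≤
      searchConst c κ * Λ * ε⁻¹ ^ (2 * (κ - 1)) := by
  have ratio_gt := one_lt_two_rpow hκ
  have searchConst_pos := searchConst_pos (c := c) hκ
  rcases lt_or_ge (searchDepth ε) 2 with hK | hK
  · rw [show searchDepth ε - 1 = 0 by omega, Finset.range_zero, Finset.sum_empty]
    positivity
  calc ∑ i ∈ Finset.range (searchDepth ε - 1), 3 * (roundBound c κ Λ i : ℝ)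
      ≤ ∑ i ∈ Finset.range (searchDepth ε - 1),
          3 * (Λ * roundConst c κ * ((2 : ℝ) ^ (2 * (κ - 1))) ^ i) := by
        gcongr
        exact roundBound_le hc hκ hΛ _
    _ = searchConst c κ * Λ * (((2 : ℝ) ^ (2 * (κ - 1))) ^ (searchDepth ε - 1) - 1) := by
        rw [← Finset.mul_sum, ← Finset.mul_sum, geom_sum_eq ratio_gt.ne', searchConst]
        ring
    _ ≤ searchConst c κ * Λ * ε⁻¹ ^ (2 * (κ - 1)) := by
        gcongr
        linarith [two_rpow_pow_le hκ.le hε (Nat.sub_le _ 1) hK]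

theorem searchCost_le_of_log_le {lab : ℕ → ℝ → ℕ → Bool} {h : ℝ → ℝ} {γ : ℝ} (hκ : 1 < κ)
    (hc : 0 < c) (hε : 0 < ε) (hδ : 0 < δ) (hgood : LineGood lab h ε δ) (hγ : IsThreshold h γ)
    (hnoise : HasMargin c κ h γ) (hΛ : 1 ≤ Λ)
    (hlog : Real.log (Λ * roundConst c κ * ε⁻¹ ^ (2 * κ) / δ) ≤ Λ) :
    searchCost lab ε δ ≤ (⌊searchConst c κ * Λ * ε⁻¹ ^ (2 * (κ - 1))⌋₊ : ℕ∞) := by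
  have rounds : ∀ k, k + 1 < searchDepth ε → 1 ≤ roundBound c κ Λ k ∧
      2 * confRadius (epochConf ε δ (k + 1)) (roundBound c κ Λ k) ≤
        c * (((2 : ℝ) ^ k)⁻¹ / 8) ^ (κ - 1) := fun k hk => by
    have one_le : 1 ≤ roundBound c κ Λ k := Nat.ceil_pos.mpr (by positivity)
    have conf_pos := epochConf_pos (ε := ε) hδ hk
    exact ⟨one_le, two_mul_confRadius_le (by positivity) one_le
      ((Real.log_le_log (by positivity)
        (roundBound_div_epochConf_le hκ hc hε hδ hΛ hk)).trans hlog) (Nat.le_ceil _)⟩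
  refine (searchCost_le hκ.le hc.le hgood hγ hnoise rounds).trans ?_
  have floor_le := Nat.le_floor (a := searchConst c κ * Λ * ε⁻¹ ^ (2 * (κ - 1)))
    (n := ∑ i ∈ Finset.range (searchDepth ε - 1), 3 * roundBound c κ Λ i)
    (by simpa using sum_three_mul_roundBound_le hκ hc hε hΛ)
  exact_mod_cast floor_le

end SearchCost

/-- The denominator `2α(κ-1) + d - 1` of the exponents in the rate of convergence. -/
def rateDenom (d : ℕ) (κ α : ℝ) : ℝ := 2 * α * (κ - 1) + d - 1

/-- The number of labels requested at depth `l` is at most this constant times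
`λ^{-2(κ-1)} 2^{l(2α(κ-1)+d-1)}` times a logarithm. -/
def depthConst (d : ℕ) (c κ α : ℝ) : ℝ := (2 * cellDegree α : ℝ) ^ (d - 1) * searchConst c κ

section DepthCost

variable {d l n : ℕ} {P : Problem d} {g : (Fin (d - 1) → ℝ) → ℝ}
  {lab : ℕ → ℕ → Point d → ℕ → Bool} {δ lam α c κ Λ : ℝ}

theorem one_le_rateDenom (hd : 2 ≤ d) (hα : 0 ≤ α) (hκ : 1 ≤ κ) : 1 ≤ rateDenom d κ α := by
  have two_le : (2 : ℝ) ≤ d := by exact_mod_cast hd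
  have nonneg : 0 ≤ 2 * α * (κ - 1) := mul_nonneg (by linarith) (by linarith)
  rw [rateDenom]
  linarith

theorem depthConst_pos (hκ : 1 < κ) : 0 < depthConst d c κ α :=
  have degree_pos := one_le_cellDegree_cast α
  mul_pos (by positivity) (searchConst_pos hκ)

theorem inv_depthPrec (lam α : ℝ) (l : ℕ) :
    (depthPrec lam α l)⁻¹ = lam⁻¹ * (2 : ℝ) ^ ((l : ℝ) * α) := by
  rw [depthPrec, mul_inv, ← Real.rpow_neg zero_le_two, neg_neg]

theorem inv_depthPrec_le (hlam : 1 ≤ lam) (α : ℝ) (l : ℕ) :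
    (depthPrec lam α l)⁻¹ ≤ (2 : ℝ) ^ ((l : ℝ) * α) := by
  rw [inv_depthPrec]
  exact mul_le_of_le_one_left (by positivity) (inv_le_one_of_one_le₀ hlam)

theorem two_rpow_rateDenom_pow (hd : 1 ≤ d) (κ α : ℝ) (l : ℕ) :
    ((2 : ℝ) ^ rateDenom d κ α) ^ l =
      (2 ^ l) ^ (d - 1) * ((2 : ℝ) ^ ((l : ℝ) * α)) ^ (2 * (κ - 1)) := by
  rw [← Real.rpow_mul zero_le_two, ← pow_mul, ← Real.rpow_natCast, ← Real.rpow_natCast,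
    ← Real.rpow_mul zero_le_two, ← Real.rpow_add zero_lt_two, rateDenom]
  congr 1
  push_cast [Nat.cast_sub hd]
  ring

theorem depthCost_le (hd : 1 ≤ d) (hlam : 0 < lam) (hκ : 1 < κ) (hc : 0 < c) (hδ : 0 < δ)
    (hP : SmoothBoundary P lam α g) (hnoise : GeometricNoise P c κ g)
    (hgood : CallGood P lab δ lam α) (hΛ : 1 ≤ Λ)
    (hlog : Real.log (Λ * roundConst c κ * (depthPrec lam α l)⁻¹ ^ (2 * κ) /
      depthConf d δ α l) ≤ Λ) :
    depthCost lab δ lam α l ≤ (⌊depthConst d c κ α * Λ * lam⁻¹ ^ (2 * (κ - 1)) *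
      ((2 : ℝ) ^ rateDenom d κ α) ^ l⌋₊ : ℕ∞) := by
  set lineBound := searchConst c κ * Λ * (depthPrec lam α l)⁻¹ ^ (2 * (κ - 1)) with lineBound_eq
  have lineBound_nonneg : 0 ≤ lineBound := by
    have := searchConst_pos (c := c) hκ
    have := depthPrec_pos hlam α l
    positivity
  have line_le : ∀ a ∈ Fintype.piFinset fun _ : Fin (d - 1) => Finset.range (gridSize α l + 1),
      searchCost (lineLabels lab α l a) (depthPrec lam α l) (depthConf d δ α l) ≤
        (⌊lineBound⌋₊ : ℕ∞) := fun a ha => by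
    have a_le : ∀ i, a i ≤ gridSize α l := fun i =>
      Finset.mem_range_succ_iff.mp (Fintype.mem_piFinset.mp ha i)
    exact searchCost_le_of_log_le hκ hc (depthPrec_pos hlam α l) (depthConf_pos hδ α l)
      (hgood l a a_le) (hP.isThreshold (gridPoint_mem a_le))
      (hnoise.hasMargin (gridPoint_mem a_le)) hΛ hlog
  have total_le : (((gridSize α l + 1) ^ (d - 1) * ⌊lineBound⌋₊ : ℕ) : ℝ) ≤
      depthConst d c κ α * Λ * lam⁻¹ ^ (2 * (κ - 1)) * ((2 : ℝ) ^ rateDenom d κ α) ^ l :=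
    calc (((gridSize α l + 1) ^ (d - 1) * ⌊lineBound⌋₊ : ℕ) : ℝ)
        = ((gridSize α l + 1 : ℕ) : ℝ) ^ (d - 1) * (⌊lineBound⌋₊ : ℝ) := by push_cast; ring
      _ ≤ (2 * cellDegree α * 2 ^ l) ^ (d - 1) * lineBound := by
          gcongr
          · exact gridSize_add_one_le α l
          · exact Nat.floor_le lineBound_nonneg
      _ = depthConst d c κ α * Λ * lam⁻¹ ^ (2 * (κ - 1)) * ((2 : ℝ) ^ rateDenom d κ α) ^ l := by
          rw [lineBound_eq, inv_depthPrec, Real.mul_rpow (by positivity) (by positivity),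
            two_rpow_rateDenom_pow hd, depthConst, mul_pow]
          ring
  refine (Finset.sum_le_card_nsmul _ _ _ line_le).trans ?_
  simp only [Fintype.card_piFinset, Finset.card_range, Finset.prod_const, Finset.card_univ,
    Fintype.card_fin, nsmul_eq_mul]
  exact_mod_cast Nat.le_floor total_le

theorem roundConst_mul_inv_depthPrec_div_depthConf_le (hlam : 1 ≤ lam) (hα : 0 ≤ α) (hκ : 0 ≤ κ)
    (hδ : 0 < δ) (hΛ : 0 ≤ Λ) {j : ℕ} (hj : j ≤ l) :
    Λ * roundConst c κ * (depthPrec lam α j)⁻¹ ^ (2 * κ) / depthConf d δ α j ≤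
      Λ * roundConst c κ * cellDegree α * ((2 : ℝ) ^ (2 * κ * α + d + 1)) ^ l / δ := by
  have roundConst_pos := one_le_roundConst c κ
  have prec_pos := depthPrec_pos (zero_lt_one.trans_le hlam) α j
  have pow_eq : ((2 : ℝ) ^ ((j : ℝ) * α)) ^ (2 * κ) * 2 ^ (j * (d + 1)) =
      ((2 : ℝ) ^ (2 * κ * α + d + 1)) ^ j := by
    rw [← Real.rpow_mul zero_le_two, ← Real.rpow_natCast, ← Real.rpow_natCast,
      ← Real.rpow_mul zero_le_two, ← Real.rpow_add zero_lt_two]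
    congr 1
    push_cast
    ring
  rw [depthConf, div_div_eq_mul_div]
  refine div_le_div_of_nonneg_right ?_ hδ.le
  calc Λ * roundConst c κ * (depthPrec lam α j)⁻¹ ^ (2 * κ) * (cellDegree α * 2 ^ (j * (d + 1)))
      ≤ Λ * roundConst c κ * ((2 : ℝ) ^ ((j : ℝ) * α)) ^ (2 * κ) *
          (cellDegree α * 2 ^ (j * (d + 1))) := by
        gcongr
        exact inv_depthPrec_le hlam α j
    _ = Λ * roundConst c κ * cellDegree α * ((2 : ℝ) ^ (2 * κ * α + d + 1)) ^ j := by
        rw [← pow_eq]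
        ring
    _ ≤ Λ * roundConst c κ * cellDegree α * ((2 : ℝ) ^ (2 * κ * α + d + 1)) ^ l := by
        gcongr
        exact Real.one_le_rpow one_le_two (by positivity)

theorem sum_pow_le_two_mul_pow {r : ℝ} (hr : 2 ≤ r) (l : ℕ) :
    ∑ j ∈ Finset.Icc 1 l, r ^ j ≤ 2 * r ^ l := by
  induction l with
  | zero => simp
  | succ l ih =>
    rw [Finset.sum_Icc_succ_top (by omega), pow_succ]
    have : 0 ≤ r ^ l := by positivity
    nlinarith

theorem le_lastDepth_of_budget (hd : 2 ≤ d) (hlam : 1 ≤ lam) (hα : 0 < α) (hκ : 1 < κ)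
    (hc : 0 < c) (hδ : 0 < δ) (hP : SmoothBoundary P lam α g) (hnoise : GeometricNoise P c κ g)
    (hgood : CallGood P lab δ lam α) (hΛ : 1 ≤ Λ)
    (hlog : Real.log (Λ * roundConst c κ * cellDegree α *
      ((2 : ℝ) ^ (2 * κ * α + d + 1)) ^ l / δ) ≤ Λ)
    (hn : 2 * depthConst d c κ α * Λ * lam⁻¹ ^ (2 * (κ - 1)) *
      ((2 : ℝ) ^ rateDenom d κ α) ^ l ≤ n) :
    l ≤ lastDepth lab n δ lam α := by
  have lam_pos : 0 < lam := zero_lt_one.trans_le hlam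
  have roundConst_pos := one_le_roundConst c κ
  set A := depthConst d c κ α * Λ * lam⁻¹ ^ (2 * (κ - 1))
  set r := (2 : ℝ) ^ rateDenom d κ α
  have A_nonneg : 0 ≤ A := by
    have := depthConst_pos (d := d) (c := c) (α := α) hκ
    positivity
  have depth_le : ∀ j ∈ Finset.Icc 1 l, depthCost lab δ lam α j ≤ (⌊A * r ^ j⌋₊ : ℕ∞) :=
    fun j hj => by
    have prec_pos := depthPrec_pos lam_pos α j
    have conf_pos := depthConf_pos (d := d) hδ α j
    exact depthCost_le (by omega) lam_pos hκ hc hδ hP hnoise hgood hΛ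
      ((Real.log_le_log (by positivity) (roundConst_mul_inv_depthPrec_div_depthConf_le hlam hα.le
        (by linarith) hδ (by linarith) (Finset.mem_Icc.mp hj).2)).trans hlog)
  have sum_le : ((∑ j ∈ Finset.Icc 1 l, ⌊A * r ^ j⌋₊ : ℕ) : ℝ) ≤ n :=
    calc ((∑ j ∈ Finset.Icc 1 l, ⌊A * r ^ j⌋₊ : ℕ) : ℝ)
        ≤ ∑ j ∈ Finset.Icc 1 l, A * r ^ j := by
          rw [Nat.cast_sum]
          gcongr
          exact Nat.floor_le (by positivity)
      _ ≤ A * (2 * r ^ l) := by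
          rw [← Finset.mul_sum]
          gcongr
          have two_le : 2 ≤ r :=
            Real.self_le_rpow_of_one_le one_le_two (one_le_rateDenom hd hα.le hκ.le)
          exact sum_pow_le_two_mul_pow two_le l
      _ ≤ n := by linarith
  refine le_lastDepth lam_pos hα ((Finset.sum_le_sum depth_le).trans ?_)
  exact_mod_cast sum_le

end DepthCost

/-! ### The exponents of the rate -/

/-- The loss `α/D - α'/D'` in the exponent of the rate when the smoothness `α` is replaced by `α'`,
where `D` and `D'` are the denominators of the exponents. -/
def exponentGap (d : ℕ) (κ α α' : ℝ) : ℝ :=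
  (d - 1) / rateDenom d κ α * ((α - α') / rateDenom d κ α')

section Rate

variable {d : ℕ} {α α' κ L x : ℝ}

theorem div_rateDenom_eq_sub_exponentGap (h : rateDenom d κ α ≠ 0) (h' : rateDenom d κ α' ≠ 0) :
    α' / rateDenom d κ α' = α / rateDenom d κ α + -exponentGap d κ α α' := by
  rw [exponentGap]
  field_simp
  rw [rateDenom, rateDenom]
  ring

theorem sub_one_div_rateDenom_eq_add_exponentGap (h : rateDenom d κ α ≠ 0)
    (h' : rateDenom d κ α' ≠ 0) :
    (d - 1) / rateDenom d κ α' =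
      (d - 1) / rateDenom d κ α + 2 * (κ - 1) * exponentGap d κ α α' := by
  rw [exponentGap]
  field_simp
  rw [rateDenom, rateDenom]
  ring

theorem exponentGap_mem_Icc (hd : 2 ≤ d) (hα' : 0 ≤ α') (hle : α' ≤ α) (hκ : 1 ≤ κ) :
    exponentGap d κ α α' ∈ Set.Icc 0 (α - α') := by
  have two_le : (2 : ℝ) ≤ d := by exact_mod_cast hd
  have denom_ge := one_le_rateDenom hd (hα'.trans hle) hκ
  have denom_ge' := one_le_rateDenom hd hα' hκ
  have ratio_nonneg : 0 ≤ (d - 1) / rateDenom d κ α := div_nonneg (by linarith) (by linarith)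
  have ratio_le : (d - 1) / rateDenom d κ α ≤ 1 := by
    rw [div_le_one (by linarith), rateDenom]
    linarith [mul_nonneg (hα'.trans hle) (sub_nonneg.mpr hκ)]
  have gap_nonneg : 0 ≤ (α - α') / rateDenom d κ α' := div_nonneg (by linarith) (by linarith)
  exact ⟨mul_nonneg ratio_nonneg gap_nonneg,
    (mul_le_of_le_one_left gap_nonneg ratio_le).trans (div_le_self (by linarith) denom_ge')⟩

theorem rpow_add_le_mul_exp {s e B : ℝ} (hx : 0 < x) (h : Real.log x * e ≤ B) :
    x ^ (s + e) ≤ x ^ s * Real.exp B := by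
  rw [Real.rpow_add hx, Real.rpow_def_of_pos hx e]
  gcongr

theorem rpow_sub_one_div_rateDenom_le (hd : 2 ≤ d) (hα' : 0 ≤ α') (hle : α' ≤ α) (hκ : 1 ≤ κ)
    (hgap : α - α' ≤ 1 / L) (hx : 1 ≤ x) (hlog : Real.log x ≤ L) :
    x ^ (((d : ℝ) - 1) / rateDenom d κ α') ≤
      x ^ (((d : ℝ) - 1) / rateDenom d κ α) * Real.exp (2 * (κ - 1)) := by
  obtain ⟨gap_nonneg, gap_le⟩ := exponentGap_mem_Icc hd hα' hle hκ
  have log_nonneg := Real.log_nonneg hx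
  have log_mul_gap_le : Real.log x * exponentGap d κ α α' ≤ 1 :=
    calc Real.log x * exponentGap d κ α α' ≤ L * (1 / L) :=
          mul_le_mul hlog (gap_le.trans hgap) gap_nonneg (log_nonneg.trans hlog)
      _ ≤ 1 := by rw [mul_one_div]; exact div_self_le_one L
  rw [sub_one_div_rateDenom_eq_add_exponentGap (α := α)
    (by linarith [one_le_rateDenom hd (hα'.trans hle) hκ])
    (by linarith [one_le_rateDenom hd hα' hκ])]
  refine rpow_add_le_mul_exp (by linarith) ?_
  nlinarith

theorem rpow_div_rateDenom_le (hd : 2 ≤ d) (hα' : 0 ≤ α') (hle : α' ≤ α) (hκ : 1 ≤ κ)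
    (hL : 0 ≤ L) (hgap : α - α' ≤ 1 / L) (hx : 0 < x) (hlog : -Real.log x ≤ 2 * L) :
    x ^ (α' / rateDenom d κ α') ≤ x ^ (α / rateDenom d κ α) * Real.exp 2 := by
  obtain ⟨gap_nonneg, gap_le⟩ := exponentGap_mem_Icc hd hα' hle hκ
  rw [div_rateDenom_eq_sub_exponentGap (α := α)
    (by linarith [one_le_rateDenom hd (hα'.trans hle) hκ])
    (by linarith [one_le_rateDenom hd hα' hκ])]
  refine rpow_add_le_mul_exp hx ?_
  calc Real.log x * -exponentGap d κ α α' = -Real.log x * exponentGap d κ α α' := by ring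
    _ ≤ 2 * L * (1 / L) := mul_le_mul hlog (gap_le.trans hgap) gap_nonneg (by positivity)
    _ ≤ 2 := by
        rw [mul_assoc, mul_one_div]
        linarith [div_self_le_one L]

end Rate

/-! ### Large samples -/

/-- The quantity `log³(n/δ)/n` whose power is the rate of convergence. -/
def sampleRate (δ : ℝ) (n : ℕ) : ℝ := Real.log (n / δ) ^ 3 / n

/-- The logarithms in the confidence radii are at most this constant times `log (n/δ)`. The `5`
covers the logarithms of this constant, of `log (n/δ)`, of `⌊log n⌋²` and of `1/δ`; the other
summand covers the powers of `2` that depend on the depth. -/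
def logConst (d : ℕ) (α κ : ℝ) : ℝ := 5 + 2 * κ * (2 * κ * α + d + 1)

/-- A call of the subroutine reaches the depths `l` at which `2^{l(2α(κ-1)+d-1)}`, times
`λ^{-2(κ-1)}`, times this constant, is at most the inverse of the sample rate. -/
def budgetConst (d : ℕ) (c κ α : ℝ) : ℝ := 4 * depthConst d c κ α * logConst d α κ + 1

/-- The constant factor of `bandWidth`. -/
def bandConst (d : ℕ) (c κ α : ℝ) : ℝ :=
  7 * (⌈α⌉₊ : ℝ) ^ (d * ⌈α⌉₊) * 2 ^ α * budgetConst d c κ α ^ α * Real.exp (2 * (κ - 1) + 2)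

/-- The distance from the boundary beyond which every point is labeled correctly, if `x` is the
sample rate. -/
def bandWidth (d : ℕ) (c κ α lam x : ℝ) : ℝ :=
  bandConst d c κ α * (lam ^ (((d : ℝ) - 1) / rateDenom d κ α) * x ^ (α / rateDenom d κ α))

/-- The parameters `λ` and `δ` are admissible, and the sample size is large enough relative to
them for the analysis of the adaptive procedure. -/
structure LargeSample (d : ℕ) (c κ α lam δ : ℝ) (n : ℕ) : Prop where
  one_le_lam : 1 ≤ lam
  conf_pos : 0 < δ
  conf_le_one : δ ≤ 1
  le_logFloor : 64 * (2 * cellDegree α : ℝ) ^ (d - 1) ≤ logFloor n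
  log_lam_le : Real.log lam ≤ logFloor n
  lam_le : lam ≤ n
  const_le : logConst d α κ * roundConst c κ * cellDegree α ≤ n
  logFloor_sq_le : 2 * (logFloor n : ℝ) ^ 2 ≤ n
  sampleRate_le : sampleRate δ n * (budgetConst d c κ α * 2 ^ rateDenom d κ α) ≤ 1

section Constants

variable {d : ℕ} {α α' κ c lam x : ℝ}

theorem five_le_logConst (d : ℕ) (hα : 0 ≤ α) (hκ : 0 ≤ κ) : 5 ≤ logConst d α κ := by
  rw [logConst]
  exact le_add_of_nonneg_right (by positivity)

theorem one_le_budgetConst (hα : 0 ≤ α) (hκ : 1 < κ) : 1 ≤ budgetConst d c κ α := by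
  have logConst_ge := five_le_logConst d hα (zero_le_one.trans hκ.le)
  have depthConst_pos := depthConst_pos (d := d) (c := c) (α := α) hκ
  rw [budgetConst]
  exact le_add_of_nonneg_left (by positivity)

theorem bandConst_pos (hα : 0 < α) (hκ : 1 < κ) : 0 < bandConst d c κ α := by
  have budgetConst_ge := one_le_budgetConst (d := d) (c := c) hα.le hκ
  rw [bandConst]
  positivity

theorem bandWidth_pos (hα : 0 < α) (hκ : 1 < κ) (hlam : 0 < lam) (hx : 0 < x) :
    0 < bandWidth d c κ α lam x := by
  have bandConst_pos := bandConst_pos (d := d) (c := c) hα hκ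
  rw [bandWidth]
  positivity

theorem depthConst_mono (hκ : 1 < κ) (h : α' ≤ α) : depthConst d c κ α' ≤ depthConst d c κ α := by
  have degree_le : (cellDegree α' : ℝ) ≤ cellDegree α := by exact_mod_cast cellDegree_mono h
  have searchConst_pos := searchConst_pos (c := c) hκ
  rw [depthConst, depthConst]
  gcongr

theorem rateDenom_mono (d : ℕ) (hκ : 1 ≤ κ) (h : α' ≤ α) : rateDenom d κ α' ≤ rateDenom d κ α := by
  rw [rateDenom, rateDenom]
  gcongr

end Constants

theorem logFloor_le_log {n : ℕ} (h : 1 ≤ logFloor n) : (logFloor n : ℝ) ≤ Real.log n :=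
  Nat.floor_le (zero_le_one.trans (Nat.one_le_floor_iff _ |>.mp h))

namespace LargeSample

variable {d n l : ℕ} {α α' κ c lam δ : ℝ}

theorem one_le_logFloor_cast (hn : LargeSample d c κ α lam δ n) : (1 : ℝ) ≤ logFloor n := by
  exact_mod_cast one_le_logFloor hn.le_logFloor

theorem logFloor_le (hn : LargeSample d c κ α lam δ n) : (logFloor n : ℝ) ≤ Real.log n :=
  logFloor_le_log (one_le_logFloor hn.le_logFloor)

theorem log_le_two_mul_logFloor (hn : LargeSample d c κ α lam δ n) :
    Real.log n ≤ 2 * logFloor n := by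
  have log_lt : Real.log n < logFloor n + 1 := Nat.lt_floor_add_one _
  linarith [hn.one_le_logFloor_cast]

theorem cast_pos (hn : LargeSample d c κ α lam δ n) : (0 : ℝ) < n :=
  (zero_lt_one.trans_le hn.one_le_lam).trans_le hn.lam_le

theorem log_div_eq (hn : LargeSample d c κ α lam δ n) :
    Real.log (n / δ) = Real.log n + Real.log (1 / δ) := by
  rw [div_eq_mul_one_div, Real.log_mul hn.cast_pos.ne' (one_div_pos.mpr hn.conf_pos).ne']

theorem log_le_log_div (hn : LargeSample d c κ α lam δ n) : Real.log n ≤ Real.log (n / δ) := by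
  rw [hn.log_div_eq]
  exact le_add_of_nonneg_right (Real.log_nonneg (one_le_one_div hn.conf_pos hn.conf_le_one))

theorem one_le_log_div (hn : LargeSample d c κ α lam δ n) : 1 ≤ Real.log (n / δ) :=
  hn.one_le_logFloor_cast.trans (hn.logFloor_le.trans hn.log_le_log_div)

theorem sampleRate_pos (hn : LargeSample d c κ α lam δ n) : 0 < sampleRate δ n :=
  div_pos (pow_pos (zero_lt_one.trans_le hn.one_le_log_div) 3) hn.cast_pos

theorem neg_log_sampleRate_le (hn : LargeSample d c κ α lam δ n) :
    -Real.log (sampleRate δ n) ≤ 2 * logFloor n := by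
  have log_pow_nonneg : 0 ≤ Real.log (Real.log (n / δ) ^ 3) :=
    Real.log_nonneg (one_le_pow₀ hn.one_le_log_div)
  have log_pow_pos := zero_lt_one.trans_le (one_le_pow₀ (n := 3) hn.one_le_log_div)
  rw [sampleRate, Real.log_div log_pow_pos.ne' hn.cast_pos.ne']
  linarith [hn.log_le_two_mul_logFloor]

theorem le_nat_div (hn : LargeSample d c κ α lam δ n) :
    (n : ℝ) / (2 * (logFloor n : ℝ) ^ 2) ≤ (n / logFloor n ^ 2 : ℕ) := by
  have sq_pos : (0 : ℝ) < (logFloor n : ℝ) ^ 2 := pow_pos (by linarith [hn.one_le_logFloor_cast]) 2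
  have lt_div_add_one : (n : ℝ) / (logFloor n : ℝ) ^ 2 < (n / logFloor n ^ 2 : ℕ) + 1 := by
    rw [← Nat.floor_div_eq_div (K := ℝ), Nat.cast_pow]
    exact Nat.lt_floor_add_one _
  have two_le : 2 ≤ (n : ℝ) / (logFloor n : ℝ) ^ 2 := (le_div_iff₀ sq_pos).mpr hn.logFloor_sq_le
  rw [mul_comm 2, ← div_div]
  linarith

theorem depth_mul_log_two_le (hn : LargeSample d c κ α lam δ n) (hd : 2 ≤ d) (hκ : 1 ≤ κ)
    (hα' : 0 ≤ α') (hl : ((2 : ℝ) ^ rateDenom d κ α') ^ l ≤ lam ^ (2 * (κ - 1)) * n) :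
    l * Real.log 2 ≤ 2 * κ * Real.log (n / δ) := by
  have lam_pos : 0 < lam := zero_lt_one.trans_le hn.one_le_lam
  have log_le := Real.log_le_log (by positivity) hl
  rw [Real.log_mul (by positivity) hn.cast_pos.ne', Real.log_pow, Real.log_rpow zero_lt_two,
    Real.log_rpow lam_pos] at log_le
  have log_lam_le : Real.log lam ≤ Real.log n := Real.log_le_log lam_pos hn.lam_le
  have log_two_nonneg : 0 ≤ Real.log 2 := Real.log_nonneg one_le_two
  calc l * Real.log 2 ≤ l * (rateDenom d κ α' * Real.log 2) := by
        gcongr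
        exact le_mul_of_one_le_left log_two_nonneg (one_le_rateDenom hd hα' hκ)
    _ ≤ 2 * (κ - 1) * Real.log lam + Real.log n := log_le
    _ ≤ 2 * (κ - 1) * Real.log (n / δ) + Real.log (n / δ) := by
        have log_le_log_div := hn.log_le_log_div
        exact add_le_add (mul_le_mul_of_nonneg_left (log_lam_le.trans log_le_log_div)
          (by linarith)) log_le_log_div
    _ ≤ 2 * κ * Real.log (n / δ) := by linarith [hn.one_le_log_div]

theorem log_two_rpow_pow_le (hn : LargeSample d c κ α lam δ n) (hd : 2 ≤ d) (hκ : 1 ≤ κ)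
    (hα' : 0 ≤ α') (hle : α' ≤ α)
    (hl : ((2 : ℝ) ^ rateDenom d κ α') ^ l ≤ lam ^ (2 * (κ - 1)) * n) :
    Real.log (((2 : ℝ) ^ (2 * κ * α' + d + 1)) ^ l) ≤
      2 * κ * (2 * κ * α + d + 1) * Real.log (n / δ) := by
  have α_nonneg := hα'.trans hle
  rw [Real.log_pow, Real.log_rpow zero_lt_two]
  calc l * ((2 * κ * α' + d + 1) * Real.log 2) = (2 * κ * α' + d + 1) * (l * Real.log 2) := by ring
    _ ≤ (2 * κ * α + d + 1) * (2 * κ * Real.log (n / δ)) := by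
        refine mul_le_mul ?_ (hn.depth_mul_log_two_le hd hκ hα' hl) (by positivity) (by positivity)
        gcongr
    _ = 2 * κ * (2 * κ * α + d + 1) * Real.log (n / δ) := by ring

theorem log_requests_le (hn : LargeSample d c κ α lam δ n) (hd : 2 ≤ d) (hκ : 1 ≤ κ)
    (hα' : 0 ≤ α') (hle : α' ≤ α)
    (hl : ((2 : ℝ) ^ rateDenom d κ α') ^ l ≤ lam ^ (2 * (κ - 1)) * n) :
    Real.log (logConst d α κ * Real.log (n / δ) * roundConst c κ * cellDegree α' *
      ((2 : ℝ) ^ (2 * κ * α' + d + 1)) ^ l / (δ / (logFloor n : ℝ) ^ 2)) ≤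
      logConst d α κ * Real.log (n / δ) := by
  have δ_pos := hn.conf_pos
  have L_ge := hn.one_le_logFloor_cast
  have logConst_ge := five_le_logConst d (hα'.trans hle) (zero_le_one.trans hκ)
  have roundConst_ge := one_le_roundConst c κ
  have degree_ge := one_le_cellDegree_cast α'
  have degree_le : (cellDegree α' : ℝ) ≤ cellDegree α := by exact_mod_cast cellDegree_mono hle
  have log_le := hn.log_le_log_div
  have log_pow_le := hn.log_two_rpow_pow_le hd hκ hα' hle hl
  have log_div_eq := hn.log_div_eq
  have ℓ_ge := hn.one_le_log_div
  set ℓ := Real.log (n / δ)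
  have log_const_le : Real.log (logConst d α κ * roundConst c κ * cellDegree α') ≤ Real.log n :=
    Real.log_le_log (by positivity) (le_trans (by gcongr) hn.const_le)
  have log_ℓ_le : Real.log ℓ ≤ ℓ := Real.log_le_self (by linarith)
  have log_logFloor_le : Real.log (logFloor n) ≤ ℓ :=
    (Real.log_le_self (by linarith)).trans (hn.logFloor_le.trans log_le)
  have log_inv_le : Real.log (1 / δ) ≤ ℓ := by linarith [hn.logFloor_le]
  calc Real.log (logConst d α κ * ℓ * roundConst c κ * cellDegree α' *
        ((2 : ℝ) ^ (2 * κ * α' + d + 1)) ^ l / (δ / (logFloor n : ℝ) ^ 2))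
      = Real.log (logConst d α κ * roundConst c κ * cellDegree α' * ℓ *
          ((2 : ℝ) ^ (2 * κ * α' + d + 1)) ^ l * (logFloor n : ℝ) ^ 2 * (1 / δ)) := by
        congr 1
        field_simp
    _ = Real.log (logConst d α κ * roundConst c κ * cellDegree α') + Real.log ℓ +
          Real.log (((2 : ℝ) ^ (2 * κ * α' + d + 1)) ^ l) + 2 * Real.log (logFloor n) +
          Real.log (1 / δ) := by
        rw [Real.log_mul (by positivity) (by positivity),
          Real.log_mul (by positivity) (by positivity),
          Real.log_mul (by positivity) (by positivity),
          Real.log_mul (by positivity) (by positivity), Real.log_pow (logFloor n : ℝ),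
          Nat.cast_ofNat]
    _ ≤ ℓ + ℓ + 2 * κ * (2 * κ * α + d + 1) * ℓ + 2 * ℓ + ℓ := by
        gcongr
        exact log_const_le.trans log_le
    _ = logConst d α κ * ℓ := by
        rw [logConst]
        ring

end LargeSample

/-! ### The depth reached by the subroutine -/

/-- The value of `2^{l(2α'(κ-1)+d-1)}` up to which the depth `l` is within the budget of a call with
smoothness `α' ≤ α`. -/
def depthTarget (d : ℕ) (c κ α lam x : ℝ) : ℝ := lam ^ (2 * (κ - 1)) / (budgetConst d c κ α * x)

section DepthTarget

variable {d n l : ℕ} {α α' κ c lam δ x D G : ℝ}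

theorem depthTarget_pos (hα : 0 ≤ α) (hκ : 1 < κ) (hlam : 0 < lam) (hx : 0 < x) :
    0 < depthTarget d c κ α lam x := by
  have budgetConst_ge := one_le_budgetConst (d := d) (c := c) hα hκ
  rw [depthTarget]
  positivity

theorem LargeSample.two_rpow_rateDenom_le_depthTarget (hn : LargeSample d c κ α lam δ n)
    (hκ : 1 < κ) (hα : 0 ≤ α) (hle : α' ≤ α) :
    (2 : ℝ) ^ rateDenom d κ α' ≤ depthTarget d c κ α lam (sampleRate δ n) := by
  have rate_pos := hn.sampleRate_pos
  have budgetConst_ge := one_le_budgetConst (d := d) (c := c) hα hκ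
  rw [depthTarget, le_div_iff₀ (by positivity)]
  calc (2 : ℝ) ^ rateDenom d κ α' * (budgetConst d c κ α * sampleRate δ n)
      ≤ 2 ^ rateDenom d κ α * (budgetConst d c κ α * sampleRate δ n) := by
        gcongr
        · exact one_le_two
        · exact rateDenom_mono d hκ.le hle
    _ = sampleRate δ n * (budgetConst d c κ α * 2 ^ rateDenom d κ α) := by ring
    _ ≤ 1 := hn.sampleRate_le
    _ ≤ lam ^ (2 * (κ - 1)) := Real.one_le_rpow hn.one_le_lam (by linarith)

theorem LargeSample.exists_depth (hn : LargeSample d c κ α lam δ n) (hd : 2 ≤ d) (hκ : 1 < κ)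
    (hα' : 0 ≤ α') (hle : α' ≤ α) :
    ∃ l, 1 ≤ l ∧
      ((2 : ℝ) ^ rateDenom d κ α') ^ l ≤ depthTarget d c κ α lam (sampleRate δ n) ∧
      depthTarget d c κ α lam (sampleRate δ n) < ((2 : ℝ) ^ rateDenom d κ α') ^ (l + 1) := by
  have base_le := hn.two_rpow_rateDenom_le_depthTarget hκ (hα'.trans hle) hle
  have one_lt_base : 1 < (2 : ℝ) ^ rateDenom d κ α' :=
    Real.one_lt_rpow one_lt_two (by linarith [one_le_rateDenom hd hα' hκ.le])
  obtain ⟨l, le_target, target_lt⟩ := exists_nat_pow_near (one_lt_base.le.trans base_le) one_lt_base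
  have lt_succ : 1 < l + 1 :=
    (pow_lt_pow_iff_right₀ one_lt_base).mp ((pow_one _).trans_lt (base_le.trans_lt target_lt))
  exact ⟨l, by omega, le_target, target_lt⟩

theorem LargeSample.depthTarget_le (hn : LargeSample d c κ α lam δ n) (hα : 0 ≤ α) (hκ : 1 < κ) :
    depthTarget d c κ α lam (sampleRate δ n) ≤ lam ^ (2 * (κ - 1)) * n := by
  have lam_pos : 0 < lam := zero_lt_one.trans_le hn.one_le_lam
  have n_pos := hn.cast_pos
  have rate_pos := hn.sampleRate_pos
  have budgetConst_ge := one_le_budgetConst (d := d) (c := c) hα hκ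
  have one_le_mul : 1 ≤ n * (budgetConst d c κ α * sampleRate δ n) :=
    calc 1 ≤ budgetConst d c κ α * Real.log (n / δ) ^ 3 :=
          one_le_mul_of_one_le_of_one_le budgetConst_ge (one_le_pow₀ hn.one_le_log_div)
      _ = n * (budgetConst d c κ α * sampleRate δ n) := by
          rw [sampleRate]
          field_simp
  rw [depthTarget, div_le_iff₀ (by positivity), mul_assoc]
  exact le_mul_of_one_le_right (by positivity) one_le_mul

theorem LargeSample.requests_le_budget (hn : LargeSample d c κ α lam δ n) (hα : 0 ≤ α) (hκ : 1 < κ)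
    (hle : α' ≤ α) :
    2 * depthConst d c κ α' * (logConst d α κ * Real.log (n / δ)) * lam⁻¹ ^ (2 * (κ - 1)) *
      depthTarget d c κ α lam (sampleRate δ n) ≤ (n / logFloor n ^ 2 : ℕ) := by
  have lam_pos : 0 < lam := zero_lt_one.trans_le hn.one_le_lam
  have n_pos := hn.cast_pos
  have L_ge := hn.one_le_logFloor_cast
  have L_le := hn.logFloor_le.trans hn.log_le_log_div
  have ℓ_ge := hn.one_le_log_div
  have budgetConst_ge := one_le_budgetConst (d := d) (c := c) hα hκ
  have logConst_ge := five_le_logConst d hα (zero_le_one.trans hκ.le)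
  rw [depthTarget, sampleRate]
  set ℓ := Real.log (n / δ)
  calc 2 * depthConst d c κ α' * (logConst d α κ * ℓ) * lam⁻¹ ^ (2 * (κ - 1)) *
        (lam ^ (2 * (κ - 1)) / (budgetConst d c κ α * (ℓ ^ 3 / n)))
      = 4 * depthConst d c κ α' * logConst d α κ / budgetConst d c κ α * (n / (2 * ℓ ^ 2)) := by
        rw [Real.inv_rpow lam_pos.le]
        field_simp
        ring
    _ ≤ 1 * (n / (2 * ℓ ^ 2)) := by
        gcongr
        rw [div_le_one (by linarith), budgetConst]
        exact le_add_of_le_of_nonneg (by gcongr; exact depthConst_mono hκ hle) zero_le_one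
    _ ≤ n / (2 * (logFloor n : ℝ) ^ 2) := by
        rw [one_mul]
        gcongr
    _ ≤ (n / logFloor n ^ 2 : ℕ) := hn.le_nat_div

theorem depthPrec_le_of_le_pow (hD : 0 < D) (hα : 0 ≤ α) (hlam : 0 ≤ lam) (hG : 0 < G)
    (hl : G ≤ ((2 : ℝ) ^ D) ^ (l + 1)) :
    depthPrec lam α l ≤ 2 ^ α * (lam * G⁻¹ ^ (α / D)) := by
  have rpow_le : G ^ (α / D) ≤ 2 ^ α * 2 ^ ((l : ℝ) * α) :=
    calc G ^ (α / D) ≤ (((2 : ℝ) ^ D) ^ (l + 1)) ^ (α / D) :=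
          Real.rpow_le_rpow hG.le hl (by positivity)
      _ = 2 ^ α * 2 ^ ((l : ℝ) * α) := by
          rw [← Real.rpow_natCast, ← Real.rpow_mul (by positivity), ← Real.rpow_mul zero_le_two,
            ← Real.rpow_add zero_lt_two]
          congr 1
          push_cast
          field_simp
          ring
  rw [depthPrec, mul_left_comm, Real.inv_rpow hG.le, Real.rpow_neg zero_le_two]
  refine mul_le_mul_of_nonneg_left ?_ hlam
  rwa [← div_eq_mul_inv, le_div_iff₀ (by positivity), inv_mul_le_iff₀ (by positivity), mul_comm]

theorem ceil_pow_mul_ceil_mono (d : ℕ) (hα : 0 < α) (hle : α' ≤ α) :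
    (⌈α'⌉₊ : ℝ) ^ (d * ⌈α'⌉₊) ≤ (⌈α⌉₊ : ℝ) ^ (d * ⌈α⌉₊) := by
  have ceil_le : ⌈α'⌉₊ ≤ ⌈α⌉₊ := Nat.ceil_mono hle
  calc (⌈α'⌉₊ : ℝ) ^ (d * ⌈α'⌉₊) ≤ (⌈α⌉₊ : ℝ) ^ (d * ⌈α'⌉₊) := by gcongr
    _ ≤ (⌈α⌉₊ : ℝ) ^ (d * ⌈α⌉₊) :=
        pow_le_pow_right₀ (one_le_ceil_cast hα) (Nat.mul_le_mul_left d ceil_le)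

theorem mul_inv_depthTarget_rpow (hD : rateDenom d κ α' ≠ 0) (hE : 0 ≤ budgetConst d c κ α)
    (hlam : 0 < lam) (hx : 0 ≤ x) :
    lam * (depthTarget d c κ α lam x)⁻¹ ^ (α' / rateDenom d κ α') =
      budgetConst d c κ α ^ (α' / rateDenom d κ α') *
        (lam ^ (((d : ℝ) - 1) / rateDenom d κ α') * x ^ (α' / rateDenom d κ α')) := by
  have exponent_eq : ((d : ℝ) - 1) / rateDenom d κ α' =
      1 + -(2 * (κ - 1)) * (α' / rateDenom d κ α') := by
    field_simp
    rw [rateDenom]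
    ring
  rw [depthTarget, inv_div, div_eq_mul_inv, ← Real.rpow_neg hlam.le,
    Real.mul_rpow (by positivity) (by positivity), Real.mul_rpow hE hx, ← Real.rpow_mul hlam.le,
    exponent_eq, Real.rpow_add hlam, Real.rpow_one]
  ring

theorem LargeSample.mul_inv_depthTarget_rpow_le (hn : LargeSample d c κ α lam δ n) (hd : 2 ≤ d)
    (hκ : 1 < κ) (hα' : 0 < α') (hle : α' ≤ α) (hgap : α - α' ≤ 1 / (logFloor n : ℝ)) :
    lam * (depthTarget d c κ α lam (sampleRate δ n))⁻¹ ^ (α' / rateDenom d κ α') ≤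
      budgetConst d c κ α ^ α *
        ((lam ^ (((d : ℝ) - 1) / rateDenom d κ α) * Real.exp (2 * (κ - 1))) *
          (sampleRate δ n ^ (α / rateDenom d κ α) * Real.exp 2)) := by
  have rate_pos := hn.sampleRate_pos
  have lam_pos : 0 < lam := zero_lt_one.trans_le hn.one_le_lam
  have denom_ge := one_le_rateDenom hd hα'.le hκ.le
  have budgetConst_ge := one_le_budgetConst (d := d) (c := c) (hα'.le.trans hle) hκ
  rw [mul_inv_depthTarget_rpow (by linarith) (by linarith) lam_pos rate_pos.le]
  gcongr ?_ * (?_ * ?_)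
  · exact Real.rpow_le_rpow_of_exponent_le budgetConst_ge ((div_le_self hα'.le denom_ge).trans hle)
  · exact rpow_sub_one_div_rateDenom_le hd hα'.le hle hκ.le hgap hn.one_le_lam hn.log_lam_le
  · exact rpow_div_rateDenom_le hd hα'.le hle hκ.le (Nat.cast_nonneg _) hgap rate_pos
      hn.neg_log_sampleRate_le

theorem LargeSample.seven_mul_biasTerm_le (hn : LargeSample d c κ α lam δ n) (hd : 2 ≤ d)
    (hκ : 1 < κ) (hα' : 0 < α') (hle : α' ≤ α) (hgap : α - α' ≤ 1 / (logFloor n : ℝ))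
    (hl : depthTarget d c κ α lam (sampleRate δ n) ≤ ((2 : ℝ) ^ rateDenom d κ α') ^ (l + 1)) :
    7 * biasTerm d lam α' l ≤ bandWidth d c κ α lam (sampleRate δ n) := by
  have α_pos := hα'.trans_le hle
  have lam_pos : 0 < lam := zero_lt_one.trans_le hn.one_le_lam
  have denom_ge := one_le_rateDenom hd hα'.le hκ.le
  have target_pos := depthTarget_pos (d := d) (c := c) α_pos.le hκ lam_pos hn.sampleRate_pos
  set G := depthTarget d c κ α lam (sampleRate δ n)
  calc 7 * biasTerm d lam α' l
      ≤ 7 * ((⌈α⌉₊ : ℝ) ^ (d * ⌈α⌉₊) * (2 ^ α * (lam * G⁻¹ ^ (α' / rateDenom d κ α')))) := by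
        refine mul_le_mul_of_nonneg_left ((biasTerm_le hα' lam_pos.le).trans ?_) (by norm_num)
        refine mul_le_mul (ceil_pow_mul_ceil_mono d α_pos hle) ?_ (depthPrec_nonneg lam_pos.le)
          (by positivity)
        refine (depthPrec_le_of_le_pow (by linarith) hα'.le lam_pos.le target_pos hl).trans ?_
        gcongr
        exact one_le_two
    _ ≤ 7 * ((⌈α⌉₊ : ℝ) ^ (d * ⌈α⌉₊) * (2 ^ α * (budgetConst d c κ α ^ α *
          ((lam ^ (((d : ℝ) - 1) / rateDenom d κ α) * Real.exp (2 * (κ - 1))) *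
            (sampleRate δ n ^ (α / rateDenom d κ α) * Real.exp 2))))) := by
        have target_le := hn.mul_inv_depthTarget_rpow_le (c := c) hd hκ hα' hle hgap
        gcongr
    _ = bandWidth d c κ α lam (sampleRate δ n) := by
        rw [bandWidth, bandConst, Real.exp_add]
        ring

end DepthTarget

section LastDepth

variable {d n : ℕ} {α α' κ c lam δ : ℝ} {P : Problem d} {g : (Fin (d - 1) → ℝ) → ℝ}
  {lab : ℕ → ℕ → Point d → ℕ → Bool}

theorem LargeSample.depthTarget_le_lastDepth (hn : LargeSample d c κ α lam δ n) (hd : 2 ≤ d)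
    (hκ : 1 < κ) (hc : 0 < c) (hα' : 0 < α') (hle : α' ≤ α) (hP : SmoothBoundary P lam α' g)
    (hnoise : GeometricNoise P c κ g)
    (hgood : CallGood P lab (δ / (logFloor n : ℝ) ^ 2) lam α') :
    1 ≤ lastDepth lab (n / logFloor n ^ 2) (δ / (logFloor n : ℝ) ^ 2) lam α' ∧
      depthTarget d c κ α lam (sampleRate δ n) ≤ ((2 : ℝ) ^ rateDenom d κ α') ^
        (lastDepth lab (n / logFloor n ^ 2) (δ / (logFloor n : ℝ) ^ 2) lam α' + 1) := by
  have α_nonneg := hα'.le.trans hle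
  have lam_pos : 0 < lam := zero_lt_one.trans_le hn.one_le_lam
  have conf_pos : 0 < δ / (logFloor n : ℝ) ^ 2 :=
    div_pos hn.conf_pos (pow_pos (by linarith [hn.one_le_logFloor_cast]) 2)
  have logConst_ge := five_le_logConst d α_nonneg (zero_le_one.trans hκ.le)
  have depthConst_pos := depthConst_pos (d := d) (c := c) (α := α') hκ
  have ℓ_ge := hn.one_le_log_div
  have one_le_base : 1 ≤ (2 : ℝ) ^ rateDenom d κ α' :=
    Real.one_le_rpow one_le_two (by linarith [one_le_rateDenom hd hα'.le hκ.le])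
  obtain ⟨l, one_le, le_target, target_lt⟩ := hn.exists_depth (c := c) hd hκ hα'.le hle
  have le_last : l ≤ lastDepth lab (n / logFloor n ^ 2) (δ / (logFloor n : ℝ) ^ 2) lam α' := by
    refine le_lastDepth_of_budget hd hn.one_le_lam hα' hκ hc conf_pos hP hnoise hgood
      (one_le_mul_of_one_le_of_one_le (by linarith) ℓ_ge)
      (hn.log_requests_le hd hκ.le hα'.le hle (le_target.trans (hn.depthTarget_le α_nonneg hκ)))
      (le_trans ?_ (hn.requests_le_budget α_nonneg hκ hle))
    gcongr
  exact ⟨one_le.trans le_last, target_lt.le.trans (pow_le_pow_right₀ one_le_base (by omega))⟩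

end LastDepth

section SampleThreshold

open Filter Topology

variable {d : ℕ} {c κ α lam δ Δ₀ : ℝ}

theorem tendsto_logFloor : Tendsto (fun n : ℕ => (logFloor n : ℝ)) atTop atTop :=
  tendsto_natCast_atTop_atTop.comp (tendsto_nat_floor_atTop.comp
    (Real.tendsto_log_atTop.comp tendsto_natCast_atTop_atTop))

theorem tendsto_log_pow_div (k : ℕ) : Tendsto (fun y => Real.log y ^ k / y) atTop (𝓝 0) := by
  simpa using Real.tendsto_pow_log_div_mul_add_atTop 1 0 k one_ne_zero

theorem tendsto_sampleRate (hδ : 0 < δ) : Tendsto (sampleRate δ) atTop (𝓝 0) := by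
  have ratio_tendsto : Tendsto (fun n : ℕ => (n : ℝ) / δ) atTop atTop :=
    tendsto_natCast_atTop_atTop.atTop_div_const hδ
  have rate_tendsto := ((tendsto_log_pow_div 3).comp ratio_tendsto).div_const δ
  rw [zero_div] at rate_tendsto
  refine rate_tendsto.congr fun n => ?_
  rw [Function.comp_apply, div_div, div_mul_cancel₀ _ hδ.ne', sampleRate]

theorem tendsto_bandWidth (hs : 0 < α / rateDenom d κ α) (hδ : 0 < δ) :
    Tendsto (fun n => bandWidth d c κ α lam (sampleRate δ n)) atTop (𝓝 0) := by
  have rpow_tendsto := (tendsto_sampleRate hδ).rpow_const (Or.inr hs.le)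
  rw [Real.zero_rpow hs.ne'] at rpow_tendsto
  have band_tendsto := (rpow_tendsto.const_mul
    (lam ^ (((d : ℝ) - 1) / rateDenom d κ α))).const_mul (bandConst d c κ α)
  rwa [mul_zero, mul_zero] at band_tendsto

theorem eventually_two_mul_logFloor_sq_le : ∀ᶠ n : ℕ in atTop, 2 * (logFloor n : ℝ) ^ 2 ≤ n := by
  have ratio_le := ((tendsto_log_pow_div 2).comp
    (tendsto_natCast_atTop_atTop (R := ℝ))).eventually_le_const one_half_pos
  filter_upwards [ratio_le, tendsto_logFloor.eventually_ge_atTop 1, eventually_gt_atTop 0]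
    with n log_sq_le one_le n_pos
  rw [Function.comp_apply, div_le_iff₀ (Nat.cast_pos.mpr n_pos)] at log_sq_le
  have logFloor_sq_le : (logFloor n : ℝ) ^ 2 ≤ Real.log n ^ 2 :=
    pow_le_pow_left₀ (Nat.cast_nonneg _) (logFloor_le_log (by exact_mod_cast one_le)) 2
  linarith

theorem eventually_largeSample (hlam : 1 ≤ lam) (hδ : 0 < δ) (hδ1 : δ ≤ 1) :
    ∀ᶠ n in atTop, LargeSample d c κ α lam δ n := by
  have rate_tendsto := (tendsto_sampleRate hδ).mul_const
    (budgetConst d c κ α * 2 ^ rateDenom d κ α)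
  rw [zero_mul] at rate_tendsto
  filter_upwards [tendsto_logFloor.eventually_ge_atTop _, tendsto_logFloor.eventually_ge_atTop _,
    (tendsto_natCast_atTop_atTop (R := ℝ)).eventually_ge_atTop _,
    (tendsto_natCast_atTop_atTop (R := ℝ)).eventually_ge_atTop _,
    eventually_two_mul_logFloor_sq_le, rate_tendsto.eventually_le_const zero_lt_one]
    with n le_logFloor log_lam_le lam_le const_le logFloor_sq_le sampleRate_le
  exact ⟨hlam, hδ, hδ1, le_logFloor, log_lam_le, lam_le, const_le, logFloor_sq_le, sampleRate_le⟩

theorem exists_sampleThreshold (hd : 2 ≤ d) (hα : 0 < α) (hκ : 1 ≤ κ) (hΔ₀ : 0 < Δ₀) (c : ℝ) :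
    ∃ N : ℝ → ℝ → ℕ, ∀ lam δ, 1 ≤ lam → 0 < δ → δ ≤ 1 → ∀ n, N lam δ ≤ n →
      LargeSample d c κ α lam δ n ∧ bandWidth d c κ α lam (sampleRate δ n) ≤ Δ₀ := by
  have exponent_pos : 0 < α / rateDenom d κ α :=
    div_pos hα (zero_lt_one.trans_le (one_le_rateDenom hd hα.le hκ))
  have exists_threshold (lam δ : ℝ) : ∃ N : ℕ, 1 ≤ lam → 0 < δ → δ ≤ 1 → ∀ n, N ≤ n →
      LargeSample d c κ α lam δ n ∧ bandWidth d c κ α lam (sampleRate δ n) ≤ Δ₀ := by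
    by_cases h : 1 ≤ lam ∧ 0 < δ ∧ δ ≤ 1
    · obtain ⟨N, hN⟩ := eventually_atTop.mp <| (eventually_largeSample h.1 h.2.1 h.2.2).and <|
        (tendsto_bandWidth exponent_pos h.2.1).eventually_le_const hΔ₀
      exact ⟨N, fun _ _ _ => hN⟩
    · exact ⟨0, fun hlam hδ hδ1 => absurd ⟨hlam, hδ, hδ1⟩ h⟩
  choose N hN using exists_threshold
  exact ⟨N, hN⟩

end SampleThreshold

/-! ### The adaptive procedure on the good event -/

/-- The index of the last call whose smoothness parameter is at most `α`. -/
def bestCall (α : ℝ) (n : ℕ) : ℕ := ⌊α * logFloor n⌋₊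

section BestCall

variable {n i : ℕ} {α : ℝ}

theorem one_le_bestCall (hL : 0 < logFloor n) (hα : 1 / (logFloor n : ℝ) ≤ α) :
    1 ≤ bestCall α n := by
  rwa [bestCall, Nat.one_le_floor_iff, ← div_le_iff₀ (Nat.cast_pos.mpr hL)]

theorem bestCall_le_sq (hα : α ≤ logFloor n) : bestCall α n ≤ logFloor n ^ 2 := by
  refine Nat.floor_le_of_le ?_
  rw [Nat.cast_pow, sq]
  gcongr

theorem div_logFloor_le_of_le_bestCall (hα : 0 ≤ α) (hL : 0 < logFloor n) (hi : i ≤ bestCall α n) :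
    (i : ℝ) / logFloor n ≤ α := by
  rw [div_le_iff₀ (Nat.cast_pos.mpr hL)]
  exact (Nat.le_floor_iff (by positivity)).mp hi

theorem sub_bestCall_div_logFloor_le (hL : 0 < logFloor n) :
    α - (bestCall α n : ℝ) / logFloor n ≤ 1 / (logFloor n : ℝ) := by
  rw [sub_le_iff_le_add, ← add_div, le_div_iff₀ (Nat.cast_pos.mpr hL), add_comm]
  exact (Nat.lt_floor_add_one _).le

end BestCall

section GoodEvent

variable {d n : ℕ} {P : Problem d} {g : (Fin (d - 1) → ℝ) → ℝ} {c κ κ' CM Δ₀ α lam δ x : ℝ}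
  {lab : Request d → Bool}

theorem LargeSample.settledBeyond (hn : LargeSample d c κ α lam δ n) (hd : 2 ≤ d) (hκ : 1 < κ)
    (hc : 0 < c) (hα : 1 / (logFloor n : ℝ) ≤ α) (hα' : α ≤ logFloor n)
    (hP : SmoothBoundary P lam α g) (hnoise : GeometricNoise P c κ g)
    (hgood : AllGood P lab n δ lam α) :
    SettledBeyond g (bandWidth d c κ α lam (sampleRate δ n))
      (aggregate lab n δ lam (logFloor n ^ 2)) := by
  have lam_pos : 0 < lam := zero_lt_one.trans_le hn.one_le_lam
  have L_pos : 0 < logFloor n := one_le_logFloor hn.le_logFloor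
  have α_pos : 0 < α := lt_of_lt_of_le (by positivity) hα
  have one_le_best := one_le_bestCall L_pos hα
  have best_le := bestCall_le_sq hα'
  have smoothness_pos {i : ℕ} (hi : 1 ≤ i) : 0 < (i : ℝ) / logFloor n := by positivity
  have smoothness_le {i : ℕ} (hi : i ≤ bestCall α n) :=
    div_logFloor_le_of_le_bestCall α_pos.le L_pos hi
  have callGood {i : ℕ} (h1 : 1 ≤ i) (hi : i ≤ bestCall α n) :=
    hgood i h1 (hi.trans best_le) (smoothness_le hi)
  obtain ⟨one_le_depth, target_le⟩ := hn.depthTarget_le_lastDepth hd hκ hc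
    (smoothness_pos one_le_best) (smoothness_le le_rfl) (hP.mono (smoothness_le le_rfl)) hnoise
    (callGood one_le_best le_rfl)
  refine settledBeyond_aggregate (bandWidth_pos α_pos hκ lam_pos hn.sampleRate_pos) one_le_best
    (fun i h1 hi => ?_) ?_ _ best_le
  · exact correctLabels_subroutine (by omega) lam_pos (smoothness_pos h1)
      (hP.mono (smoothness_le hi)) (callGood h1 hi)
  · exact coversBeyond_subroutine (by omega) lam_pos (smoothness_pos one_le_best)
      (hP.mono (smoothness_le le_rfl)) (callGood one_le_best le_rfl) one_le_depth
      (hn.seven_mul_biasTerm_le hd hκ (smoothness_pos one_le_best) (smoothness_le le_rfl)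
        (sub_bestCall_div_logFloor_le L_pos) target_le)

theorem SettledBeyond.excessRisk_le {B : ℝ}
    (hs : SettledBeyond g B (aggregate lab n δ lam (logFloor n ^ 2))) (hB : B ∈ Set.Icc 0 Δ₀)
    (hP : SmoothBoundary P lam α g) (hmass : BoundaryMass P CM Δ₀ κ' g) :
    P.excessRisk (classifier lab n δ lam) ≤ CM * B ^ κ' ∧
      P.excessRisk (setClassifier lab n δ lam) ≤ CM * B ^ κ' :=
  have eq_bayes {x : Point d} (hx : x ∈ cube d) (hfar : B < |x.2 - g x.1|) :=
    hs.classifier_eq_bayes hB.1 hP.1.mapsTo hP.2 hx hfar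
  ⟨hmass.excessRisk_le hB (measurable_classifier lab n δ lam) fun _ hx hfar =>
    (eq_bayes hx hfar).1,
   hmass.excessRisk_le hB (measurable_setClassifier lab n δ lam) fun _ hx hfar =>
    (eq_bayes hx hfar).2⟩

theorem bandWidth_rpow (hα : 0 < α) (hκ : 1 < κ) (hlam : 0 ≤ lam) (hx : 0 ≤ x) :
    bandWidth d c κ α lam x ^ κ' =
      bandConst d c κ α ^ κ' * lam ^ (κ' * ((d : ℝ) - 1) / rateDenom d κ α) *
        x ^ (α * κ' / rateDenom d κ α) := by
  have bandConst_pos := bandConst_pos (d := d) (c := c) hα hκ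
  rw [bandWidth, Real.mul_rpow bandConst_pos.le (by positivity),
    Real.mul_rpow (by positivity) (by positivity), ← Real.rpow_mul hlam, ← Real.rpow_mul hx,
    div_mul_eq_mul_div, div_mul_eq_mul_div, mul_comm κ', mul_assoc]

theorem LargeSample.excessRisk_le (hn : LargeSample d c κ α lam δ n) (hd : 2 ≤ d) (hκ : 1 < κ)
    (hc : 0 < c) (hα : 1 / (logFloor n : ℝ) ≤ α) (hα' : α ≤ logFloor n)
    (hB : bandWidth d c κ α lam (sampleRate δ n) ≤ Δ₀) (hP : SmoothBoundary P lam α g)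
    (hnoise : GeometricNoise P c κ g) (hmass : BoundaryMass P CM Δ₀ κ' g)
    (hgood : AllGood P lab n δ lam α) :
    P.excessRisk (classifier lab n δ lam) ≤ CM * bandWidth d c κ α lam (sampleRate δ n) ^ κ' ∧
      P.excessRisk (setClassifier lab n δ lam) ≤
        CM * bandWidth d c κ α lam (sampleRate δ n) ^ κ' := by
  have L_pos : 0 < logFloor n := one_le_logFloor hn.le_logFloor
  have α_pos : 0 < α := lt_of_lt_of_le (by positivity) hα
  have width_pos := bandWidth_pos (d := d) (c := c) α_pos hκ
    (zero_lt_one.trans_le hn.one_le_lam) hn.sampleRate_pos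
  exact (hn.settledBeyond hd hκ hc hα hα' hP hnoise hgood).excessRisk_le ⟨width_pos.le, hB⟩ hP hmass

end GoodEvent

end ActiveBoundary

end

theorem corollary1 (d : ℕ) (hd : 2 ≤ d) (c : ℝ) (hc : 0 < c) (α : ℝ) (hα : 0 < α)
    (κ : ℝ) (hκ : 1 < κ) (Δ₀ : ℝ) (hΔ₀ : 0 < Δ₀) :
    -- the sample size threshold depends on `λ` and `δ` (and on `d`, `c`, `α`, `κ`, `Δ₀`) only
    ∃ N : ℝ → ℝ → ℕ,
      ∀ κ' CM : ℝ, 0 < κ' → 0 < CM →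
        -- the constant `C` does not depend on `λ`, `n`, `δ`, nor on the problem
        ∃ C : ℝ, 0 < C ∧
          ∀ lam δ : ℝ, 1 ≤ lam → 0 < δ →
          ∀ n : ℕ, N lam δ ≤ n →
            1 / (ActiveBoundary.logFloor n : ℝ) ≤ α → α ≤ (ActiveBoundary.logFloor n : ℝ) →
          ∀ (P : ActiveBoundary.Problem d) (g : (Fin (d - 1) → ℝ) → ℝ),
            ActiveBoundary.SmoothBoundary P lam α g →
            ActiveBoundary.GeometricNoise P c κ g →
            ActiveBoundary.BoundaryMass P CM Δ₀ κ' g →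
          ∀ (Ω : Type*) [MeasurableSpace Ω] (μ : MeasureTheory.Measure Ω)
            [MeasureTheory.IsProbabilityMeasure μ] (Y : ActiveBoundary.Request d → Ω → Bool),
            ActiveBoundary.IsLabelOracle P μ Y →
            let bound : ℝ :=
              C * lam ^ (κ' * ((d : ℝ) - 1) / (2 * α * (κ - 1) + (d : ℝ) - 1)) *
                (Real.log ((n : ℝ) / δ) ^ 3 / (n : ℝ)) ^
                  (α * κ' / (2 * α * (κ - 1) + (d : ℝ) - 1))
            ENNReal.ofReal (1 - 2 * δ) ≤
              μ {ω | P.excessRisk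
                        (ActiveBoundary.classifier (fun r => Y r ω) n δ lam) ≤ bound ∧
                     P.excessRisk
                        (ActiveBoundary.setClassifier (fun r => Y r ω) n δ lam) ≤ bound} := by
  obtain ⟨N, hN⟩ := ActiveBoundary.exists_sampleThreshold hd hα hκ.le hΔ₀ c
  refine ⟨N, fun κ' CM _ hCM => ⟨CM * ActiveBoundary.bandConst d c κ α ^ κ', by
    have bandConst_pos := ActiveBoundary.bandConst_pos (d := d) (c := c) hα hκ
    positivity, ?_⟩⟩
  intro lam δ hlam hδ n hn hαL hαL' P g hP hnoise hmass Ω _ μ _ Y hY bound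
  obtain hδ2 | hδ2 := le_or_gt (1 / 2) δ
  · rw [ENNReal.ofReal_of_nonpos (by linarith)]
    exact zero_le
  have hδ1 : δ ≤ 1 := by linarith
  obtain ⟨hlarge, hwidth⟩ := hN lam δ hlam hδ hδ1 n hn
  have bound_eq : CM * ActiveBoundary.bandWidth d c κ α lam (ActiveBoundary.sampleRate δ n) ^ κ' =
      bound := by
    rw [ActiveBoundary.bandWidth_rpow hα hκ (by linarith) hlarge.sampleRate_pos.le, ← mul_assoc,
      ← mul_assoc]
    rfl
  calc ENNReal.ofReal (1 - 2 * δ) ≤ ENNReal.ofReal (1 - δ) :=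
        ENNReal.ofReal_le_ofReal (by linarith)
    _ ≤ μ {ω | ActiveBoundary.AllGood P (fun r => Y r ω) n δ lam α} :=
        ActiveBoundary.ofReal_one_sub_le_measure_allGood hY hδ hδ1 hlarge.le_logFloor
    _ ≤ _ := MeasureTheory.measure_mono fun ω hω => by
        rw [Set.mem_ofPred_eq, ← bound_eq]
        exact hlarge.excessRisk_le hd hκ hc hαL hαL' hwidth hP hnoise hmass hω
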